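/- Let $M$ be a smooth (Hausdorff, second countable) manifold of dimension $4n\ge 8$ and let $Q\subset\mathrm{End}(TM)$ be a rank three subbundle which is locally generated by three smooth almost complex structures $J_1,J_2,J_3$ with $J_1J_2=J_3$ (an admissible basis). Let $D$ be a quaternionic connection, i.e. a smooth torsion-free linear connection on $M$ preserving $Q$ (so that $(M,Q)$ is a quaternionic manifold). Endow $Q$ with the Euclidean metric $\langle A,B\rangle=-\frac{1}{4n}\mathrm{tr}(AB)$, for which every admissible basis is orthonormal. Let $\pi:Z\to M$ be the twistor space, $Z=\{(p,J): p\in M,\ J\in Q_p,\ J^2=-\mathrm{Id}\}$, with its smooth structure as the unit sphere bundle of $Q$, and with the complex structure $\mathcal J$ defined as follows: a quaternionic connection $D_0$ splits $T_JZ$ into the vertical space $T_JZ_p=\{A\in Q_p: AJ=-JA\}=J^\perp\subset Q_p$ and a horizontal space identified with $T_pM$ by $\pi_*$; $\mathcal J$ is $A\mapsto J\circ A$ on the former and $J$ on the latter. ($\mathcal J$ does not depend on $D_0$.) Let $\Theta\to Z$ be the vertical tangent bundle, $\Theta_J=T_JZ_p=J^\perp$, a complex line bundle with the complex structure $\mathcal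 J A=J\circ A$ and the hermitian metric $h(A,B)=\frac12\left(\langle A,B\rangle-i\langle\mathcal JA,B\rangle\right)$, and let $\Pi:\pi^*Q\to\Theta$, $\Pi_J(A)=\frac12(A+JAJ)=A-\langle A,J\rangle J$, be the orthogonal projection. Put $\nabla:=\Pi\circ\pi^*D$, acting on sections of $\Theta\subset\pi^*Q$. Then $\nabla$ is a hermitian connection on $\Theta$, that is, a connection on $\Theta$ with $\nabla\mathcal J=0$ and $\nabla h=0$. Moreover, $\nabla$ is a Chern connection, i.e. its curvature satisfies $R^\nabla_{\mathcal JU,\mathcal JV}=R^\nabla_{U,V}$ for all $U,V\in T_zZ$, $z\in Z$ (type $(1,1)$ with respect to $\mathcal J$), if and only if $D$ is self-dual, i.e. the curvature $R$ of the connection induced by $D$ on $\Lambda^{4n}(T^*M)$ is $Q$-hermitian: $R_{JX,JY}=R_{X,Y}$ for all $p\in M$, $X,Y\in T_pM$ and all $J\in Q_p$ with $J^2=-\mathrm{Id}$. -/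

import Mathlib

open Bundle FiberBundle
open scoped Manifold ContDiff Topology

noncomputable section

set_option linter.unusedSectionVars false

namespace Quaternionic

section Connections

variable {E : Type*} [NormedAddCommGroup E] [NormedSpace ℝ E]
  {H : Type*} [TopologicalSpace H] {I : ModelWithCorners ℝ E H}
  {M : Type*} [TopologicalSpace M] [ChartedSpace H M] [IsManifold I ∞ M]

variable (I) in
/-- The fibre `End(T_pM)`. -/
abbrev EndT (p : M) : Type _ := TangentSpace I p →L[ℝ] TangentSpace I p

theorem endCov_tensorial₂
    (D : CovariantDerivative I E (TangentSpace I : M → Type _))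
    (A : Π p : M, EndT I p) (p : M)
    (hA : MDifferentiableAt I (I.prod 𝓘(ℝ, E →L[ℝ] E))
            (fun q ↦ TotalSpace.mk' (E →L[ℝ] E) (E := EndT I) q (A q)) p) (X : Π q : M, TangentSpace I q) :
    TensorialAt I E (fun Y : Π q : M, TangentSpace I q ↦
        D (fun q ↦ A q (Y q)) p (X p) - A p (D Y p (X p))) p where
  smul {f Y} hf hY := by
    have h1 : MDiffAt (T% (fun q ↦ A q (Y q))) p := hA.clm_bundle_apply hY
    have h2 : (fun q ↦ A q ((f • Y) q)) = f • (fun q ↦ A q (Y q)) := by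
      ext1 q; simp
    rw [h2, D.isCovariantDerivativeOnUniv.leibniz h1 hf,
      D.isCovariantDerivativeOnUniv.leibniz hY hf]
    simp
    module
  add {Y Y'} hY hY' := by
    have h1 : MDiffAt (T% (fun q ↦ A q (Y q))) p := hA.clm_bundle_apply hY
    have h1' : MDiffAt (T% (fun q ↦ A q (Y' q))) p := hA.clm_bundle_apply hY'
    have h2 : (fun q ↦ A q ((Y + Y') q)) = (fun q ↦ A q (Y q)) + (fun q ↦ A q (Y' q)) := by
      ext1 q; simp
    rw [h2, D.isCovariantDerivativeOnUniv.add h1 h1',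
      D.isCovariantDerivativeOnUniv.add hY hY']
    simp
    module

theorem endCov_tensorial₁
    (D : CovariantDerivative I E (TangentSpace I : M → Type _))
    (A : Π p : M, EndT I p) (p : M)
    (Y : Π q : M, TangentSpace I q) :
    TensorialAt I E (fun X : Π q : M, TangentSpace I q ↦
        D (fun q ↦ A q (Y q)) p (X p) - A p (D Y p (X p))) p where
  smul {f X} hf hX := by
    simp [smul_sub]
  add {X X'} hX hX' := by
    simp
    module

open scoped Classical in
/-- The connection induced on `End(TM)`: `(D_X A)(Y) = D_X (A Y) - A (D_X Y)`. -/
def endCov [FiniteDimensional ℝ E] (D : CovariantDerivative I E (TangentSpace I : M → Type _)) :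
    CovariantDerivative I (E →L[ℝ] E)
      (EndT I : M → Type _) where
  toFun A p :=
    if hA : MDifferentiableAt I (I.prod 𝓘(ℝ, E →L[ℝ] E))
            (fun q ↦ TotalSpace.mk' (E →L[ℝ] E) (E := EndT I) q (A q)) p
    then TensorialAt.mkHom₂ (fun X Y : Π q : M, TangentSpace I q ↦
        D (fun q ↦ A q (Y q)) p (X p) - A p (D Y p (X p))) p
        (fun Y _ ↦ endCov_tensorial₁ D A p Y) (fun X _ ↦ endCov_tensorial₂ D A p hA X)
    else 0
  isCovariantDerivativeOnUniv :=
    { add := by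
        intro A B p hA hB _
        have hAB : MDifferentiableAt I (I.prod 𝓘(ℝ, E →L[ℝ] E))
            (fun q ↦ TotalSpace.mk' (E →L[ℝ] E) (E := EndT I) q ((A + B) q)) p := mdifferentiableAt_add_section hA hB
        rw [dif_pos hA, dif_pos hB, dif_pos hAB]
        ext x v
        have hv := mdifferentiableAt_extend I E v
        have h1 : MDiffAt (T% (fun q ↦ A q (extend E v q))) p := hA.clm_bundle_apply hv
        have h2 : MDiffAt (T% (fun q ↦ B q (extend E v q))) p := hB.clm_bundle_apply hv
        have h3 := D.isCovariantDerivativeOnUniv.add h1 h2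
        have h4 : (fun q ↦ (A + B) q (extend E v q)) =
          (fun q ↦ A q (extend E v q)) + (fun q ↦ B q (extend E v q)) := by
          ext1 q; simp
        simp only [add_apply, TensorialAt.mkHom₂_apply_eq_extend, h4, h3]
        simp
        module
      leibniz := by
        intro A g p hA hg _
        have hgA : MDifferentiableAt I (I.prod 𝓘(ℝ, E →L[ℝ] E))
            (fun q ↦ TotalSpace.mk' (E →L[ℝ] E) (E := EndT I) q ((g • A) q)) p := hg.smul_section hA
        rw [dif_pos hA, dif_pos hgA]
        ext x v
        have hv := mdifferentiableAt_extend I E v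
        have h1 : MDiffAt (T% (fun q ↦ A q (extend E v q))) p := hA.clm_bundle_apply hv
        have h3 := D.isCovariantDerivativeOnUniv.leibniz h1 hg
        have h4 : (fun q ↦ (g • A) q (extend E v q)) = g • (fun q ↦ A q (extend E v q)) := by
          ext1 q; simp
        simp only [add_apply, smul_apply,
          TensorialAt.mkHom₂_apply_eq_extend, h4, h3]
        simp
        module }

/-- The pull-back `f^*D` of a connection `D` on `V → M` along a map `f : N → M`, acting on a section
`s` of `f^*V`. In a local frame `e_i` of `V` around `f z`, if `s = ∑ sⁱ (e_i ∘ f)`, then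
`(f^*D)_U s = ∑ sⁱ(z) D_{f_* U} e_i + ∑ dsⁱ(U) e_i`; below the frame is the one given by the
trivialization of `V` at `f z`, so that `extend F (s z) = ∑ sⁱ(z) e_i` near `f z`. -/
def pullbackCov {F : Type*} [NormedAddCommGroup F] [NormedSpace ℝ F]
    {V : M → Type*} [TopologicalSpace (TotalSpace F V)]
    [∀ x, AddCommGroup (V x)] [∀ x, Module ℝ (V x)] [∀ x : M, TopologicalSpace (V x)]
    [∀ x, IsTopologicalAddGroup (V x)] [∀ x, ContinuousSMul ℝ (V x)]
    [FiberBundle F V] [VectorBundle ℝ F V]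
    (D : CovariantDerivative I F V)
    {E' : Type*} [NormedAddCommGroup E'] [NormedSpace ℝ E']
    {H' : Type*} [TopologicalSpace H'] (I' : ModelWithCorners ℝ E' H')
    {N : Type*} [TopologicalSpace N] [ChartedSpace H' N] (f : N → M)
    (s : Π z : N, V (f z)) (z : N) : TangentSpace I' z →L[ℝ] V (f z) :=
  (D (extend F (s z)) (f z)).comp (mfderiv I' I f z) +
    ((trivializationAt F V (f z)).symmL ℝ (f z)).comp
      (mvfderiv I' (fun z' ↦ ((trivializationAt F V (f z)) ⟨f z', s z'⟩).2) z)

end Connections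

section Algebra

variable {V : Type*} [AddCommGroup V] [Module ℝ V] [TopologicalSpace V]
  [IsTopologicalAddGroup V] [ContinuousSMul ℝ V]

/-- Three complex structures satisfying the quaternionic relations. -/
structure IsQuaternionTriple (J : Fin 3 → V →L[ℝ] V) : Prop where
  sq : ∀ i, J i * J i = -1
  mul : J 0 * J 1 = J 2

/-- The bilinear form `tr(A ∘ B)`. -/
def traceForm (A B : V →L[ℝ] V) : ℝ := LinearMap.trace ℝ V (A * B : V →L[ℝ] V)

theorem traceForm_comm (A B : V →L[ℝ] V) : traceForm A B = traceForm B A := by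
  unfold traceForm
  exact LinearMap.trace_mul_comm ℝ (A : V →ₗ[ℝ] V) (B : V →ₗ[ℝ] V)

theorem traceForm_sum (A : V →L[ℝ] V) (a : Fin 3 → ℝ) (J : Fin 3 → V →L[ℝ] V) :
    traceForm A (∑ i, a i • J i) = ∑ i, a i * traceForm A (J i) := by
  simp only [traceForm, Fin.sum_univ_three, mul_add, mul_smul_comm,
    ContinuousLinearMap.toLinearMap_add, ContinuousLinearMap.toLinearMap_smul, map_add, map_smul, smul_eq_mul]

namespace IsQuaternionTriple

variable {J : Fin 3 → V →L[ℝ] V}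

theorem anti01 (hJ : IsQuaternionTriple J) : J 1 * J 0 = -(J 0 * J 1) := by
  have h0 := hJ.sq 0
  have h1 := hJ.sq 1
  have h2 := hJ.sq 2
  rw [← hJ.mul] at h2
  calc J 1 * J 0 = (J 0 * J 0) * (J 1 * J 0) * (J 1 * J 1) := by rw [h0, h1]; simp
    _ = J 0 * ((J 0 * J 1) * (J 0 * J 1)) * J 1 := by simp only [mul_assoc]
    _ = -(J 0 * J 1) := by rw [h2]; simp

theorem mul02 (hJ : IsQuaternionTriple J) : J 0 * J 2 = -J 1 := by
  rw [← hJ.mul, ← mul_assoc, hJ.sq]; simp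

theorem mul20 (hJ : IsQuaternionTriple J) : J 2 * J 0 = J 1 := by
  rw [← hJ.mul, mul_assoc, hJ.anti01, mul_neg, ← mul_assoc, hJ.sq]; simp

theorem mul21 (hJ : IsQuaternionTriple J) : J 2 * J 1 = -J 0 := by
  rw [← hJ.mul, mul_assoc, hJ.sq]; simp

theorem mul12 (hJ : IsQuaternionTriple J) : J 1 * J 2 = J 0 := by
  rw [← hJ.mul, ← mul_assoc, hJ.anti01, neg_mul, mul_assoc, hJ.sq]; simp

theorem anti (hJ : IsQuaternionTriple J) {i j : Fin 3} (h : i ≠ j) : J i * J j = -(J j * J i) := by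
  have := hJ.anti01
  have := hJ.mul02
  have := hJ.mul20
  have := hJ.mul12
  have := hJ.mul21
  fin_cases i <;> fin_cases j <;> simp_all

theorem sum_sq (hJ : IsQuaternionTriple J) (a : Fin 3 → ℝ) :
    (∑ i, a i • J i) * (∑ i, a i • J i) = -((∑ i, a i ^ 2) • (1 : V →L[ℝ] V)) := by
  have h00 := hJ.sq 0
  have h11 := hJ.sq 1
  have h22 := hJ.sq 2
  simp only [Fin.sum_univ_three, mul_add, add_mul, smul_mul_smul_comm, h00, h11, h22, hJ.mul,
    hJ.anti01, hJ.mul02, hJ.mul20, hJ.mul21, hJ.mul12]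
  module

theorem traceForm_ne (hJ : IsQuaternionTriple J) {i j : Fin 3} (h : i ≠ j) : traceForm (J i) (J j) = 0 := by
  have h1 := traceForm_comm (J i) (J j)
  have h2 : traceForm (J i) (J j) = -traceForm (J j) (J i) := by
    unfold traceForm
    rw [hJ.anti h, ContinuousLinearMap.toLinearMap_neg, map_neg]
  linarith

theorem traceForm_self [Module.Finite ℝ V] (hJ : IsQuaternionTriple J) (i : Fin 3) :
    traceForm (J i) (J i) = -(Module.finrank ℝ V : ℝ) := by
  unfold traceForm
  rw [hJ.sq, ContinuousLinearMap.toLinearMap_neg, map_neg]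
  congr 1
  exact LinearMap.trace_one ℝ V

theorem traceForm_sum_eq [Module.Finite ℝ V] (hJ : IsQuaternionTriple J) (i : Fin 3) (a : Fin 3 → ℝ) :
    traceForm (J i) (∑ j, a j • J j) = -(Module.finrank ℝ V : ℝ) * a i := by
  rw [traceForm_sum, Finset.sum_eq_single i]
  · rw [hJ.traceForm_self]; ring
  · intro j _ hj
    rw [hJ.traceForm_ne hj.symm, mul_zero]
  · simp

end IsQuaternionTriple

end Algebra

section TraceSmooth

variable {E : Type*} [NormedAddCommGroup E] [NormedSpace ℝ E] [FiniteDimensional ℝ E]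
  {H : Type*} [TopologicalSpace H] {I : ModelWithCorners ℝ E H}
  {M : Type*} [TopologicalSpace M] [ChartedSpace H M] [IsManifold I ∞ M]
  {E' : Type*} [NormedAddCommGroup E'] [NormedSpace ℝ E']
  {H' : Type*} [TopologicalSpace H'] {I' : ModelWithCorners ℝ E' H'}
  {N : Type*} [TopologicalSpace N] [ChartedSpace H' N]

theorem contMDiffWithinAt_traceForm {f : N → M} {A B : Π z : N, EndT I (f z)} {s : Set N} {z₀ : N}
    (hA : ContMDiffWithinAt I' (I.prod 𝓘(ℝ, E →L[ℝ] E)) ∞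
      (fun z ↦ TotalSpace.mk' (E →L[ℝ] E) (E := EndT I) (f z) (A z)) s z₀)
    (hB : ContMDiffWithinAt I' (I.prod 𝓘(ℝ, E →L[ℝ] E)) ∞
      (fun z ↦ TotalSpace.mk' (E →L[ℝ] E) (E := EndT I) (f z) (B z)) s z₀) :
    ContMDiffWithinAt I' 𝓘(ℝ, ℝ) ∞ (fun z ↦ traceForm (A z) (B z)) s z₀ := by
  rw [← contMDiffWithinAt_insert_self] at hA hB ⊢
  rw [contMDiffWithinAt_hom_bundle] at hA hB
  let τ : (E →L[ℝ] E) →L[ℝ] ℝ :=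
    LinearMap.toContinuousLinearMap
      ((LinearMap.trace ℝ E) ∘ₗ (ContinuousLinearMap.coeLM ℝ : (E →L[ℝ] E) →ₗ[ℝ] (E →ₗ[ℝ] E)))
  have h1 := hA.2.clm_comp hB.2
  have h2 := (τ.contMDiff (n := ∞)).contMDiffAt.comp_contMDiffWithinAt z₀ h1
  refine h2.congr_of_eventuallyEq_of_mem ?_ (Set.mem_insert z₀ s)
  have hb : ∀ᶠ z in 𝓝[insert z₀ s] z₀,
      f z ∈ (trivializationAt E (TangentSpace I) (f z₀)).baseSet := by
    apply hA.1.continuousWithinAt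
    apply (trivializationAt E (TangentSpace I) (f z₀)).open_baseSet.mem_nhds
    exact FiberBundle.mem_baseSet_trivializationAt' (f z₀)
  filter_upwards [hb] with z hz
  simp only [Function.comp]
  rw [ContinuousLinearMap.inCoordinates_eq hz hz, ContinuousLinearMap.inCoordinates_eq hz hz]
  set e := (trivializationAt E (TangentSpace I) (f z₀)).continuousLinearEquivAt ℝ (f z) hz
  have : ((e : TangentSpace I (f z) →L[ℝ] E).comp ((A z).comp (e.symm : E →L[ℝ] _))).comp
      ((e : TangentSpace I (f z) →L[ℝ] E).comp ((B z).comp (e.symm : E →L[ℝ] _))) =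
      (e : TangentSpace I (f z) →L[ℝ] E).comp ((A z * B z).comp (e.symm : E →L[ℝ] _)) := by
    ext v; simp
  rw [this]
  exact (LinearMap.trace_conj' ((A z * B z : EndT I (f z)) : _ →ₗ[ℝ] _) e.toLinearEquiv).symm

end TraceSmooth

/-- The model fibre of the bundle `End(TM)` of a manifold of dimension `4n`. -/
abbrev EndF (n : ℕ) : Type :=
  EuclideanSpace ℝ (Fin (4 * n)) →L[ℝ] EuclideanSpace ℝ (Fin (4 * n))

section Structure

variable (n : ℕ) (M : Type*) [TopologicalSpace M]
  [ChartedSpace (EuclideanSpace ℝ (Fin (4 * n))) M] [IsManifold (𝓡 (4 * n)) ∞ M]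

/-- An almost quaternionic structure on a manifold `M` of dimension `4n ≥ 8`: a subbundle `Q` of
`End(TM)` which is locally generated by three smooth almost complex structures satisfying the
quaternionic relations (they are then automatically linearly independent, so `Q` has rank 3). -/
structure AlmostQuaternionicStructure where
  two_le : 2 ≤ n
  fiber : Π p : M, Submodule ℝ (EndT (𝓡 (4 * n)) p)
  exists_admissible : ∀ p : M, ∃ U : Set M, IsOpen U ∧ p ∈ U ∧
    ∃ J : Fin 3 → Π q : M, EndT (𝓡 (4 * n)) q,
      (∀ i, ContMDiffOn (𝓡 (4 * n))
        ((𝓡 (4 * n)).prod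
          𝓘(ℝ, EndF n)) ∞
        (fun q ↦ TotalSpace.mk' (EndF n) (E := EndT (𝓡 (4 * n))) q (J i q)) U) ∧
      ∀ q ∈ U, IsQuaternionTriple (fun i ↦ J i q) ∧
        fiber q = Submodule.span ℝ (Set.range fun i ↦ J i q)

end Structure

namespace AlmostQuaternionicStructure

variable {n : ℕ} {M : Type*} [TopologicalSpace M]
  [ChartedSpace (EuclideanSpace ℝ (Fin (4 * n))) M] [IsManifold (𝓡 (4 * n)) ∞ M]
  (Q : AlmostQuaternionicStructure n M)

/-- The twistor space `Z`: the set of pairs `(p, J)` with `J ∈ Q_p` and `J² = -1`. Its topology is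
induced from the total space of `End(TM)`. -/
def Twistor : Type _ :=
  {z : TotalSpace (EndF n)
      (EndT (𝓡 (4 * n)) : M → Type _) // z.2 ∈ Q.fiber z.1 ∧ z.2 * z.2 = -1}

instance : TopologicalSpace Q.Twistor := inferInstanceAs (TopologicalSpace (Subtype _))

/-- The twistor projection `π : Z → M`. -/
def proj (z : Q.Twistor) : M := z.1.1

/-- The complex structure `J` of `T_pM` given by a point `z = (p, J)` of `Z`. -/
def taut (z : Q.Twistor) : EndT (𝓡 (4 * n)) (Q.proj z) := z.1.2

theorem exists_frame (p : M) : ∃ (U : Set M) (J : Fin 3 → Π q : M, EndT (𝓡 (4 * n)) q),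
    IsOpen U ∧ p ∈ U ∧
      (∀ i, ContMDiffOn (𝓡 (4 * n))
        ((𝓡 (4 * n)).prod
          𝓘(ℝ, EndF n)) ∞
        (fun q ↦ TotalSpace.mk' (EndF n) (E := EndT (𝓡 (4 * n))) q (J i q)) U) ∧
      ∀ q, IsQuaternionTriple (fun i ↦ J i q) ∧
        Q.fiber q = Submodule.span ℝ (Set.range fun i ↦ J i q) := by
  classical
  choose U hU hpU J hJ hJ' using Q.exists_admissible
  refine ⟨U p, fun i q ↦ if q ∈ U p then J p i q else J q i q, hU p, hpU p, fun i ↦ ?_, fun q ↦ ?_⟩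
  · exact (hJ p i).congr fun q hq ↦ by simp [hq]
  · by_cases hq : q ∈ U p
    · simpa [hq] using hJ' p q hq
    · simpa [hq] using hJ' q q (hpU q)

/-- The domain of a chosen admissible frame of `Q` around `p`. -/
def dom (p : M) : Set M := (Q.exists_frame p).choose

/-- A chosen admissible frame of `Q` around `p`. It is smooth on `Q.dom p`; outside this set it is
a pointwise choice, without any continuity. -/
def frame (p : M) : Fin 3 → Π q : M, EndT (𝓡 (4 * n)) q := (Q.exists_frame p).choose_spec.choose

theorem isOpen_dom (p : M) : IsOpen (Q.dom p) := (Q.exists_frame p).choose_spec.choose_spec.1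

theorem mem_dom (p : M) : p ∈ Q.dom p := (Q.exists_frame p).choose_spec.choose_spec.2.1

theorem contMDiffOn_frame (p : M) (i : Fin 3) : ContMDiffOn (𝓡 (4 * n))
    ((𝓡 (4 * n)).prod
      𝓘(ℝ, EndF n)) ∞
    (fun q ↦ TotalSpace.mk' (EndF n) (E := EndT (𝓡 (4 * n))) q (Q.frame p i q)) (Q.dom p) :=
  (Q.exists_frame p).choose_spec.choose_spec.2.2.1 i

theorem frame_triple (p q : M) : IsQuaternionTriple (fun i ↦ Q.frame p i q) :=
  ((Q.exists_frame p).choose_spec.choose_spec.2.2.2 q).1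

theorem fiber_eq (p q : M) : Q.fiber q = Submodule.span ℝ (Set.range fun i ↦ Q.frame p i q) :=
  ((Q.exists_frame p).choose_spec.choose_spec.2.2.2 q).2

instance (p : M) : Module.Finite ℝ (TangentSpace (𝓡 (4 * n)) p) :=
  inferInstanceAs (Module.Finite ℝ (EuclideanSpace ℝ (Fin (4 * n))))

theorem finrank_tangent (p : M) : (Module.finrank ℝ (TangentSpace (𝓡 (4 * n)) p) : ℝ) = 4 * n := by
  have : Module.finrank ℝ (EuclideanSpace ℝ (Fin (4 * n))) = 4 * n := finrank_euclideanSpace_fin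
  change (Module.finrank ℝ (EuclideanSpace ℝ (Fin (4 * n))) : ℝ) = 4 * n
  rw [this]; push_cast; ring

/-- The natural Euclidean metric of `Q`, `⟨A, B⟩ = -(1/4n) tr(A ∘ B)`: the one for which every
admissible basis is orthonormal (see `qInner_frame_sum`). -/
def qInner {p : M} (A B : EndT (𝓡 (4 * n)) p) : ℝ := -(1 / (4 * n : ℝ)) * traceForm A B

theorem qInner_frame_sum (p q : M) (i : Fin 3) (a : Fin 3 → ℝ) :
    qInner (Q.frame p i q) (∑ j, a j • Q.frame p j q) = a i := by
  have h := (Q.frame_triple p q).traceForm_sum_eq i a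
  have hn : (n : ℝ) ≠ 0 := by
    have := Q.two_le
    positivity
  rw [qInner, h, finrank_tangent]
  field_simp

/-- The coordinates of an element of `Q_q` in the admissible frame chosen around `p`. -/
def coord (p : M) {q : M} (A : EndT (𝓡 (4 * n)) q) : EuclideanSpace ℝ (Fin 3) :=
  WithLp.toLp 2 fun i ↦ qInner (Q.frame p i q) A

theorem sum_coord (p : M) {q : M} {A : EndT (𝓡 (4 * n)) q} (hA : A ∈ Q.fiber q) :
    ∑ i, Q.coord p A i • Q.frame p i q = A := by
  rw [Q.fiber_eq p q, Submodule.mem_span_range_iff_exists_fun] at hA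
  obtain ⟨c, rfl⟩ := hA
  refine Finset.sum_congr rfl fun i _ ↦ ?_
  congr 1
  exact Q.qInner_frame_sum p q i c

theorem norm_coord (p : M) (z : Q.Twistor) : ‖Q.coord p (Q.taut z)‖ = 1 := by
  have h := (Q.frame_triple p (Q.proj z)).sum_sq (Q.coord p (Q.taut z))
  rw [Q.sum_coord p (show Q.taut z ∈ Q.fiber (Q.proj z) from z.2.1), show Q.taut z * Q.taut z = -1 from z.2.2, neg_inj] at h
  have h' := congrArg (fun A : EndT (𝓡 (4 * n)) (Q.proj z) ↦
    LinearMap.trace ℝ (TangentSpace (𝓡 (4 * n)) (Q.proj z)) A.toLinearMap) h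
  have h1 : LinearMap.trace ℝ (TangentSpace (𝓡 (4 * n)) (Q.proj z)) 
    (1 : EndT (𝓡 (4 * n)) (Q.proj z)).toLinearMap = 4 * n := by
    rw [← finrank_tangent (Q.proj z)]; exact LinearMap.trace_one ℝ _
  simp only [ContinuousLinearMap.toLinearMap_smul, map_smul, h1, smul_eq_mul] at h'
  have hn : (4 * n : ℝ) ≠ 0 := by
    have := Q.two_le
    positivity
  have h2 : ∑ i, Q.coord p (Q.taut z) i ^ 2 = 1 :=
    mul_right_cancel₀ hn (by rw [one_mul]; exact h'.symm)
  rw [EuclideanSpace.norm_eq]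
  simp [h2]

/-- The point of `Z` over `q` with given coordinates in the admissible frame chosen around `p`. -/
def ofCoord (p q : M) (a : Metric.sphere (0 : EuclideanSpace ℝ (Fin 3)) 1) : Q.Twistor :=
  ⟨⟨q, ∑ i, a.1 i • Q.frame p i q⟩, by
    constructor
    · rw [Q.fiber_eq p q]
      change ∑ i, a.1 i • Q.frame p i q ∈ Submodule.span ℝ (Set.range fun i ↦ Q.frame p i q)
      refine Submodule.sum_mem _ fun i _ ↦ ?_
      exact Submodule.smul_mem _ _ (Submodule.subset_span ⟨i, rfl⟩)
    · have h := (Q.frame_triple p q).sum_sq a.1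
      have h1 : ∑ i, a.1 i ^ 2 = 1 := by
        have := a.2
        rw [mem_sphere_zero_iff_norm, EuclideanSpace.norm_eq] at this
        simpa using this
      rw [h1, one_smul] at h
      exact h⟩


theorem coord_ofCoord (p q : M) (a : Metric.sphere (0 : EuclideanSpace ℝ (Fin 3)) 1) :
    Q.coord p (Q.taut (Q.ofCoord p q a)) = a.1 := by
  ext i
  exact Q.qInner_frame_sum p q i a.1

theorem ofCoord_coord (p : M) (z : Q.Twistor) :
    Q.ofCoord p (Q.proj z) ⟨Q.coord p (Q.taut z), by simp [Q.norm_coord p z]⟩ = z := by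
  apply Subtype.ext
  change TotalSpace.mk _ _ = TotalSpace.mk _ _
  congr 1
  exact Q.sum_coord p (show Q.taut z ∈ Q.fiber (Q.proj z) from z.2.1)

theorem contMDiffWithinAt_qInner {E' : Type*} [NormedAddCommGroup E'] [NormedSpace ℝ E']
    {H' : Type*} [TopologicalSpace H'] {I' : ModelWithCorners ℝ E' H'}
    {N : Type*} [TopologicalSpace N] [ChartedSpace H' N]
    {f : N → M} {A B : Π z : N, EndT (𝓡 (4 * n)) (f z)} {s : Set N} {z₀ : N}
    (hA : ContMDiffWithinAt I' ((𝓡 (4 * n)).prod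
      𝓘(ℝ, EndF n)) ∞
      (fun z ↦ TotalSpace.mk' (EndF n) (E := EndT (𝓡 (4 * n))) (f z) (A z)) s z₀)
    (hB : ContMDiffWithinAt I' ((𝓡 (4 * n)).prod
      𝓘(ℝ, EndF n)) ∞
      (fun z ↦ TotalSpace.mk' (EndF n) (E := EndT (𝓡 (4 * n))) (f z) (B z)) s z₀) :
    ContMDiffWithinAt I' 𝓘(ℝ, ℝ) ∞ (fun z ↦ qInner (A z) (B z)) s z₀ :=
  contMDiffWithinAt_const.mul (contMDiffWithinAt_traceForm hA hB)

theorem contMDiffOn_sum_frame (p : M) {E' : Type*} [NormedAddCommGroup E'] [NormedSpace ℝ E']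
    {H' : Type*} [TopologicalSpace H'] {I' : ModelWithCorners ℝ E' H'}
    {N : Type*} [TopologicalSpace N] [ChartedSpace H' N]
    {f : N → M} {a : N → Fin 3 → ℝ} {s : Set N} (hf : ContMDiffOn I' (𝓡 (4 * n)) ∞ f s)
    (hs : Set.MapsTo f s (Q.dom p))
    (ha : ∀ i, ContMDiffOn I' 𝓘(ℝ, ℝ) ∞ (fun z ↦ a z i) s) :
    ContMDiffOn I' ((𝓡 (4 * n)).prod
      𝓘(ℝ, EndF n)) ∞
      (fun z ↦ TotalSpace.mk' (EndF n) (E := EndT (𝓡 (4 * n))) (f z)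
          (∑ i, a z i • Q.frame p i (f z))) s := by
  intro z₀ hz₀
  have hJ : ∀ i, ContMDiffWithinAt I' ((𝓡 (4 * n)).prod
      𝓘(ℝ, EndF n)) ∞
      (fun z ↦ TotalSpace.mk' (EndF n) (E := EndT (𝓡 (4 * n))) (f z)
          (Q.frame p i (f z))) s z₀ := fun i ↦
    (Q.contMDiffOn_frame p i (f z₀) (hs hz₀)).comp z₀ (hf z₀ hz₀) hs
  rw [contMDiffWithinAt_totalSpace]
  refine ⟨hf z₀ hz₀, ?_⟩
  have hJ' := fun i ↦ (contMDiffWithinAt_totalSpace.1 (hJ i)).2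
  have h : ContMDiffWithinAt I' 𝓘(ℝ, EndF n) ∞ (fun z ↦ ∑ i, a z i •
      (trivializationAt (EndF n)
        (EndT (𝓡 (4 * n))) (f z₀) ⟨f z, Q.frame p i (f z)⟩).2) s z₀ := by
    apply ContMDiffWithinAt.sum
    intro i _
    exact (ha i z₀ hz₀).smul (hJ' i)
  refine h.congr_of_eventuallyEq_of_mem ?_ hz₀
  have hb : ∀ᶠ z in 𝓝[s] z₀,
      f z ∈ (trivializationAt (EndF n) (EndT (𝓡 (4 * n))) (f z₀)).baseSet := by
    apply (hf z₀ hz₀).continuousWithinAt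
    apply (trivializationAt _ _ _).open_baseSet.mem_nhds
    exact FiberBundle.mem_baseSet_trivializationAt' (f z₀)
  filter_upwards [hb] with z hz
  have hlin := (trivializationAt (EndF n) (EndT (𝓡 (4 * n))) (f z₀)).linear ℝ hz
  refine (map_sum (IsLinearMap.mk' _ hlin) _ _).trans ?_
  refine Finset.sum_congr rfl fun i _ ↦ ?_
  exact map_smul (IsLinearMap.mk' _ hlin) _ _

theorem contMDiff_coe_sphere₂ : ContMDiff (𝓡 2) 𝓘(ℝ, EuclideanSpace ℝ (Fin 3)) ∞
    ((↑) : Metric.sphere (0 : EuclideanSpace ℝ (Fin 3)) 1 → EuclideanSpace ℝ (Fin 3)) :=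
  haveI : Fact (Module.finrank ℝ (EuclideanSpace ℝ (Fin 3)) = 2 + 1) :=
    ⟨finrank_euclideanSpace_fin⟩
  contMDiff_coe_sphere

/-- The local trivialization `Z|_U ≅ U × S²` given by the admissible frame chosen around `p`. -/
def triv (p : M) : OpenPartialHomeomorph Q.Twistor
    (M × Metric.sphere (0 : EuclideanSpace ℝ (Fin 3)) 1) where
  toFun z := (Q.proj z, ⟨Q.coord p (Q.taut z), by simp [Q.norm_coord p z]⟩)
  invFun x := Q.ofCoord p x.1 x.2
  source := Q.proj ⁻¹' Q.dom p
  target := Q.dom p ×ˢ Set.univ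
  map_source' z hz := ⟨hz, trivial⟩
  map_target' x hx := hx.1
  left_inv' z _ := Q.ofCoord_coord p z
  right_inv' x _ := Prod.ext rfl (Subtype.ext (Q.coord_ofCoord p x.1 x.2))
  open_source := by
    refine (Q.isOpen_dom p).preimage ?_
    exact (FiberBundle.continuous_proj _ _).comp continuous_subtype_val
  open_target := (Q.isOpen_dom p).prod isOpen_univ
  continuousOn_toFun := by
    have hπ : Continuous Q.proj := (FiberBundle.continuous_proj _ _).comp continuous_subtype_val
    refine hπ.continuousOn.prodMk ?_
    rw [Topology.IsInducing.subtypeVal.continuousOn_iff]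
    refine (PiLp.continuous_toLp 2 _).comp_continuousOn (continuousOn_pi.2 fun i ↦ ?_)
    have h : ContMDiffOn ((𝓡 (4 * n)).prod
        𝓘(ℝ, EndF n)) 𝓘(ℝ, ℝ) ∞
        (fun z : TotalSpace (EndF n)
          (EndT (𝓡 (4 * n)) : M → Type _) ↦ qInner (Q.frame p i z.1) z.2)
        (TotalSpace.proj ⁻¹' Q.dom p) := by
      intro z₀ hz₀
      refine contMDiffWithinAt_qInner (f := TotalSpace.proj) ?_ contMDiffWithinAt_id
      exact (Q.contMDiffOn_frame p i z₀.1 hz₀).comp z₀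
        (Bundle.contMDiff_proj _).contMDiffAt.contMDiffWithinAt (fun _ h ↦ h)
    exact h.continuousOn.comp continuous_subtype_val.continuousOn (fun _ h ↦ h)
  continuousOn_invFun := by
    refine (Topology.IsInducing.subtypeVal (t := {z : TotalSpace
      (EndF n)
      (EndT (𝓡 (4 * n)) : M → Type _) | z.2 ∈ Q.fiber z.1 ∧ z.2 * z.2 = -1})).continuousOn_iff.2 ?_
    have h := Q.contMDiffOn_sum_frame p (I' := (𝓡 (4 * n)).prod (𝓡 2))
      (N := M × Metric.sphere (0 : EuclideanSpace ℝ (Fin 3)) 1) (f := Prod.fst)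
      (a := fun x ↦ x.2.1) (s := Q.dom p ×ˢ Set.univ) contMDiffOn_fst (fun _ h ↦ h.1) ?_
    · exact h.continuousOn
    · intro i
      have h1 : ContMDiff ((𝓡 (4 * n)).prod (𝓡 2)) 𝓘(ℝ, EuclideanSpace ℝ (Fin 3)) ∞
          (fun x : M × Metric.sphere (0 : EuclideanSpace ℝ (Fin 3)) 1 ↦ x.2.1) :=
        contMDiff_coe_sphere₂.comp contMDiff_snd
      exact ((EuclideanSpace.proj (𝕜 := ℝ) i).contMDiff.comp h1).contMDiffOn



theorem contMDiffOn_transition (p q : M) :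
    ContMDiffOn ((𝓡 (4 * n)).prod (𝓡 2)) ((𝓡 (4 * n)).prod (𝓡 2)) ∞
      ((Q.triv p).symm ≫ₕ Q.triv q) ((Q.triv p).symm ≫ₕ Q.triv q).source := by
  set s := ((Q.triv p).symm ≫ₕ Q.triv q).source
  have hs1 : Set.MapsTo Prod.fst s (Q.dom p) := fun x hx ↦ hx.1.1
  have hs2 : Set.MapsTo Prod.fst s (Q.dom q) := fun x hx ↦ hx.2
  have hsum := Q.contMDiffOn_sum_frame p (I' := (𝓡 (4 * n)).prod (𝓡 2))
    (N := M × Metric.sphere (0 : EuclideanSpace ℝ (Fin 3)) 1) (f := Prod.fst)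
    (a := fun x ↦ x.2.1) (s := s) contMDiffOn_fst hs1 (fun i ↦ by
      have h1 : ContMDiff ((𝓡 (4 * n)).prod (𝓡 2)) 𝓘(ℝ, EuclideanSpace ℝ (Fin 3)) ∞
          (fun x : M × Metric.sphere (0 : EuclideanSpace ℝ (Fin 3)) 1 ↦ x.2.1) :=
        contMDiff_coe_sphere₂.comp contMDiff_snd
      exact ((EuclideanSpace.proj (𝕜 := ℝ) i).contMDiff.comp h1).contMDiffOn)
  have hc : ContMDiffOn ((𝓡 (4 * n)).prod (𝓡 2)) 𝓘(ℝ, EuclideanSpace ℝ (Fin 3)) ∞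
      (fun x : M × Metric.sphere (0 : EuclideanSpace ℝ (Fin 3)) 1 ↦
        Q.coord q (Q.taut (Q.ofCoord p x.1 x.2))) s := by
    have h : ContMDiffOn ((𝓡 (4 * n)).prod (𝓡 2)) 𝓘(ℝ, Fin 3 → ℝ) ∞
      (fun (x : M × Metric.sphere (0 : EuclideanSpace ℝ (Fin 3)) 1) (i : Fin 3) ↦
        qInner (Q.frame q i x.1) (Q.taut (Q.ofCoord p x.1 x.2))) s := by
      rw [contMDiffOn_pi_space]
      intro i x hx
      refine contMDiffWithinAt_qInner (f := Prod.fst) ?_ (hsum x hx)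
      exact (Q.contMDiffOn_frame q i x.1 (hs2 hx)).comp x contMDiffWithinAt_fst hs2
    exact (PiLp.continuousLinearEquiv 2 ℝ
      (fun _ : Fin 3 ↦ ℝ)).symm.toContinuousLinearMap.contMDiff.comp_contMDiffOn h
  refine contMDiffOn_fst.prodMk ?_
  have hso : IsOpen s := ((Q.triv p).symm ≫ₕ Q.triv q).open_source
  have : Fact (Module.finrank ℝ (EuclideanSpace ℝ (Fin 3)) = 2 + 1) :=
    ⟨finrank_euclideanSpace_fin⟩
  let S : TopologicalSpace.Opens (M × Metric.sphere (0 : EuclideanSpace ℝ (Fin 3)) 1) := ⟨s, hso⟩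
  have hc' : ContMDiff ((𝓡 (4 * n)).prod (𝓡 2)) 𝓘(ℝ, EuclideanSpace ℝ (Fin 3)) ∞
      (fun x : S ↦ Q.coord q (Q.taut (Q.ofCoord p x.1.1 x.1.2))) := fun x ↦
    contMDiffAt_subtype_iff.2 (hc.contMDiffAt (hso.mem_nhds x.2))
  have hc'' := hc'.codRestrict_sphere (n := 2)
    (fun x ↦ by simp [Q.norm_coord q (Q.ofCoord p x.1.1 x.1.2)])
  intro x hx
  exact (contMDiffAt_subtype_iff (U := S) (x := ⟨x, hx⟩)
    (f := fun x : M × Metric.sphere (0 : EuclideanSpace ℝ (Fin 3)) 1 ↦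
      (⟨Q.coord q (Q.taut (Q.ofCoord p x.1 x.2)), by
        simp [Q.norm_coord q (Q.ofCoord p x.1 x.2)]⟩ :
        Metric.sphere (0 : EuclideanSpace ℝ (Fin 3)) 1))).1 (hc'' ⟨x, hx⟩) |>.contMDiffWithinAt

/-- The charts of `Z`: the local trivializations `Z|_U ≅ U × S²` followed by charts of `M × S²`. -/
instance : ChartedSpace
    (ModelProd (EuclideanSpace ℝ (Fin (4 * n))) (EuclideanSpace ℝ (Fin 2))) Q.Twistor where
  atlas := Set.range fun z ↦ Q.triv (Q.proj z) ≫ₕ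
    chartAt (ModelProd (EuclideanSpace ℝ (Fin (4 * n))) (EuclideanSpace ℝ (Fin 2)))
      (Q.triv (Q.proj z) z)
  chartAt z := Q.triv (Q.proj z) ≫ₕ
    chartAt (ModelProd (EuclideanSpace ℝ (Fin (4 * n))) (EuclideanSpace ℝ (Fin 2)))
      (Q.triv (Q.proj z) z)
  mem_chart_source z := ⟨Q.mem_dom (Q.proj z), mem_chart_source
    (ModelProd (EuclideanSpace ℝ (Fin (4 * n))) (EuclideanSpace ℝ (Fin 2)))
    (Q.triv (Q.proj z) z)⟩
  chart_mem_atlas z := ⟨z, rfl⟩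

instance : IsManifold ((𝓡 (4 * n)).prod (𝓡 2)) ∞ Q.Twistor := by
  apply isManifold_of_contDiffOn
  rintro _ _ ⟨z, rfl⟩ ⟨w, rfl⟩
  rw [← contMDiffOn_iff_contDiffOn]
  set e := chartAt (ModelProd (EuclideanSpace ℝ (Fin (4 * n))) (EuclideanSpace ℝ (Fin 2)))
      (Q.triv (Q.proj z) z) with he
  set e' := chartAt (ModelProd (EuclideanSpace ℝ (Fin (4 * n))) (EuclideanSpace ℝ (Fin 2)))
      (Q.triv (Q.proj w) w) with he'
  have h1 : ContMDiffOn 𝓘(ℝ, EuclideanSpace ℝ (Fin (4 * n)) × EuclideanSpace ℝ (Fin 2))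
      ((𝓡 (4 * n)).prod (𝓡 2)) ∞ ((𝓡 (4 * n)).prod (𝓡 2)).symm
      (Set.range ((𝓡 (4 * n)).prod (𝓡 2))) :=
    ModelWithCorners.contMDiffOn_symm _
  have h2 : ContMDiffOn ((𝓡 (4 * n)).prod (𝓡 2)) ((𝓡 (4 * n)).prod (𝓡 2)) ∞ e.symm e.target :=
    contMDiffOn_chart_symm
  have h3 := Q.contMDiffOn_transition (Q.proj z) (Q.proj w)
  have h4 : ContMDiffOn ((𝓡 (4 * n)).prod (𝓡 2)) ((𝓡 (4 * n)).prod (𝓡 2)) ∞ e' e'.source :=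
    contMDiffOn_chart
  have h5 : ContMDiff ((𝓡 (4 * n)).prod (𝓡 2))
    𝓘(ℝ, EuclideanSpace ℝ (Fin (4 * n)) × EuclideanSpace ℝ (Fin 2)) ∞ ((𝓡 (4 * n)).prod (𝓡 2)) :=
    ModelWithCorners.contMDiff _
  have h6 := h5.comp_contMDiffOn (h4.comp' (h3.comp' (h2.comp' h1)))
  refine h6.mono ?_
  rintro x ⟨⟨⟨hx1, hx2⟩, hx3, hx4⟩, hx5⟩
  refine ⟨⟨⟨hx5, hx1⟩, ?_⟩, ?_⟩
  · exact ⟨hx2, hx3⟩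
  · exact hx4

variable (D : CovariantDerivative (𝓡 (4 * n)) (EuclideanSpace ℝ (Fin (4 * n)))
  (TangentSpace (𝓡 (4 * n)) : M → Type _))

/-- A quaternionic connection: a smooth torsion-free linear connection on `M` which preserves `Q`. -/
structure IsQuaternionicConnection : Prop where
  smooth : D.ContMDiffCovariantDerivative ∞
  torsion_free : D.torsion = 0
  preserves : ∀ A : Π p : M, EndT (𝓡 (4 * n)) p,
    ContMDiff (𝓡 (4 * n)) ((𝓡 (4 * n)).prod 𝓘(ℝ, EndF n)) ∞
      (fun q ↦ TotalSpace.mk' (EndF n) (E := EndT (𝓡 (4 * n))) q (A q)) →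
    (∀ p, A p ∈ Q.fiber p) → ∀ (p : M) (x : TangentSpace (𝓡 (4 * n)) p),
      endCov D A p x ∈ Q.fiber p

/-- The pull-back connection `π^*D` on `π^*End(TM)`, which contains `π^*Q` as a `π^*D`-parallel
subbundle when `D` preserves `Q`. -/
def piCov (s : Π z : Q.Twistor, EndT (𝓡 (4 * n)) (Q.proj z)) (z : Q.Twistor) :
    TangentSpace ((𝓡 (4 * n)).prod (𝓡 2)) z →ₗ[ℝ] EndT (𝓡 (4 * n)) (Q.proj z) :=
  (pullbackCov (endCov D) ((𝓡 (4 * n)).prod (𝓡 2)) Q.proj s z).toLinearMap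

/-! ### The complex structure of the twistor space -/

/-- The vertical part of `U ∈ T_J Z` for the connection which `D` induces on `Z → M`, as an element
of `T_J Z_p = J^⊥ ⊂ Q_p`: the covariant derivative along `U` of the tautological section `J` of
`π^*Q`. On a vertical vector it is the velocity in `Q_p`, and its kernel is the horizontal space. -/
def vert (z : Q.Twistor) :
    TangentSpace ((𝓡 (4 * n)).prod (𝓡 2)) z →ₗ[ℝ] EndT (𝓡 (4 * n)) (Q.proj z) :=
  Q.piCov D Q.taut z

/-- The differential of the twistor projection. -/
def dproj (z : Q.Twistor) :
    TangentSpace ((𝓡 (4 * n)).prod (𝓡 2)) z →L[ℝ] TangentSpace (𝓡 (4 * n)) (Q.proj z) :=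
  mfderiv ((𝓡 (4 * n)).prod (𝓡 2)) (𝓡 (4 * n)) Q.proj z

/-- The complex structure `𝒥` of `Z`, defined by means of a quaternionic connection `D`: at the point
`J` it is equal to `J` on the horizontal space, identified with `T_pM` by `π_*`, and to `A ↦ J ∘ A`
on the vertical space `T_J Z_p ⊂ Q_p`. Since a tangent vector is determined by its projection and
its vertical part, `𝒥 U` is the only vector with the two components below. -/
def twistorJ (z : Q.Twistor) (U : TangentSpace ((𝓡 (4 * n)).prod (𝓡 2)) z) :
    TangentSpace ((𝓡 (4 * n)).prod (𝓡 2)) z :=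
  Classical.epsilon fun W ↦
    Q.dproj z W = Q.taut z (Q.dproj z U) ∧ Q.vert D z W = Q.taut z * Q.vert D z U

/-! ### The vertical tangent bundle `Θ` -/

/-- The fibre `Θ_J = T_J Z_p`: the `J`-anti-linear elements of `Q_p`. -/
def Theta (z : Q.Twistor) : Submodule ℝ (EndT (𝓡 (4 * n)) (Q.proj z)) where
  carrier := {A | A ∈ Q.fiber (Q.proj z) ∧ A * Q.taut z = -(Q.taut z * A)}
  zero_mem' := ⟨zero_mem _, by simp⟩
  add_mem' := fun {A B} hA hB ↦ ⟨add_mem hA.1 hB.1, by rw [add_mul, mul_add, hA.2, hB.2]; abel⟩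
  smul_mem' := fun c A hA ↦ ⟨Submodule.smul_mem _ c hA.1, by
    rw [smul_mul_assoc, mul_smul_comm, hA.2, smul_neg]⟩

/-- Smooth sections of `Θ ⊂ π^*End(TM)`. -/
structure IsSmoothSection (s : Π z : Q.Twistor, EndT (𝓡 (4 * n)) (Q.proj z)) : Prop where
  mem : ∀ z, s z ∈ Q.Theta z
  smooth : ContMDiff ((𝓡 (4 * n)).prod (𝓡 2)) ((𝓡 (4 * n)).prod 𝓘(ℝ, EndF n)) ∞
    (fun z ↦ TotalSpace.mk' (EndF n) (E := EndT (𝓡 (4 * n))) (Q.proj z) (s z))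

/-- Smooth vector fields on `Z`. -/
def IsSmoothField (X : Π z : Q.Twistor, TangentSpace ((𝓡 (4 * n)).prod (𝓡 2)) z) : Prop :=
  ContMDiff ((𝓡 (4 * n)).prod (𝓡 2)) ((𝓡 (4 * n)).prod (𝓡 2)).tangent ∞
    (fun z ↦ (⟨z, X z⟩ : TangentBundle ((𝓡 (4 * n)).prod (𝓡 2)) Q.Twistor))

/-- The hermitian metric `h(A, B) = (⟨A, B⟩ - i⟨𝒥A, B⟩) / 2` of `Θ`, where `𝒥A = J ∘ A`. -/
def herm (z : Q.Twistor) (A B : EndT (𝓡 (4 * n)) (Q.proj z)) : ℂ :=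
  (1 / 2 : ℂ) * ((qInner A B : ℂ) - Complex.I * (qInner (Q.taut z * A) B : ℂ))

/-- The orthogonal projection `Π_J : Q_p → Θ_J`, `Π_J(A) = (A + J ∘ A ∘ J) / 2`. -/
def projTheta (z : Q.Twistor) :
    EndT (𝓡 (4 * n)) (Q.proj z) →ₗ[ℝ] EndT (𝓡 (4 * n)) (Q.proj z) where
  toFun A := (1 / 2 : ℝ) • (A + Q.taut z * A * Q.taut z)
  map_add' A B := by simp only [mul_add, add_mul, smul_add]; abel
  map_smul' c A := by
    simp only [mul_smul_comm, smul_mul_assoc, smul_add, RingHom.id_apply, smul_smul, mul_comm c]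

/-- The connection `∇ = Π ∘ π^*D` on `Θ`. -/
def thetaCov (s : Π z : Q.Twistor, EndT (𝓡 (4 * n)) (Q.proj z)) (z : Q.Twistor) :
    TangentSpace ((𝓡 (4 * n)).prod (𝓡 2)) z →ₗ[ℝ] EndT (𝓡 (4 * n)) (Q.proj z) :=
  (Q.projTheta z).comp (Q.piCov D s z)

variable (nabla : (Π z : Q.Twistor, EndT (𝓡 (4 * n)) (Q.proj z)) → Π z : Q.Twistor,
  TangentSpace ((𝓡 (4 * n)).prod (𝓡 2)) z →ₗ[ℝ] EndT (𝓡 (4 * n)) (Q.proj z))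

/-- `nabla` is a hermitian connection on the hermitian complex line bundle `Θ`: it maps smooth
sections of `Θ` to smooth `Θ`-valued 1-forms, is additive and satisfies the Leibniz rule, is
`ℂ`-linear (`∇𝒥 = 0`) and preserves the hermitian metric `h`. -/
structure IsHermitianConnection : Prop where
  smooth : ∀ s X, Q.IsSmoothSection s → Q.IsSmoothField X →
    Q.IsSmoothSection fun z ↦ nabla s z (X z)
  add : ∀ s t, Q.IsSmoothSection s → Q.IsSmoothSection t → ∀ z U,
    nabla (s + t) z U = nabla s z U + nabla t z U
  leibniz : ∀ (f : Q.Twistor → ℝ) (s), ContMDiff ((𝓡 (4 * n)).prod (𝓡 2)) 𝓘(ℝ, ℝ) ∞ f →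
    Q.IsSmoothSection s → ∀ z U, nabla (fun w ↦ f w • s w) z U =
      f z • nabla s z U + mvfderiv ((𝓡 (4 * n)).prod (𝓡 2)) f z U • s z
  complex_linear : ∀ s, Q.IsSmoothSection s → ∀ z U,
    nabla (fun w ↦ Q.taut w * s w) z U = Q.taut z * nabla s z U
  metric : ∀ s t, Q.IsSmoothSection s → Q.IsSmoothSection t → ∀ z U,
    mvfderiv ((𝓡 (4 * n)).prod (𝓡 2)) (fun w ↦ Q.herm w (s w) (t w)) z U =
      Q.herm z (nabla s z U) (t z) + Q.herm z (s z) (nabla t z U)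

/-- The curvature `R_{X,Y}s = ∇_X ∇_Y s - ∇_Y ∇_X s - ∇_{[X,Y]} s`. -/
def curvature (X Y : Π z : Q.Twistor, TangentSpace ((𝓡 (4 * n)).prod (𝓡 2)) z)
    (s : Π z : Q.Twistor, EndT (𝓡 (4 * n)) (Q.proj z)) (z : Q.Twistor) :
    EndT (𝓡 (4 * n)) (Q.proj z) :=
  nabla (fun w ↦ nabla s w (Y w)) z (X z) - nabla (fun w ↦ nabla s w (X w)) z (Y z) -
    nabla s z (VectorField.mlieBracket ((𝓡 (4 * n)).prod (𝓡 2)) X Y z)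

/-- `nabla` is a Chern connection of `Θ` with respect to an almost complex structure `Jc` of `Z`: it
is hermitian and its curvature is of type (1,1), i.e. `R_{𝒥U,𝒥V} = R_{U,V}` for all `U, V ∈ T_zZ`.
The curvature at `z` is evaluated on tangent vectors by means of smooth vector fields extending
them. -/
def IsChernConnection (Jc : Π z : Q.Twistor, TangentSpace ((𝓡 (4 * n)).prod (𝓡 2)) z →
    TangentSpace ((𝓡 (4 * n)).prod (𝓡 2)) z) : Prop :=
  Q.IsHermitianConnection nabla ∧
    ∀ X Y X' Y', Q.IsSmoothField X → Q.IsSmoothField Y → Q.IsSmoothField X' →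
      Q.IsSmoothField Y' → ∀ s, Q.IsSmoothSection s → ∀ z, X' z = Jc z (X z) → Y' z = Jc z (Y z) →
        Q.curvature nabla X' Y' s z = Q.curvature nabla X Y s z

/-! ### Self-dual connections -/

/-- The value of a differential form on vector fields. -/
def formOnFields {k : ℕ} (η : Π p : M, TangentSpace (𝓡 (4 * n)) p [⋀^Fin k]→ₗ[ℝ] ℝ)
    (Y : Fin k → Π p : M, TangentSpace (𝓡 (4 * n)) p) (p : M) : ℝ :=
  η p fun i ↦ Y i p

/-- The connection induced by `D` on differential forms, which are regarded as functionals of vector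
fields: `(D_X η)(Y_1, …, Y_k) = X(η(Y_1, …, Y_k)) - ∑ η(Y_1, …, D_X Y_i, …, Y_k)`. -/
def formCov {k : ℕ} (X : Π p : M, TangentSpace (𝓡 (4 * n)) p)
    (η : (Fin k → Π p : M, TangentSpace (𝓡 (4 * n)) p) → M → ℝ)
    (Y : Fin k → Π p : M, TangentSpace (𝓡 (4 * n)) p) (p : M) : ℝ :=
  mvfderiv (𝓡 (4 * n)) (η Y) p (X p) -
    ∑ i, η (Function.update Y i fun q ↦ D (Y i) q (X q)) p

/-- The curvature `R_{X,Y}η = D_X D_Y η - D_Y D_X η - D_{[X,Y]} η` of the connection induced on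
differential forms. -/
def formCurvature {k : ℕ} (X Y : Π p : M, TangentSpace (𝓡 (4 * n)) p)
    (η : (Fin k → Π p : M, TangentSpace (𝓡 (4 * n)) p) → M → ℝ)
    (V : Fin k → Π p : M, TangentSpace (𝓡 (4 * n)) p) (p : M) : ℝ :=
  formCov D X (formCov D Y η) V p - formCov D Y (formCov D X η) V p -
    formCov D (VectorField.mlieBracket (𝓡 (4 * n)) X Y) η V p

/-- Smooth vector fields on `M`. -/
def IsSmoothFieldBase (X : Π p : M, TangentSpace (𝓡 (4 * n)) p) : Prop :=
  ContMDiff (𝓡 (4 * n)) (𝓡 (4 * n)).tangent ∞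
    (fun p ↦ (⟨p, X p⟩ : TangentBundle (𝓡 (4 * n)) M))

/-- Smooth differential forms on `M`. -/
def IsSmoothForm {k : ℕ} (η : Π p : M, TangentSpace (𝓡 (4 * n)) p [⋀^Fin k]→ₗ[ℝ] ℝ) : Prop :=
  ∀ Y : Fin k → Π p : M, TangentSpace (𝓡 (4 * n)) p, (∀ i, IsSmoothFieldBase (Y i)) →
    ContMDiff (𝓡 (4 * n)) 𝓘(ℝ, ℝ) ∞ (formOnFields η Y)

/-- `D` is self-dual: the curvature of the connection induced on `Λ^{4n}(T^*M)` is `Q`-hermitian,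
i.e. `R_{Jx,Jy} = R_{x,y}` for every complex structure `J ∈ Q_p` and all `x, y ∈ T_pM`. The curvature
at `p` is evaluated on tangent vectors by means of smooth vector fields extending them. -/
def IsSelfDual : Prop :=
  ∀ X Y X' Y' : Π p : M, TangentSpace (𝓡 (4 * n)) p, IsSmoothFieldBase X → IsSmoothFieldBase Y →
    IsSmoothFieldBase X' → IsSmoothFieldBase Y' →
    ∀ η : Π p : M, TangentSpace (𝓡 (4 * n)) p [⋀^Fin (4 * n)]→ₗ[ℝ] ℝ, IsSmoothForm η →
    ∀ V : Fin (4 * n) → Π p : M, TangentSpace (𝓡 (4 * n)) p, (∀ i, IsSmoothFieldBase (V i)) →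
    ∀ (p : M) (J : EndT (𝓡 (4 * n)) p), J ∈ Q.fiber p → J * J = -1 →
      X' p = J (X p) → Y' p = J (Y p) →
      formCurvature D X' Y' (formOnFields η) V p = formCurvature D X Y (formOnFields η) V p

end AlmostQuaternionicStructure

end Quaternionic

end

open Bundle FiberBundle
open scoped Manifold ContDiff Topology

noncomputable section

set_option linter.unusedSectionVars false

namespace Quaternionic

section Algebra

variable {V : Type*} [AddCommGroup V] [Module ℝ V] [TopologicalSpace V]
  [IsTopologicalAddGroup V] [ContinuousSMul ℝ V]

theorem traceForm_add_right (A B C : V →L[ℝ] V) :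
    traceForm A (B + C) = traceForm A B + traceForm A C := by
  simp [traceForm, mul_add]

theorem traceForm_sub_right (A B C : V →L[ℝ] V) :
    traceForm A (B - C) = traceForm A B - traceForm A C := by
  simp [traceForm, mul_sub]

theorem traceForm_neg_right (A B : V →L[ℝ] V) : traceForm A (-B) = -traceForm A B := by
  simp [traceForm]

theorem traceForm_add_left (A B C : V →L[ℝ] V) :
    traceForm (A + B) C = traceForm A C + traceForm B C := by
  simp [traceForm, add_mul]

theorem traceForm_smul_left (c : ℝ) (A B : V →L[ℝ] V) :
    traceForm (c • A) B = c * traceForm A B := by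
  simp [traceForm]

theorem traceForm_neg_left (A B : V →L[ℝ] V) : traceForm (-A) B = -traceForm A B := by
  simp [traceForm]

theorem traceForm_mul_assoc (A B C : V →L[ℝ] V) :
    traceForm (A * B) C = traceForm A (B * C) := by
  simp [traceForm, mul_assoc]

theorem traceForm_mul_cycle (A B C : V →L[ℝ] V) :
    traceForm (A * B) C = traceForm B (C * A) := by
  rw [traceForm_mul_assoc, traceForm_comm, traceForm_mul_assoc]

/-- The derivation `[T, ·]` is skew with respect to the trace form. -/
theorem traceForm_commutator (T A B : V →L[ℝ] V) :
    traceForm (T * A - A * T) B = traceForm T (A * B - B * A) := by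
  rw [traceForm_sub_right, ← traceForm_mul_assoc, ← traceForm_mul_cycle, sub_eq_add_neg,
    traceForm_add_left, traceForm_neg_left, sub_eq_add_neg]

namespace IsQuaternionTriple

variable {J : Fin 3 → V →L[ℝ] V}

theorem rotate (hJ : IsQuaternionTriple J) : IsQuaternionTriple ![J 1, J 2, J 0] where
  sq i := by fin_cases i <;> simp [hJ.sq]
  mul := by simpa using hJ.mul12

theorem swap (hJ : IsQuaternionTriple J) : IsQuaternionTriple ![J 1, J 0, -J 2] where
  sq i := by fin_cases i <;> simp [hJ.sq]
  mul := by simp [hJ.anti01, hJ.mul]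

theorem mul01 (hJ : IsQuaternionTriple J) : J 0 * J 1 = J 2 := hJ.mul

theorem mul10 (hJ : IsQuaternionTriple J) : J 1 * J 0 = -J 2 := by rw [hJ.anti01, hJ.mul]

theorem mem_span_rotate : Submodule.span ℝ (Set.range ![J 1, J 2, J 0]) =
    Submodule.span ℝ (Set.range J) := by
  congr 1
  ext A
  simp only [Set.mem_range, Fin.exists_fin_succ, Fin.isValue]
  simp
  tauto

theorem mem_span_swap : Submodule.span ℝ (Set.range ![J 1, J 0, -J 2]) =
    Submodule.span ℝ (Set.range J) := by
  apply le_antisymm <;> rw [Submodule.span_le] <;> rintro _ ⟨i, rfl⟩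
  · fin_cases i
    · exact Submodule.subset_span ⟨1, rfl⟩
    · exact Submodule.subset_span ⟨0, rfl⟩
    · exact neg_mem (Submodule.subset_span ⟨2, rfl⟩)
  · fin_cases i
    · exact Submodule.subset_span ⟨1, rfl⟩
    · exact Submodule.subset_span ⟨0, rfl⟩
    · exact neg_mem_iff.1 (Submodule.subset_span (s := Set.range ![J 1, J 0, -J 2]) ⟨2, rfl⟩)

theorem exists_coeff {A : V →L[ℝ] V} (hA : A ∈ Submodule.span ℝ (Set.range J)) :
    ∃ c : Fin 3 → ℝ, A = c 0 • J 0 + c 1 • J 1 + c 2 • J 2 := by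
  rw [Submodule.mem_span_range_iff_exists_fun] at hA
  obtain ⟨c, rfl⟩ := hA
  exact ⟨c, by rw [Fin.sum_univ_three]⟩

theorem coeff_mem (a b c : ℝ) :
    a • J 0 + b • J 1 + c • J 2 ∈ Submodule.span ℝ (Set.range J) :=
  add_mem (add_mem (Submodule.smul_mem _ _ (Submodule.subset_span ⟨0, rfl⟩))
    (Submodule.smul_mem _ _ (Submodule.subset_span ⟨1, rfl⟩)))
    (Submodule.smul_mem _ _ (Submodule.subset_span ⟨2, rfl⟩))

theorem sq_coeff (hJ : IsQuaternionTriple J) (a b c : ℝ) :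
    (a • J 0 + b • J 1 + c • J 2) * (a • J 0 + b • J 1 + c • J 2) =
      -((a ^ 2 + b ^ 2 + c ^ 2) • (1 : V →L[ℝ] V)) := by
  have := hJ.sum_sq ![a, b, c]
  simpa [Fin.sum_univ_three] using this

/-- A complex structure in the span of a quaternionic triple is the first member of another
triple with the same span. -/
theorem exists_adapted [Nontrivial V] (hJ : IsQuaternionTriple J) {j : V →L[ℝ] V}
    (hj : j ∈ Submodule.span ℝ (Set.range J)) (hj2 : j * j = -1) :
    ∃ K : Fin 3 → V →L[ℝ] V, IsQuaternionTriple K ∧ K 0 = j ∧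
      Submodule.span ℝ (Set.range K) = Submodule.span ℝ (Set.range J) := by
  obtain ⟨a, rfl⟩ := exists_coeff hj
  rw [hJ.sq_coeff, neg_inj] at hj2
  have hone : (1 : V →L[ℝ] V) ≠ 0 := by
    obtain ⟨v, hv⟩ := exists_ne (0 : V)
    intro h
    exact hv (by simpa using congrArg (fun A : V →L[ℝ] V ↦ A v) h)
  have ha : a 0 ^ 2 + a 1 ^ 2 + a 2 ^ 2 = 1 := by
    by_contra hne
    have : (a 0 ^ 2 + a 1 ^ 2 + a 2 ^ 2 - 1) • (1 : V →L[ℝ] V) = 0 := by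
      rw [sub_smul, hj2, one_smul, sub_self]
    rcases smul_eq_zero.1 this with h | h
    · exact hne (sub_eq_zero.1 h)
    · exact hone h
  obtain ⟨b, hb1, hb2⟩ : ∃ b : Fin 3 → ℝ, b 0 ^ 2 + b 1 ^ 2 + b 2 ^ 2 = 1 ∧
      a 0 * b 0 + a 1 * b 1 + a 2 * b 2 = 0 := by
    by_cases h : a 0 ^ 2 + a 1 ^ 2 = 0
    · have h0 : a 0 = 0 := by nlinarith [sq_nonneg (a 0), sq_nonneg (a 1)]
      exact ⟨![1, 0, 0], by simp, by simp [h0]⟩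
    · have hpos : 0 < a 0 ^ 2 + a 1 ^ 2 := lt_of_le_of_ne (by positivity) (Ne.symm h)
      have hs := Real.sq_sqrt hpos.le
      have hs0 : √(a 0 ^ 2 + a 1 ^ 2) ≠ 0 := (Real.sqrt_pos.2 hpos).ne'
      refine ⟨![-a 1 / √(a 0 ^ 2 + a 1 ^ 2), a 0 / √(a 0 ^ 2 + a 1 ^ 2), 0], ?_, ?_⟩
      · simp only [Matrix.cons_val_zero, Matrix.cons_val_one, Matrix.cons_val]
        field_simp
        rw [hs]; ring
      · simp only [Matrix.cons_val_zero, Matrix.cons_val_one, Matrix.cons_val]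
        field_simp
        ring
  set c : Fin 3 → ℝ := ![a 1 * b 2 - a 2 * b 1, a 2 * b 0 - a 0 * b 2, a 0 * b 1 - a 1 * b 0]
    with hc
  have hprod : (a 0 • J 0 + a 1 • J 1 + a 2 • J 2) * (b 0 • J 0 + b 1 • J 1 + b 2 • J 2) =
      -(a 0 * b 0 + a 1 * b 1 + a 2 * b 2) • (1 : V →L[ℝ] V) +
        (c 0 • J 0 + c 1 • J 1 + c 2 • J 2) := by
    have h00 := hJ.sq 0
    have h11 := hJ.sq 1
    have h22 := hJ.sq 2
    simp only [hc, mul_add, add_mul, smul_mul_smul_comm, h00, h11, h22, hJ.mul01, hJ.mul10,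
      hJ.mul02, hJ.mul20, hJ.mul21, hJ.mul12, Matrix.cons_val_zero, Matrix.cons_val_one,
      Matrix.cons_val]
    module
  rw [hb2, neg_zero, zero_smul, zero_add] at hprod
  have hcn : c 0 ^ 2 + c 1 ^ 2 + c 2 ^ 2 = 1 := by
    have : c 0 ^ 2 + c 1 ^ 2 + c 2 ^ 2 = (a 0 ^ 2 + a 1 ^ 2 + a 2 ^ 2) *
      (b 0 ^ 2 + b 1 ^ 2 + b 2 ^ 2) - (a 0 * b 0 + a 1 * b 1 + a 2 * b 2) ^ 2 := by
      simp only [hc, Matrix.cons_val_zero, Matrix.cons_val_one, Matrix.cons_val]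
      ring
    rw [this, ha, hb1, hb2]; norm_num
  set K : Fin 3 → V →L[ℝ] V := ![a 0 • J 0 + a 1 • J 1 + a 2 • J 2,
    b 0 • J 0 + b 1 • J 1 + b 2 • J 2, c 0 • J 0 + c 1 • J 1 + c 2 • J 2] with hK
  have hac : a 0 * c 0 + a 1 * c 1 + a 2 * c 2 = 0 := by
    simp only [hc, Matrix.cons_val_zero, Matrix.cons_val_one, Matrix.cons_val]; ring
  have hbc : b 0 * c 0 + b 1 * c 1 + b 2 * c 2 = 0 := by
    simp only [hc, Matrix.cons_val_zero, Matrix.cons_val_one, Matrix.cons_val]; ring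
  have hKJ : ∀ i, K i ∈ Submodule.span ℝ (Set.range J) := by
    intro i; fin_cases i <;> exact coeff_mem _ _ _
  have hKt : IsQuaternionTriple K := by
    refine ⟨fun i ↦ ?_, by simpa [hK] using hprod⟩
    fin_cases i <;> simp [hK, hJ.sq_coeff, ha, hb1, hcn]
  refine ⟨K, hKt, rfl, ?_⟩
  apply le_antisymm <;> rw [Submodule.span_le] <;> rintro _ ⟨i, rfl⟩
  · exact hKJ i
  · -- the rows of an orthogonal matrix have orthonormal columns
    let O : Matrix (Fin 3) (Fin 3) ℝ := Matrix.of ![a, b, c]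
    have hO : O * O.transpose = 1 := by
      ext i j
      fin_cases i <;> fin_cases j <;>
        simp [O, Matrix.mul_apply, Fin.sum_univ_three] <;>
        linarith
    have hO' : O.transpose * O = 1 := mul_eq_one_comm.1 hO
    have hcol : ∀ i k, a i * a k + b i * b k + c i * c k = if i = k then 1 else 0 := by
      intro i k
      have := congrFun (congrFun hO' i) k
      simpa [O, Matrix.mul_apply, Fin.sum_univ_three, Matrix.one_apply] using this
    have : J i = a i • K 0 + b i • K 1 + c i • K 2 := by
      have h0 := hcol i 0
      have h1 := hcol i 1
      have h2 := hcol i 2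
      have hexp : a i • K 0 + b i • K 1 + c i • K 2 = (a i * a 0 + b i * b 0 + c i * c 0) • J 0 +
          (a i * a 1 + b i * b 1 + c i * c 1) • J 1 + (a i * a 2 + b i * b 2 + c i * c 2) • J 2 := by
        simp only [hK, Matrix.cons_val_zero, Matrix.cons_val_one, Matrix.cons_val]
        module
      rw [hexp, h0, h1, h2]
      fin_cases i <;> simp
    rw [this]
    exact coeff_mem _ _ _

end IsQuaternionTriple

section Curvature

variable [Module.Finite ℝ V] {J : Fin 3 → V →L[ℝ] V}

/-- The components of an endomorphism along a quaternionic triple. -/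
def tripleCoeff (J : Fin 3 → V →L[ℝ] V) (T : V →L[ℝ] V) (i : Fin 3) : ℝ :=
  -(Module.finrank ℝ V : ℝ)⁻¹ * traceForm T (J i)

theorem IsQuaternionTriple.commutator_zero [Nontrivial V] (hJ : IsQuaternionTriple J)
    {T : V →L[ℝ] V} (hT : T * J 0 - J 0 * T ∈ Submodule.span ℝ (Set.range J)) :
    T * J 0 - J 0 * T = (2 * tripleCoeff J T 2) • J 1 - (2 * tripleCoeff J T 1) • J 2 := by
  obtain ⟨c, hc⟩ := exists_coeff hT
  have hd : (Module.finrank ℝ V : ℝ) ≠ 0 := by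
    have := Module.finrank_pos (R := ℝ) (M := V)
    positivity
  have key : ∀ i, traceForm (T * J 0 - J 0 * T) (J i) = -(Module.finrank ℝ V : ℝ) * c i := by
    intro i
    rw [hc, traceForm_comm, ← hJ.traceForm_sum_eq i c, Fin.sum_univ_three]
  have h0 := key 0
  have h1 := key 1
  have h2 := key 2
  rw [traceForm_commutator] at h0 h1 h2
  rw [sub_self, show traceForm T 0 = 0 by simp [traceForm]] at h0
  rw [hJ.mul01, hJ.mul10, sub_neg_eq_add, traceForm_add_right] at h1
  rw [hJ.mul02, hJ.mul20, traceForm_sub_right, traceForm_neg_right] at h2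
  have e0 : c 0 = 0 := by
    rcases mul_eq_zero.1 h0.symm with h | h
    · exact absurd (neg_eq_zero.1 h) hd
    · exact h
  have e1 : c 1 = 2 * tripleCoeff J T 2 := by
    rw [tripleCoeff]; field_simp; linarith
  have e2 : c 2 = -(2 * tripleCoeff J T 1) := by
    rw [tripleCoeff]; field_simp; linarith
  rw [hc, e0, e1, e2]; module

theorem IsQuaternionTriple.commutator_one [Nontrivial V] (hJ : IsQuaternionTriple J)
    {T : V →L[ℝ] V} (hT : T * J 1 - J 1 * T ∈ Submodule.span ℝ (Set.range J)) :
    T * J 1 - J 1 * T = (2 * tripleCoeff J T 0) • J 2 - (2 * tripleCoeff J T 2) • J 0 := by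
  rw [← IsQuaternionTriple.mem_span_rotate] at hT
  exact hJ.rotate.commutator_zero hT

/-- An algebraic curvature tensor which satisfies the first Bianchi identity and takes values in
the normalizer of the span of a quaternionic triple. -/
structure IsQuaternionicCurvature (J : Fin 3 → V →L[ℝ] V)
    (R : V →ₗ[ℝ] V →ₗ[ℝ] V →L[ℝ] V) : Prop where
  alt : ∀ x y, R y x = -R x y
  bianchi : ∀ x y z, R x y z + R y z x + R z x y = 0
  normalizes : ∀ x y, ∀ A ∈ Submodule.span ℝ (Set.range J),
    R x y * A - A * R x y ∈ Submodule.span ℝ (Set.range J)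

namespace IsQuaternionicCurvature

variable {R : V →ₗ[ℝ] V →ₗ[ℝ] V →L[ℝ] V}

theorem rotate (hR : IsQuaternionicCurvature J R) :
    IsQuaternionicCurvature ![J 1, J 2, J 0] R where
  alt := hR.alt
  bianchi := hR.bianchi
  normalizes := by rw [IsQuaternionTriple.mem_span_rotate]; exact hR.normalizes

theorem swap (hR : IsQuaternionicCurvature J R) :
    IsQuaternionicCurvature ![J 1, J 0, -J 2] R where
  alt := hR.alt
  bianchi := hR.bianchi
  normalizes := by rw [IsQuaternionTriple.mem_span_swap]; exact hR.normalizes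

theorem commutator_zero [Nontrivial V] (hJ : IsQuaternionTriple J)
    (hR : IsQuaternionicCurvature J R) (x y : V) :
    R x y * J 0 - J 0 * R x y =
      (2 * tripleCoeff J (R x y) 2) • J 1 - (2 * tripleCoeff J (R x y) 1) • J 2 :=
  hJ.commutator_zero (hR.normalizes x y _ (Submodule.subset_span ⟨0, rfl⟩))

/-- The vanishing of the `(0,2)`-part, for the complex structure `J 0`, of the curvature of the span
of the triple. -/
theorem tripleCoeff_type [Nontrivial V] (hd : 4 < Module.finrank ℝ V)
    (hJ : IsQuaternionTriple J) (hR : IsQuaternionicCurvature J R) (x y : V) :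
    tripleCoeff J (R x y) 1 - tripleCoeff J (R (J 0 x) (J 0 y)) 1 =
      tripleCoeff J (R x (J 0 y)) 2 + tripleCoeff J (R (J 0 x) y) 2 := by
  have hJJ : ∀ v, J 0 (J 0 v) = -v := fun v ↦ by
    simpa using congrArg (fun A : V →L[ℝ] V ↦ A v) (hJ.sq 0)
  set Φ : V → V → V →L[ℝ] V := fun x y ↦ R x y * J 0 - J 0 * R x y with hΦ
  set b : V → V → V →L[ℝ] V := fun x y ↦
    Φ x y - Φ (J 0 x) (J 0 y) + J 0 * (Φ (J 0 x) y + Φ x (J 0 y)) with hb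
  have hcyc : ∀ x y z, b x y z + b y z x + b z x y = 0 := by
    intro x y z
    have e1 := hR.bianchi x y z
    have e2 := hR.bianchi (J 0 x) (J 0 y) (J 0 z)
    have f1 := hR.bianchi (J 0 x) y z
    have f2 := hR.bianchi x (J 0 y) z
    have f3 := hR.bianchi x y (J 0 z)
    have g1 := congrArg (J 0) (hR.bianchi (J 0 x) (J 0 y) z)
    have g2 := congrArg (J 0) (hR.bianchi (J 0 x) y (J 0 z))
    have g3 := congrArg (J 0) (hR.bianchi x (J 0 y) (J 0 z))
    have e1' := congrArg (J 0) e1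
    simp only [map_add, map_zero] at e1' g1 g2 g3
    simp only [hb, hΦ, add_apply, sub_apply, mul_apply_eq_comp, map_add, map_sub, hJJ]
    linear_combination (norm := module) f1 + f2 + f3 + g1 + g2 + g3 - e1' - e2
  set χ : V → V → ℝ := fun x y ↦ tripleCoeff J (R x y) 2 - tripleCoeff J (R (J 0 x) (J 0 y)) 2 +
    tripleCoeff J (R (J 0 x) y) 1 + tripleCoeff J (R x (J 0 y)) 1 with hχ
  set ψ : V → V → ℝ := fun x y ↦ tripleCoeff J (R x y) 1 - tripleCoeff J (R (J 0 x) (J 0 y)) 1 -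
    tripleCoeff J (R (J 0 x) y) 2 - tripleCoeff J (R x (J 0 y)) 2 with hψ
  have hbf : ∀ x y, b x y = (2 * χ x y) • J 1 - (2 * ψ x y) • J 2 := by
    intro x y
    simp only [hb, hΦ, hR.commutator_zero hJ, mul_add, mul_sub, mul_smul_comm, hJ.mul01, hJ.mul02,
      hχ, hψ]
    module
  have hJb : ∀ x y v, J 1 (b x y v) = -((2 * χ x y) • v + (2 * ψ x y) • J 0 v) := by
    intro x y v
    have h1 : J 1 (J 1 v) = -v := by
      simpa using congrArg (fun A : V →L[ℝ] V ↦ A v) (hJ.sq 1)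
    have h2 : J 1 (J 2 v) = J 0 v := by
      simpa using congrArg (fun A : V →L[ℝ] V ↦ A v) hJ.mul12
    rw [hbf]
    simp only [sub_apply, smul_apply, map_sub, map_smul, h1, h2]
    module
  let s : Fin 4 → V := ![x, J 0 x, y, J 0 y]
  let W := Submodule.span ℝ (Set.range s)
  have hWx : x ∈ W := Submodule.subset_span ⟨0, rfl⟩
  have hWx' : J 0 x ∈ W := Submodule.subset_span ⟨1, rfl⟩
  have hWy : y ∈ W := Submodule.subset_span ⟨2, rfl⟩
  have hWy' : J 0 y ∈ W := Submodule.subset_span ⟨3, rfl⟩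
  have hWJ : ∀ w ∈ W, J 0 w ∈ W := by
    intro w hw
    have : W ≤ W.comap (J 0 : V →ₗ[ℝ] V) := by
      rw [Submodule.span_le]
      rintro _ ⟨i, rfl⟩
      fin_cases i
      · exact hWx'
      · change J 0 (J 0 x) ∈ W
        rw [hJJ]; exact neg_mem hWx
      · exact hWy'
      · change J 0 (J 0 y) ∈ W
        rw [hJJ]; exact neg_mem hWy
    exact this hw
  obtain ⟨z, hz⟩ : ∃ z, z ∉ W := by
    by_contra! h
    have htop : W = ⊤ := by rw [eq_top_iff]; intro v _; exact h v
    have h1 : Module.finrank ℝ W ≤ 4 := by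
      exact (finrank_range_le_card (R := ℝ) s).trans (by simp)
    rw [htop, finrank_top] at h1
    omega
  have hmem : (2 * χ x y) • z + (2 * ψ x y) • J 0 z ∈ W := by
    have h := congrArg (J 1) (hcyc x y z)
    simp only [map_add, map_zero, hJb] at h
    have : (2 * χ x y) • z + (2 * ψ x y) • J 0 z = -((2 * χ y z) • x + (2 * ψ y z) • J 0 x)
        - ((2 * χ z x) • y + (2 * ψ z x) • J 0 y) := by
      linear_combination (norm := module) -h
    rw [this]
    exact sub_mem (neg_mem (add_mem (W.smul_mem _ hWx) (W.smul_mem _ hWx')))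
      (add_mem (W.smul_mem _ hWy) (W.smul_mem _ hWy'))
  have hmem2 : ((2 * χ x y) ^ 2 + (2 * ψ x y) ^ 2) • z ∈ W := by
    have h := sub_mem (W.smul_mem (2 * χ x y) hmem) (W.smul_mem (2 * ψ x y) (hWJ _ hmem))
    convert h using 1
    simp only [map_add, map_smul, hJJ]
    module
  have hzero : (2 * χ x y) ^ 2 + (2 * ψ x y) ^ 2 = 0 := by
    by_contra hne
    exact hz ((W.smul_mem_iff hne).1 hmem2)
  have hψ0 : ψ x y = 0 := by nlinarith [sq_nonneg (χ x y), sq_nonneg (ψ x y)]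
  simp only [hψ] at hψ0
  linarith

/-- The linear map `z ↦ R z x y`. -/
def ricciMap (R : V →ₗ[ℝ] V →ₗ[ℝ] V →L[ℝ] V) (x y : V) : V →ₗ[ℝ] V where
  toFun z := R z x y
  map_add' := by intros; simp
  map_smul' := by intros; simp

/-- The linear form `z ↦ tripleCoeff J (R z x) i`. -/
def coeffMap (J : Fin 3 → V →L[ℝ] V) (R : V →ₗ[ℝ] V →ₗ[ℝ] V →L[ℝ] V) (i : Fin 3) (x : V) :
    V →ₗ[ℝ] ℝ where
  toFun z := tripleCoeff J (R z x) i
  map_add' := by intros; simp [tripleCoeff, traceForm_add_left]; ring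
  map_smul' := by intros; simp [tripleCoeff, traceForm_smul_left]; ring

theorem trace_eq_ricci (hR : IsQuaternionicCurvature J R) (x y : V) :
    LinearMap.trace ℝ V (R x y) =
      LinearMap.trace ℝ V (ricciMap R y x) - LinearMap.trace ℝ V (ricciMap R x y) := by
  rw [← map_sub]
  congr 1
  ext z
  have h := hR.bianchi x y z
  rw [hR.alt z y] at h
  simp only [neg_apply] at h
  change R x y z = R z y x - R z x y
  linear_combination (norm := module) h

theorem tripleCoeff_eq_ricci [Nontrivial V] (hJ : IsQuaternionTriple J)
    (hR : IsQuaternionicCurvature J R) (x y : V) :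
    Module.finrank ℝ V * tripleCoeff J (R x y) 0 =
      LinearMap.trace ℝ V (ricciMap R x (J 0 y)) - LinearMap.trace ℝ V (ricciMap R y (J 0 x)) -
      2 * tripleCoeff J (R (J 2 x) y) 1 + 2 * tripleCoeff J (R (J 1 x) y) 2 +
      2 * tripleCoeff J (R (J 2 y) x) 1 - 2 * tripleCoeff J (R (J 1 y) x) 2 := by
  have hd : (Module.finrank ℝ V : ℝ) ≠ 0 := by
    have := Module.finrank_pos (R := ℝ) (M := V)
    positivity
  have hmap : ((J 0 * R x y : V →L[ℝ] V) : V →ₗ[ℝ] V) =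
      ricciMap R y (J 0 x) - (2 : ℝ) • (coeffMap J R 2 y).smulRight (J 1 x) +
      (2 : ℝ) • (coeffMap J R 1 y).smulRight (J 2 x) - ricciMap R x (J 0 y) +
      (2 : ℝ) • (coeffMap J R 2 x).smulRight (J 1 y) -
      (2 : ℝ) • (coeffMap J R 1 x).smulRight (J 2 y) := by
    ext z
    have h := congrArg (J 0) (hR.bianchi x y z)
    rw [hR.alt z y] at h
    simp only [map_add, map_zero, neg_apply, map_neg] at h
    have h1 := congrArg (fun A : V →L[ℝ] V ↦ A x) (hR.commutator_zero hJ z y)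
    have h2 := congrArg (fun A : V →L[ℝ] V ↦ A y) (hR.commutator_zero hJ z x)
    simp only [sub_apply, mul_apply_eq_comp, smul_apply] at h1 h2
    change J 0 (R x y z) = R z y (J 0 x) - (2 : ℝ) • (tripleCoeff J (R z y) 2 • J 1 x) +
      (2 : ℝ) • (tripleCoeff J (R z y) 1 • J 2 x) - R z x (J 0 y) +
      (2 : ℝ) • (tripleCoeff J (R z x) 2 • J 1 y) - (2 : ℝ) • (tripleCoeff J (R z x) 1 • J 2 y)
    simp only [smul_smul]
    linear_combination (norm := module) h - h1 + h2
  have ht := congrArg (LinearMap.trace ℝ V) hmap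
  simp only [map_add, map_sub, map_smul, LinearMap.trace_smulRight, smul_eq_mul] at ht
  change traceForm (J 0) (R x y) = _ at ht
  rw [traceForm_comm] at ht
  have h0 : Module.finrank ℝ V * tripleCoeff J (R x y) 0 = -traceForm (R x y) (J 0) := by
    rw [tripleCoeff]; field_simp
  rw [h0, ht]
  simp only [coeffMap, LinearMap.coe_mk, AddHom.coe_mk]
  ring

/-- The `J 0`-component of the curvature is `J 0`-invariant up to the failure of the trace of
the curvature to be so. -/
theorem tripleCoeff_zero_sub [Nontrivial V] (hd : 4 < Module.finrank ℝ V)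
    (hJ : IsQuaternionTriple J) (hR : IsQuaternionicCurvature J R) (x y : V) :
    (Module.finrank ℝ V + 4) *
      (tripleCoeff J (R x y) 0 - tripleCoeff J (R (J 0 x) (J 0 y)) 0) =
      -(LinearMap.trace ℝ V (R x (J 0 y)) + LinearMap.trace ℝ V (R (J 0 x) y)) := by
  have happ : ∀ {A B C : V →L[ℝ] V}, A * B = C → ∀ v, A (B v) = C v := fun h v ↦ by
    rw [← h]; rfl
  have h00 : ∀ v, J 0 (J 0 v) = -v := fun v ↦ by rw [happ (hJ.sq 0)]; simp
  have h20 : ∀ v, J 2 (J 0 v) = J 1 v := fun v ↦ by rw [happ hJ.mul20]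
  have h10 : ∀ v, J 1 (J 0 v) = -J 2 v := fun v ↦ by rw [happ hJ.mul10]; simp
  have hneg : ∀ T i, tripleCoeff J (-T) i = -tripleCoeff J T i := fun T i ↦ by
    simp [tripleCoeff, traceForm_neg_left]
  have a1 := fun x y ↦ hR.rotate.rotate.tripleCoeff_type hd hJ.rotate.rotate x y
  have a2 := fun x y ↦ hR.swap.tripleCoeff_type hd hJ.swap x y
  have r1 : ∀ T, tripleCoeff ![J 2, J 0, J 1] T 1 =
    tripleCoeff J T 0 := fun T ↦ rfl
  have r2 : ∀ T, tripleCoeff ![J 2, J 0, J 1] T 2 =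
    tripleCoeff J T 1 := fun T ↦ rfl
  have r3 : ∀ T, tripleCoeff ![J 1, J 0, -J 2] T 1 = tripleCoeff J T 0 := fun T ↦ rfl
  have r4 : ∀ T, tripleCoeff ![J 1, J 0, -J 2] T 2 = -tripleCoeff J T 2 := fun T ↦ by
    simp [tripleCoeff, traceForm_neg_right]
  simp only [Matrix.cons_val_zero, Matrix.cons_val_one, Matrix.cons_val, r1, r2, r3, r4] at a1 a2
  have b1 := a1 x y
  have b2 := a2 x y
  have b3 := a1 (J 0 x) (J 0 y)
  have b4 := a2 (J 0 x) (J 0 y)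
  have e1 := hR.tripleCoeff_eq_ricci hJ x y
  have e2 := hR.tripleCoeff_eq_ricci hJ (J 0 x) (J 0 y)
  have t1 := hR.trace_eq_ricci x (J 0 y)
  have t2 := hR.trace_eq_ricci (J 0 x) y
  have rn : ∀ u v, LinearMap.trace ℝ V (ricciMap R u (-v)) =
      -LinearMap.trace ℝ V (ricciMap R u v) := fun u v ↦ by
    rw [← map_neg]; congr 1; ext z; simp [ricciMap]
  have s1 := hR.alt x (J 2 y)
  have s2 := hR.alt x (J 1 y)
  have s3 := hR.alt (J 0 x) (J 1 y)
  have s4 := hR.alt (J 0 x) (J 2 y)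
  simp only [h00, h20, h10, map_neg, LinearMap.neg_apply, neg_neg, hneg, rn] at b3 b4 e2
  rw [s1, s2, hneg, hneg] at e1
  rw [s3, s4, hneg, hneg] at e2
  linarith

/-- `tripleCoeff J (R x y) 0` is `J 0`-invariant if and only if the trace of `R` is. -/
theorem tripleCoeff_invariant_iff [Nontrivial V] (hd : 4 < Module.finrank ℝ V)
    (hJ : IsQuaternionTriple J) (hR : IsQuaternionicCurvature J R) :
    (∀ x y, tripleCoeff J (R (J 0 x) (J 0 y)) 0 = tripleCoeff J (R x y) 0) ↔
      ∀ x y, LinearMap.trace ℝ V (R (J 0 x) (J 0 y)) = LinearMap.trace ℝ V (R x y) := by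
  have h00 : ∀ v, J 0 (J 0 v) = -v := fun v ↦ by
    simpa using congrArg (fun A : V →L[ℝ] V ↦ A v) (hJ.sq 0)
  have hpos : (Module.finrank ℝ V + 4 : ℝ) ≠ 0 := by positivity
  constructor
  · intro h x y
    have := hR.tripleCoeff_zero_sub hd hJ x (J 0 y)
    rw [h, sub_self, mul_zero, h00] at this
    simp only [map_neg, ContinuousLinearMap.toLinearMap_neg] at this
    linarith
  · intro h x y
    have h1 := hR.tripleCoeff_zero_sub hd hJ x y
    have h2 := h x (J 0 y)
    rw [h00] at h2
    simp only [map_neg, ContinuousLinearMap.toLinearMap_neg] at h2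
    rw [← h2, neg_add_cancel, neg_zero] at h1
    rcases mul_eq_zero.1 h1 with h3 | h3
    · exact absurd h3 hpos
    · linarith

end IsQuaternionicCurvature

end Curvature

end Algebra

end Quaternionic

namespace Quaternionic

section Algebra

variable {V : Type*} [AddCommGroup V] [Module ℝ V] [TopologicalSpace V]
  [IsTopologicalAddGroup V] [ContinuousSMul ℝ V] {J : Fin 3 → V →L[ℝ] V}

namespace IsQuaternionTriple

/-- If `S` is symmetric and takes values in the normalizer of the span of the triple, then
`x ↦ [S x, J 0]` is `J 0`-linear. -/
theorem commutator_complex_linear [Module.Finite ℝ V] (hd : 3 < Module.finrank ℝ V)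
    (hJ : IsQuaternionTriple J) (S : V →ₗ[ℝ] V →L[ℝ] V) (hS : ∀ x y, S x y = S y x)
    (hn : ∀ x, S x * J 0 - J 0 * S x ∈ Submodule.span ℝ (Set.range J)) (x : V) :
    S (J 0 x) * J 0 - J 0 * S (J 0 x) = J 0 * (S x * J 0 - J 0 * S x) := by
  have : Nontrivial V := Module.nontrivial_of_finrank_pos (R := ℝ) (by omega)
  have hJJ : ∀ v, J 0 (J 0 v) = -v := fun v ↦ by
    simpa using congrArg (fun A : V →L[ℝ] V ↦ A v) (hJ.sq 0)
  let c : Fin 3 → V →ₗ[ℝ] ℝ := fun i ↦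
    { toFun := fun x ↦ 2 * tripleCoeff J (S x) i
      map_add' := by intros; simp [tripleCoeff, traceForm_add_left]; ring
      map_smul' := by intros; simp [tripleCoeff, traceForm_smul_left]; ring }
  have hc : ∀ x, S x * J 0 - J 0 * S x = c 2 x • J 1 - c 1 x • J 2 := fun x ↦
    hJ.commutator_zero (hn x)
  set b : V → V →L[ℝ] V := fun x ↦
    S (J 0 x) * J 0 - J 0 * S (J 0 x) - J 0 * (S x * J 0 - J 0 * S x) with hb
  have hsymm : ∀ x y, b x y = b y x := by
    intro x y
    have e1 := hS (J 0 x) (J 0 y)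
    have e2 := congrArg (J 0) (hS (J 0 x) y)
    have e3 := congrArg (J 0) (hS x (J 0 y))
    have e4 := hS x y
    simp only [hb, sub_apply, mul_apply_eq_comp, map_sub, hJJ]
    linear_combination (norm := module) e1 - e2 - e3 - e4
  let f : V →ₗ[ℝ] Fin 2 → ℝ := LinearMap.pi
    ![c 2 ∘ₗ (J 0 : V →ₗ[ℝ] V) - c 1, c 1 ∘ₗ (J 0 : V →ₗ[ℝ] V) + c 2]
  have hbf : ∀ x, b x = 0 • J 0 + f x 0 • J 1 + (-f x 1) • J 2 := by
    intro x
    have h0 : f x 0 = c 2 (J 0 x) - c 1 x := rfl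
    have h1 : f x 1 = c 1 (J 0 x) + c 2 x := rfl
    simp only [hb, hc, h0, h1, mul_sub, mul_smul_comm, hJ.mul01, hJ.mul02]
    module
  obtain ⟨y, hy, hy0⟩ : ∃ y, f y = 0 ∧ y ≠ 0 := by
    have : LinearMap.ker f ≠ ⊥ := LinearMap.ker_ne_bot_of_finrank_lt (by simp; omega)
    obtain ⟨y, hy, hy0⟩ := (Submodule.ne_bot_iff _).1 this
    exact ⟨y, hy, hy0⟩
  have hby : b y = 0 := by rw [hbf, hy]; simp
  have hbxy : b x y = 0 := by rw [hsymm, hby]; simp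
  have hsq : b x * b x = -((0 ^ 2 + f x 0 ^ 2 + (-f x 1) ^ 2) • (1 : V →L[ℝ] V)) := by
    rw [hbf, ← hJ.sq_coeff]; simp
  have hz := congrArg (fun A : V →L[ℝ] V ↦ A y) hsq
  simp only [mul_apply_eq_comp, hbxy, map_zero, neg_apply, smul_apply, one_apply_eq_self] at hz
  have hs : (0 : ℝ) ^ 2 + f x 0 ^ 2 + (-f x 1) ^ 2 = 0 := by
    rcases smul_eq_zero.1 (neg_eq_zero.1 hz.symm) with h | h
    · exact h
    · exact absurd h hy0
  have h0 : f x 0 = 0 := by nlinarith [sq_nonneg (f x 0), sq_nonneg (f x 1)]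
  have h1 : f x 1 = 0 := by nlinarith [sq_nonneg (f x 0), sq_nonneg (f x 1)]
  have : b x = 0 := by rw [hbf, h0, h1]; simp
  exact sub_eq_zero.1 this

/-- The elements of the span which anticommute with `J 0`. -/
theorem exists_coeff_of_anticomm [Nontrivial V] (hJ : IsQuaternionTriple J) {A : V →L[ℝ] V}
    (hA : A ∈ Submodule.span ℝ (Set.range J)) (h : A * J 0 = -(J 0 * A)) :
    ∃ a b : ℝ, A = a • J 1 + b • J 2 := by
  obtain ⟨c, rfl⟩ := exists_coeff hA
  have h00 := hJ.sq 0
  have h2 : (2 * c 0) • (1 : V →L[ℝ] V) = 0 := by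
    have : (c 0 • J 0 + c 1 • J 1 + c 2 • J 2) * J 0 + J 0 * (c 0 • J 0 + c 1 • J 1 + c 2 • J 2) =
        -((2 * c 0) • (1 : V →L[ℝ] V)) := by
      simp only [add_mul, mul_add, smul_mul_assoc, mul_smul_comm, h00, hJ.mul01, hJ.mul10,
        hJ.mul20, hJ.mul02]
      module
    rw [h, neg_add_cancel] at this
    exact neg_eq_zero.1 this.symm
  have h0 : c 0 = 0 := by
    obtain ⟨v, hv⟩ := exists_ne (0 : V)
    have := congrArg (fun A : V →L[ℝ] V ↦ A v) h2
    simpa [hv] using this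
  exact ⟨c 1, c 2, by rw [h0]; simp⟩

end IsQuaternionTriple

/-- The projection `b ↦ (b + j b j) / 2` onto the endomorphisms anticommuting with `j`. -/
def antiProj (j b : V →L[ℝ] V) : V →L[ℝ] V := (1 / 2 : ℝ) • (b + j * b * j)

/-- The quadratic correction in the curvature of the projected connection. -/
def vertTerm (a v w : V →L[ℝ] V) : V →L[ℝ] V :=
  v * (a * w + w * a) + (a * w + w * a) * v - w * (a * v + v * a) - (a * v + v * a) * w

theorem antiProj_anticomm {j : V →L[ℝ] V} (hj : j * j = -1) (b : V →L[ℝ] V) :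
    antiProj j b * j = -(j * antiProj j b) := by
  simp only [antiProj, smul_mul_assoc, mul_smul_comm, add_mul, mul_add, ← smul_neg]
  congr 1
  rw [mul_assoc, hj, ← mul_assoc, ← mul_assoc, hj]
  simp

namespace IsQuaternionTriple

theorem antiProj_mem (hJ : IsQuaternionTriple J) {A : V →L[ℝ] V}
    (hA : A ∈ Submodule.span ℝ (Set.range J)) :
    antiProj (J 0) A ∈ Submodule.span ℝ (Set.range J) := by
  obtain ⟨c, rfl⟩ := exists_coeff hA
  have h00 := hJ.sq 0
  have : antiProj (J 0) (c 0 • J 0 + c 1 • J 1 + c 2 • J 2) =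
      (0 : ℝ) • J 0 + c 1 • J 1 + c 2 • J 2 := by
    simp only [antiProj, add_mul, mul_add, smul_mul_assoc, mul_smul_comm, h00, hJ.mul01,
      hJ.mul10, hJ.mul20, hJ.mul02, neg_mul, one_mul, smul_neg, neg_neg]
    module
  rw [this]
  exact coeff_mem _ _ _

theorem antiProj_commutator [Module.Finite ℝ V] [Nontrivial V] (hJ : IsQuaternionTriple J)
    {T : V →L[ℝ] V} (hT : ∀ A ∈ Submodule.span ℝ (Set.range J),
      T * A - A * T ∈ Submodule.span ℝ (Set.range J)) {a : V →L[ℝ] V}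
    (ha : a ∈ Submodule.span ℝ (Set.range J)) (haj : a * J 0 = -(J 0 * a)) :
    antiProj (J 0) (T * a - a * T) = (2 * tripleCoeff J T 0) • (J 0 * a) := by
  obtain ⟨p, q, rfl⟩ := hJ.exists_coeff_of_anticomm ha haj
  have h1 := hJ.commutator_one (hT (J 1) (Submodule.subset_span ⟨1, rfl⟩))
  have h2 : T * J 2 - J 2 * T = (2 * tripleCoeff J T 1) • J 0 - (2 * tripleCoeff J T 0) • J 1 :=
    hJ.rotate.commutator_one (T := T) (by
      rw [mem_span_rotate]; exact hT (J 2) (Submodule.subset_span ⟨2, rfl⟩))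
  have h00 := hJ.sq 0
  have : T * (p • J 1 + q • J 2) - (p • J 1 + q • J 2) * T =
      p • (T * J 1 - J 1 * T) + q • (T * J 2 - J 2 * T) := by
    simp only [add_mul, mul_add, smul_mul_assoc, mul_smul_comm, smul_sub]; abel
  rw [this, h1, h2]
  simp only [antiProj, add_mul, mul_add, sub_mul, mul_sub, smul_mul_assoc, mul_smul_comm, h00,
    hJ.mul01, hJ.mul10, hJ.mul20, hJ.mul02, neg_mul, one_mul, smul_neg, neg_neg]
  module

theorem vertTerm_complex [Nontrivial V] (hJ : IsQuaternionTriple J) {a v w : V →L[ℝ] V}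
    (ha : a ∈ Submodule.span ℝ (Set.range J)) (haj : a * J 0 = -(J 0 * a))
    (hv : v ∈ Submodule.span ℝ (Set.range J)) (hvj : v * J 0 = -(J 0 * v))
    (hw : w ∈ Submodule.span ℝ (Set.range J)) (hwj : w * J 0 = -(J 0 * w)) :
    vertTerm a (J 0 * v) (J 0 * w) = vertTerm a v w := by
  obtain ⟨p, q, rfl⟩ := hJ.exists_coeff_of_anticomm ha haj
  obtain ⟨p', q', rfl⟩ := hJ.exists_coeff_of_anticomm hv hvj
  obtain ⟨p'', q'', rfl⟩ := hJ.exists_coeff_of_anticomm hw hwj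
  have h11 := hJ.sq 1
  have h22 := hJ.sq 2
  simp only [vertTerm, add_mul, mul_add, smul_mul_assoc, mul_smul_comm, h11, h22,
    hJ.mul01, hJ.mul12, hJ.mul21, hJ.mul02, smul_neg, mul_neg, neg_mul, mul_one, one_mul, neg_neg]
  rw [show J 1 * J 0 = -J 2 from hJ.mul10]
  simp only [hJ.mul20]
  module

end IsQuaternionTriple

/-- If `a` anticommutes with `j` and `b`, `w` are the derivatives of `a`, `j`, then the
derivative of the projection onto the endomorphisms anticommuting with `j` contributes a term which
is quadratic in the derivatives of `j`. -/
theorem antiProj_deriv_proj {j v w a b : V →L[ℝ] V} (hj : j * j = -1) (hv : v * j = -(j * v))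
    (hb : b * j + a * w = -(w * a + j * b)) :
    antiProj j ((1 / 2 : ℝ) • (v * b * j + j * b * v)) =
      -(1 / 4 : ℝ) • (v * (a * w + w * a) + (a * w + w * a) * v) := by
  have hs : b * j + j * b = -(a * w + w * a) := by
    linear_combination (norm := abel) hb
  have e : v * b * j + j * b * v + j * (v * b * j + j * b * v) * j =
      v * (b * j + j * b) + (b * j + j * b) * v := by
    have e1 : j * (v * b * j) * j = v * j * b := by
      calc j * (v * b * j) * j = (j * v) * b * (j * j) := by noncomm_ring
        _ = v * j * b := by rw [hj, hv]; noncomm_ring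
    have e2 : j * (j * b * v) * j = b * j * v := by
      calc j * (j * b * v) * j = (j * j) * b * (v * j) := by noncomm_ring
        _ = b * j * v := by rw [hj, hv]; noncomm_ring
    rw [mul_add, add_mul, e1, e2]; noncomm_ring
  rw [antiProj, mul_smul_comm, smul_mul_assoc, ← smul_add, e, hs]
  simp only [mul_neg, neg_mul]
  module

theorem antiProj_idem {j : V →L[ℝ] V} (hj : j * j = -1) (b : V →L[ℝ] V) :
    antiProj j (antiProj j b) = antiProj j b := by
  have e : j * (j * b * j) * j = b := by
    calc j * (j * b * j) * j = (j * j) * b * (j * j) := by noncomm_ring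
      _ = b := by rw [hj]; noncomm_ring
  simp only [antiProj, mul_smul_comm, smul_mul_assoc, mul_add, add_mul, e]
  module

theorem antiProj_add (j b c : V →L[ℝ] V) : antiProj j (b + c) = antiProj j b + antiProj j c := by
  simp only [antiProj, mul_add, add_mul]; module

theorem antiProj_sub (j b c : V →L[ℝ] V) : antiProj j (b - c) = antiProj j b - antiProj j c := by
  simp only [antiProj, mul_sub, sub_mul]; module

theorem antiProj_smul (j : V →L[ℝ] V) (r : ℝ) (b : V →L[ℝ] V) :
    antiProj j (r • b) = r • antiProj j b := by
  simp only [antiProj, mul_smul_comm, smul_mul_assoc]; module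

theorem antiProj_of_anticomm {j a : V →L[ℝ] V} (hj : j * j = -1) (ha : a * j = -(j * a)) :
    antiProj j a = a := by
  have : j * a * j = a := by rw [mul_assoc, ha, mul_neg, ← mul_assoc, hj]; simp
  rw [antiProj, this]; module

end Algebra

section AlternatingTrace

variable {W : Type*} [AddCommGroup W] [Module ℝ W]

/-- A linear map acts on top-degree alternating forms, as a derivation, by its trace. -/
theorem AlternatingMap.sum_update_eq_trace {k : ℕ} [Module.Finite ℝ W]
    (hk : Module.finrank ℝ W = k) (η : W [⋀^Fin k]→ₗ[ℝ] ℝ) (T : W →ₗ[ℝ] W) (v : Fin k → W) :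
    ∑ i, η (Function.update v i (T (v i))) = LinearMap.trace ℝ W T * η v := by
  classical
  let f : W [⋀^Fin k]→ₗ[ℝ] ℝ :=
    { toFun := fun v ↦ ∑ i, η (Function.update v i (T (v i)))
      map_update_add' := by
        intro inst v i x y
        obtain rfl : inst = instDecidableEqFin k := Subsingleton.elim _ _
        rw [← Finset.sum_add_distrib]
        refine Finset.sum_congr rfl fun l _ ↦ ?_
        by_cases h : l = i
        · subst h; simp
        · simp only [Function.update_of_ne h, Function.update_comm (Ne.symm h)]
          simp
      map_update_smul' := by
        intro inst v i c x
        obtain rfl : inst = instDecidableEqFin k := Subsingleton.elim _ _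
        rw [Finset.smul_sum]
        refine Finset.sum_congr rfl fun l _ ↦ ?_
        by_cases h : l = i
        · subst h; simp
        · simp only [Function.update_of_ne h, Function.update_comm (Ne.symm h)]
          simp
      map_eq_zero_of_eq' := by
        intro v a b hab hne
        have hz : ∀ l, l ≠ a → l ≠ b → η (Function.update v l (T (v l))) = 0 := by
          intro l hla hlb
          refine η.map_eq_zero_of_eq _ ?_ hne
          rw [Function.update_of_ne hla.symm, Function.update_of_ne hlb.symm, hab]
        rw [Finset.sum_eq_add a b hne (fun l _ h ↦ hz l h.1 h.2) (by simp) (by simp)]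
        have hsw : Function.update v b (T (v b)) =
            Function.update v a (T (v a)) ∘ Equiv.swap a b := by
          funext l
          by_cases hla : l = a
          · subst hla; simp [Function.update_of_ne hne, Function.update_of_ne hne.symm, hab]
          · by_cases hlb : l = b
            · subst hlb; simp [hab]
            · simp [Function.update_of_ne hla, Function.update_of_ne hlb,
                Equiv.swap_apply_of_ne_of_ne hla hlb]
        rw [hsw, η.map_swap _ hne]
        simp }
  let e : Module.Basis (Fin k) ℝ W := (Module.finBasis ℝ W).reindex (finCongr hk)
  have hf : f = LinearMap.trace ℝ W T • η := by
    refine Module.Basis.ext_alternating e fun s hs ↦ ?_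
    obtain ⟨σ, rfl⟩ : ∃ σ : Equiv.Perm (Fin k), s = σ :=
      ⟨Equiv.ofBijective s (Finite.injective_iff_bijective.1 hs), rfl⟩
    have : ∀ i, η (Function.update (fun i ↦ e (σ i)) i (T (e (σ i)))) =
        e.repr (T (e (σ i))) (σ i) * η (fun i ↦ e (σ i)) := by
      intro i
      set w : Fin k → W := fun i ↦ e (σ i) with hw
      have hT : T (w i) = ∑ l, e.repr (T (w i)) (σ l) • w l := by
        rw [← Equiv.sum_comp σ.symm]
        simp only [hw, Equiv.apply_symm_apply]
        exact (e.sum_repr _).symm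
      have : η (Function.update w i (T (w i))) =
          ∑ l, e.repr (T (w i)) (σ l) • η (Function.update w i (w l)) := by
        conv_lhs => rw [hT]
        rw [η.map_update_sum]
        simp
      rw [this, Finset.sum_eq_single i]
      · simp [hw]
      · intro l _ hl
        rw [η.map_update_self w hl.symm, smul_zero]
      · simp
    change ∑ i, η (Function.update (fun i ↦ e (σ i)) i (T (e (σ i)))) =
      LinearMap.trace ℝ W T • η (fun i ↦ e (σ i))
    simp only [this]
    rw [← Finset.sum_mul, smul_eq_mul, Equiv.sum_comp σ (fun i ↦ e.repr (T (e i)) i),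
      LinearMap.trace_eq_matrix_trace ℝ e]
    simp [Matrix.trace, LinearMap.toMatrix_apply]
  exact congrArg (fun g : W [⋀^Fin k]→ₗ[ℝ] ℝ ↦ g v) hf

end AlternatingTrace

end Quaternionic

namespace Quaternionic

section Calculus

variable {E' : Type*} [NormedAddCommGroup E'] [NormedSpace ℝ E']
  {H' : Type*} [TopologicalSpace H'] {I' : ModelWithCorners ℝ E' H'}
  {N : Type*} [TopologicalSpace N] [ChartedSpace H' N]
  {F : Type*} [NormedAddCommGroup F] [NormedSpace ℝ F]
  {G : Type*} [NormedAddCommGroup G] [NormedSpace ℝ G]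
  {W : Type*} [NormedAddCommGroup W] [NormedSpace ℝ W]

theorem mvfderiv_clm_comp (B : F →L[ℝ] G) {f : N → F} {z : N} (hf : MDifferentiableAt I' 𝓘(ℝ, F) f z)
    (U : TangentSpace I' z) :
    mvfderiv I' (fun w ↦ B (f w)) z U = B (mvfderiv I' f z U) := by
  have h := (B.hasFDerivAt (x := f z)).hasMFDerivAt.comp z hf.hasMFDerivAt
  exact congrArg (fun L ↦ L U) h.mfderiv

theorem mdifferentiableAt_clm_comp (B : F →L[ℝ] G) {f : N → F} {z : N}
    (hf : MDifferentiableAt I' 𝓘(ℝ, F) f z) :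
    MDifferentiableAt I' 𝓘(ℝ, G) (fun w ↦ B (f w)) z :=
  B.differentiableAt.mdifferentiableAt.comp z hf

theorem hasMFDerivAt_bilin (B : F →L[ℝ] G →L[ℝ] W) {f : N → F} {g : N → G} {z : N}
    (hf : MDifferentiableAt I' 𝓘(ℝ, F) f z) (hg : MDifferentiableAt I' 𝓘(ℝ, G) g z) :
    HasMFDerivAt I' 𝓘(ℝ, W) (fun w ↦ B (f w) (g w)) z
      (B.precompR E' (f z) (show E' →L[ℝ] G from mvfderiv I' g z) +
        B.precompL E' (show E' →L[ℝ] F from mvfderiv I' f z) (g z)) := by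
  refine ⟨?_, ?_⟩
  · have h1 : ContinuousAt f z := hf.continuousAt
    have h2 : ContinuousAt g z := hg.continuousAt
    exact (B.continuous.continuousAt.comp h1).clm_apply h2
  · have key := B.hasFDerivWithinAt_of_bilinear hf.hasMFDerivAt.2 hg.hasMFDerivAt.2
    have e : (extChartAt I' z).symm (extChartAt I' z z) = z := extChartAt_to_inv z
    change HasFDerivWithinAt _ (B.precompR E' (f ((extChartAt I' z).symm (extChartAt I' z z)))
      (show E' →L[ℝ] G from mvfderiv I' g z) + B.precompL E' (show E' →L[ℝ] F from mvfderiv I' f z)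
        (g ((extChartAt I' z).symm (extChartAt I' z z)))) _ _ at key
    rw [e] at key
    exact key

theorem mvfderiv_bilin (B : F →L[ℝ] G →L[ℝ] W) {f : N → F} {g : N → G} {z : N}
    (hf : MDifferentiableAt I' 𝓘(ℝ, F) f z) (hg : MDifferentiableAt I' 𝓘(ℝ, G) g z)
    (U : TangentSpace I' z) :
    mvfderiv I' (fun w ↦ B (f w) (g w)) z U =
      B (mvfderiv I' f z U) (g z) + B (f z) (mvfderiv I' g z U) :=
  (congrArg (fun L : E' →L[ℝ] W ↦ L U) (hasMFDerivAt_bilin B hf hg).mfderiv).trans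
    (add_comm (B (f z) (mvfderiv I' g z U)) (B (mvfderiv I' f z U) (g z)))

theorem mdifferentiableAt_bilin (B : F →L[ℝ] G →L[ℝ] W) {f : N → F} {g : N → G} {z : N}
    (hf : MDifferentiableAt I' 𝓘(ℝ, F) f z) (hg : MDifferentiableAt I' 𝓘(ℝ, G) g z) :
    MDifferentiableAt I' 𝓘(ℝ, W) (fun w ↦ B (f w) (g w)) z :=
  (hasMFDerivAt_bilin B hf hg).mdifferentiableAt

theorem mvfderiv_congr_of_eventuallyEq {f g : N → F} {z : N} (h : f =ᶠ[𝓝 z] g) :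
    mvfderiv I' f z = mvfderiv I' g z := by
  have := h.mfderiv_eq (I := I') (I' := 𝓘(ℝ, F))
  ext U
  exact congrArg (fun L : E' →L[ℝ] F ↦ L U) this

theorem mvfderiv_comp_map {E : Type*} [NormedAddCommGroup E] [NormedSpace ℝ E]
    {H : Type*} [TopologicalSpace H] {I : ModelWithCorners ℝ E H}
    {M : Type*} [TopologicalSpace M] [ChartedSpace H M] {g : M → F} {f : N → M} {z : N}
    (hg : MDifferentiableAt I 𝓘(ℝ, F) g (f z)) (hf : MDifferentiableAt I' I f z)
    (U : TangentSpace I' z) :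
    mvfderiv I' (fun w ↦ g (f w)) z U = mvfderiv I g (f z) (mfderiv I' I f z U) :=
  congrArg (fun L : E' →L[ℝ] F ↦ L U) (mfderiv_comp z hg hf)

variable [IsManifold I' ∞ N]

theorem eventually_mdifferentiableAt {E : Type*} [NormedAddCommGroup E] [NormedSpace ℝ E]
    {H : Type*} [TopologicalSpace H] {I : ModelWithCorners ℝ E H}
    {M : Type*} [TopologicalSpace M] [ChartedSpace H M] [IsManifold I 1 M] {f : N → M} {z : N}
    (hf : ContMDiffAt I' I ∞ f z) : ∀ᶠ w in 𝓝 z, MDifferentiableAt I' I f w := by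
  have : IsManifold I' 1 N := IsManifold.of_le (n := ∞) (by simp)
  have h := (contMDiffAt_iff_contMDiffAt_nhds (n := 1) (by simp)).1 (hf.of_le (by simp))
  filter_upwards [h] with w hw using hw.mdifferentiableAt (by simp)

/-- The derivative of a smooth function along a smooth vector field is smooth. -/
theorem contMDiffAt_mvfderiv_apply {f : N → F} {X : Π z : N, TangentSpace I' z} {z : N}
    (hf : ContMDiffAt I' 𝓘(ℝ, F) ∞ f z)
    (hX : ContMDiffAt I' I'.tangent ∞ (fun w ↦ (⟨w, X w⟩ : TangentBundle I' N)) z) :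
    ContMDiffAt I' 𝓘(ℝ, F) ∞ (fun w ↦ mvfderiv I' f w (X w)) z := by
  have h1 : ContMDiffAt I' 𝓘(ℝ, E' →L[ℝ] F) ∞
      (inTangentCoordinates I' 𝓘(ℝ, F) id f (mfderiv I' 𝓘(ℝ, F) f) z) z :=
    hf.mfderiv_const (by simp)
  have h2 := ContMDiffAt.clm_apply_of_inCoordinates (F₁ := E') (E₁ := (TangentSpace I' : N → Type _))
    (F₂ := F) (E₂ := (TangentSpace 𝓘(ℝ, F) : F → Type _)) (IB₁ := I') (IB₂ := 𝓘(ℝ, F))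
    (b₁ := id) (b₂ := f) (ϕ := fun w ↦ mfderiv I' 𝓘(ℝ, F) f w) (v := X) h1 hX hf
  have h3 := (contMDiffAt_totalSpace.1 h2).2
  refine h3.congr_of_eventuallyEq (Filter.Eventually.of_forall fun w ↦ ?_)
  simp only [trivializationAt_model_space_apply]
  rfl

/-- The commutator of the derivatives along two vector fields is the derivative along their
bracket. -/
theorem mvfderiv_mlieBracket_real [CompleteSpace E'] [Nontrivial E'] {f : N → ℝ}
    {X Y : Π z : N, TangentSpace I' z} {z : N} (hf : ContMDiffAt I' 𝓘(ℝ, ℝ) ∞ f z)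
    (hX : ContMDiffAt I' I'.tangent ∞ (fun w ↦ (⟨w, X w⟩ : TangentBundle I' N)) z)
    (hY : ContMDiffAt I' I'.tangent ∞ (fun w ↦ (⟨w, Y w⟩ : TangentBundle I' N)) z) :
    mvfderiv I' f z (VectorField.mlieBracket I' X Y z) =
      mvfderiv I' (fun w ↦ mvfderiv I' f w (Y w)) z (X z) -
        mvfderiv I' (fun w ↦ mvfderiv I' f w (X w)) z (Y z) := by
  have : Nontrivial (TangentSpace I' z) := inferInstanceAs (Nontrivial E')
  obtain ⟨v, hv⟩ := exists_ne (0 : TangentSpace I' z)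
  set V : Π w : N, TangentSpace I' w := extend E' v with hVdef
  have hVz : V z = v := by simp [hVdef]
  have hV : ContMDiffAt I' I'.tangent ∞ (fun w ↦ (⟨w, V w⟩ : TangentBundle I' N)) z :=
    contMDiffAt_extend I' E' v
  have : IsManifold I' (minSmoothness ℝ 3) N := by
    rw [minSmoothness_of_isRCLikeNormedField]
    exact IsManifold.of_le (n := ∞) (WithTop.coe_le_coe.2 le_top)
  have h2 : minSmoothness ℝ 2 ≤ ∞ := by
    rw [minSmoothness_of_isRCLikeNormedField]; exact WithTop.coe_le_coe.2 le_top
  have hfd : ∀ᶠ w in 𝓝 z, MDifferentiableAt I' 𝓘(ℝ, ℝ) f w := by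
    exact eventually_mdifferentiableAt hf
  have hVd : ∀ᶠ w in 𝓝 z, MDifferentiableAt I' I'.tangent
      (fun w ↦ (⟨w, V w⟩ : TangentBundle I' N)) w := by
    exact eventually_mdifferentiableAt hV
  have hbr : ∀ {A B : Π w : N, TangentSpace I' w},
      ContMDiffAt I' I'.tangent ∞ (fun w ↦ (⟨w, A w⟩ : TangentBundle I' N)) z →
      ContMDiffAt I' I'.tangent ∞ (fun w ↦ (⟨w, B w⟩ : TangentBundle I' N)) z →
      ContMDiffAt I' I'.tangent ∞
        (fun w ↦ (⟨w, VectorField.mlieBracket I' A B w⟩ : TangentBundle I' N)) z := by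
    intro A B hA hB
    have : IsManifold I' (((⊤ : ℕ∞) : WithTop ℕ∞) + 1) N := by simpa using ‹IsManifold I' ∞ N›
    exact ContMDiffAt.mlieBracket_vectorField (n := ⊤) (m := ⊤) hA hB
      (by rw [minSmoothness_of_isRCLikeNormedField]; simp)
  have key : ∀ {A B : Π w : N, TangentSpace I' w},
      ContMDiffAt I' I'.tangent ∞ (fun w ↦ (⟨w, A w⟩ : TangentBundle I' N)) z →
      ContMDiffAt I' I'.tangent ∞ (fun w ↦ (⟨w, B w⟩ : TangentBundle I' N)) z →
      VectorField.mlieBracket I' A (VectorField.mlieBracket I' B (f • V)) z =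
        mvfderiv I' (fun w ↦ mvfderiv I' f w (B w)) z (A z) • v +
        mvfderiv I' f z (B z) • VectorField.mlieBracket I' A V z +
        (mvfderiv I' f z (A z) • VectorField.mlieBracket I' B V z +
        f z • VectorField.mlieBracket I' A (VectorField.mlieBracket I' B V) z) := by
    intro A B hA hB
    have hev : VectorField.mlieBracket I' B (f • V) =ᶠ[𝓝 z]
        (fun w ↦ mvfderiv I' f w (B w)) • V + f • VectorField.mlieBracket I' B V := by
      filter_upwards [hfd, hVd] with w h1 h2
      exact VectorField.mlieBracket_smul_right h1 h2
    rw [(Filter.EventuallyEq.refl _ A).mlieBracket_vectorField_eq hev]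
    have hfB := (contMDiffAt_mvfderiv_apply hf hB).mdifferentiableAt (by simp)
    have hBV := (hbr hB hV).mdifferentiableAt (by simp)
    have hV1 := hV.mdifferentiableAt (by simp)
    have hf1 := hf.mdifferentiableAt (by simp)
    rw [VectorField.mlieBracket_add_right (hfB.smul_section hV1) (hf1.smul_section hBV),
      VectorField.mlieBracket_smul_right hfB hV1, VectorField.mlieBracket_smul_right hf1 hBV, hVz]
  have hfV : ContMDiffAt I' I'.tangent ∞ (fun w ↦ (⟨w, (f • V) w⟩ : TangentBundle I' N)) z :=
    hf.smul_section hV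
  have J1 := VectorField.leibniz_identity_mlieBracket_apply (hX.of_le h2) (hY.of_le h2)
    (hfV.of_le h2)
  have J2 := VectorField.leibniz_identity_mlieBracket_apply (hX.of_le h2) (hY.of_le h2)
    (hV.of_le h2)
  rw [key hX hY, key hY hX, VectorField.mlieBracket_smul_right (hf.mdifferentiableAt (by simp))
    (hV.mdifferentiableAt (by simp)), J2, hVz] at J1
  have hfin : (mvfderiv I' f z (VectorField.mlieBracket I' X Y z) -
      (mvfderiv I' (fun w ↦ mvfderiv I' f w (Y w)) z (X z) -
        mvfderiv I' (fun w ↦ mvfderiv I' f w (X w)) z (Y z))) • v = 0 := by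
    linear_combination (norm := module) -J1
  rcases smul_eq_zero.1 hfin with h | h
  · exact sub_eq_zero.1 h
  · exact absurd h hv

/-- The commutator of the derivatives along two vector fields is the derivative along their
bracket. -/
theorem mvfderiv_mlieBracket [CompleteSpace E'] [Nontrivial E'] {f : N → F}
    {X Y : Π z : N, TangentSpace I' z} {z : N} (hf : ContMDiffAt I' 𝓘(ℝ, F) ∞ f z)
    (hX : ContMDiffAt I' I'.tangent ∞ (fun w ↦ (⟨w, X w⟩ : TangentBundle I' N)) z)
    (hY : ContMDiffAt I' I'.tangent ∞ (fun w ↦ (⟨w, Y w⟩ : TangentBundle I' N)) z) :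
    mvfderiv I' f z (VectorField.mlieBracket I' X Y z) =
      mvfderiv I' (fun w ↦ mvfderiv I' f w (Y w)) z (X z) -
        mvfderiv I' (fun w ↦ mvfderiv I' f w (X w)) z (Y z) := by
  refine (SeparatingDual.eq_iff_forall_dual_eq (R := ℝ)).2 fun ℓ ↦ ?_
  have hfd : ∀ᶠ w in 𝓝 z, MDifferentiableAt I' 𝓘(ℝ, F) f w := by
    exact eventually_mdifferentiableAt hf
  have hℓf : ContMDiffAt I' 𝓘(ℝ, ℝ) ∞ (fun w ↦ ℓ (f w)) z :=
    (ℓ.contMDiff (n := ∞)).contMDiffAt.comp z hf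
  have h := mvfderiv_mlieBracket_real hℓf hX hY
  have e : ∀ {A : Π w : N, TangentSpace I' w}, (fun w ↦ mvfderiv I' (fun w ↦ ℓ (f w)) w (A w))
      =ᶠ[𝓝 z] fun w ↦ ℓ (mvfderiv I' f w (A w)) := by
    intro A
    filter_upwards [hfd] with w hw using mvfderiv_clm_comp ℓ hw _
  have d : ∀ {A : Π w : N, TangentSpace I' w},
      ContMDiffAt I' I'.tangent ∞ (fun w ↦ (⟨w, A w⟩ : TangentBundle I' N)) z →
      MDifferentiableAt I' 𝓘(ℝ, F) (fun w ↦ mvfderiv I' f w (A w)) z := fun hA ↦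
    (contMDiffAt_mvfderiv_apply hf hA).mdifferentiableAt (by simp)
  rw [mvfderiv_congr_of_eventuallyEq e, mvfderiv_congr_of_eventuallyEq e,
    mvfderiv_clm_comp ℓ (d hX), mvfderiv_clm_comp ℓ (d hY), mvfderiv_clm_comp ℓ hfd.self_of_nhds]
    at h
  rw [map_sub]
  exact h

end Calculus

end Quaternionic

namespace Quaternionic

section LocalConnection

variable {E' : Type*} [NormedAddCommGroup E'] [NormedSpace ℝ E']
  {H' : Type*} [TopologicalSpace H'] {I' : ModelWithCorners ℝ E' H'}
  {N : Type*} [TopologicalSpace N] [ChartedSpace H' N]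
  {E : Type*} [NormedAddCommGroup E] [NormedSpace ℝ E]
  {F : Type*} [NormedAddCommGroup F] [NormedSpace ℝ F]

/-- The action of endomorphisms on endomorphisms by commutators. -/
def adAction (E : Type*) [NormedAddCommGroup E] [NormedSpace ℝ E] :
    (E →L[ℝ] E) →L[ℝ] (E →L[ℝ] E) →L[ℝ] (E →L[ℝ] E) :=
  ContinuousLinearMap.mul ℝ (E →L[ℝ] E) - (ContinuousLinearMap.mul ℝ (E →L[ℝ] E)).flip

@[simp]
theorem adAction_apply (A B : E →L[ℝ] E) : adAction E A B = A * B - B * A := rfl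

/-- A Lie algebra action of the endomorphisms of `E` on `F`. -/
def IsLieAction (ρ : (E →L[ℝ] E) →L[ℝ] F →L[ℝ] F) : Prop :=
  ∀ A B u, ρ (A * B - B * A) u = ρ A (ρ B u) - ρ B (ρ A u)

theorem isLieAction_ad : IsLieAction (adAction E) := fun A B u ↦ by
  simp only [adAction_apply]; noncomm_ring

theorem isLieAction_id : IsLieAction (ContinuousLinearMap.id ℝ (E →L[ℝ] E)) := fun _ _ _ ↦ rfl

/-- The covariant derivative `du + ρ(γ(dh)) u` of a function `u`, for the connection form
`γ(dh)`. -/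
def locCov (I' : ModelWithCorners ℝ E' H') (ρ : (E →L[ℝ] E) →L[ℝ] F →L[ℝ] F)
    (γ : N → E →L[ℝ] E →L[ℝ] E) (h : N → E) (u : N → F) (z : N) (U : TangentSpace I' z) : F :=
  mvfderiv I' u z U + ρ (γ z (mvfderiv I' h z U)) (u z)

/-- The curvature of the connection form `γ(dh)`. -/
def locCurv (I' : ModelWithCorners ℝ E' H') (γ : N → E →L[ℝ] E →L[ℝ] E) (h : N → E) (z : N)
    (U V : TangentSpace I' z) : E →L[ℝ] E :=
  mvfderiv I' γ z U (mvfderiv I' h z V) - mvfderiv I' γ z V (mvfderiv I' h z U) +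
    (γ z (mvfderiv I' h z U) * γ z (mvfderiv I' h z V) -
      γ z (mvfderiv I' h z V) * γ z (mvfderiv I' h z U))

variable {ρ : (E →L[ℝ] E) →L[ℝ] F →L[ℝ] F} {γ : N → E →L[ℝ] E →L[ℝ] E} {h : N → E}

theorem locCov_congr {u v : N → F} {z : N} (huv : u =ᶠ[𝓝 z] v) (U : TangentSpace I' z) :
    locCov I' ρ γ h u z U = locCov I' ρ γ h v z U := by
  rw [locCov, locCov, mvfderiv_congr_of_eventuallyEq huv, huv.self_of_nhds]

theorem locCov_add {u v : N → F} {z : N} (hu : MDifferentiableAt I' 𝓘(ℝ, F) u z)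
    (hv : MDifferentiableAt I' 𝓘(ℝ, F) v z) (U : TangentSpace I' z) :
    locCov I' ρ γ h (fun w ↦ u w + v w) z U = locCov I' ρ γ h u z U + locCov I' ρ γ h v z U := by
  simp only [locCov]
  rw [mvfderiv_fun_add hu hv]
  simp only [add_apply, map_add]
  abel

theorem locCov_smul {f : N → ℝ} {u : N → F} {z : N} (hf : MDifferentiableAt I' 𝓘(ℝ, ℝ) f z)
    (hu : MDifferentiableAt I' 𝓘(ℝ, F) u z) (U : TangentSpace I' z) :
    locCov I' ρ γ h (fun w ↦ f w • u w) z U =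
      f z • locCov I' ρ γ h u z U + mvfderiv I' f z U • u z := by
  simp only [locCov]
  rw [mvfderiv_fun_smul hf hu]
  simp only [add_apply, smul_apply, map_smul, ContinuousLinearMap.smulRight_apply]
  module

theorem locCov_mul {a b : N → E →L[ℝ] E} {z : N}
    (ha : MDifferentiableAt I' 𝓘(ℝ, E →L[ℝ] E) a z)
    (hb : MDifferentiableAt I' 𝓘(ℝ, E →L[ℝ] E) b z) (U : TangentSpace I' z) :
    locCov I' (adAction E) γ h (fun w ↦ a w * b w) z U =
      locCov I' (adAction E) γ h a z U * b z + a z * locCov I' (adAction E) γ h b z U := by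
  have e : mvfderiv I' (fun w ↦ a w * b w) z U =
      mvfderiv I' a z U * b z + a z * mvfderiv I' b z U :=
    mvfderiv_bilin (ContinuousLinearMap.mul ℝ (E →L[ℝ] E)) ha hb U
  simp only [locCov, adAction_apply, e]
  noncomm_ring

theorem mdifferentiableAt_mul {a b : N → E →L[ℝ] E} {z : N}
    (ha : MDifferentiableAt I' 𝓘(ℝ, E →L[ℝ] E) a z)
    (hb : MDifferentiableAt I' 𝓘(ℝ, E →L[ℝ] E) b z) :
    MDifferentiableAt I' 𝓘(ℝ, E →L[ℝ] E) (fun w ↦ a w * b w) z :=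
  mdifferentiableAt_bilin (ContinuousLinearMap.mul ℝ (E →L[ℝ] E)) ha hb

theorem contMDiffAt_mul {a b : N → E →L[ℝ] E} {z : N}
    (ha : ContMDiffAt I' 𝓘(ℝ, E →L[ℝ] E) ∞ a z)
    (hb : ContMDiffAt I' 𝓘(ℝ, E →L[ℝ] E) ∞ b z) :
    ContMDiffAt I' 𝓘(ℝ, E →L[ℝ] E) ∞ (fun w ↦ a w * b w) z :=
  ha.clm_comp hb

theorem mdifferentiableAt_clm_apply {G : Type*} [NormedAddCommGroup G] [NormedSpace ℝ G]
    {c : N → F →L[ℝ] G} {f : N → F} {z : N} (hc : MDifferentiableAt I' 𝓘(ℝ, F →L[ℝ] G) c z)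
    (hf : MDifferentiableAt I' 𝓘(ℝ, F) f z) :
    MDifferentiableAt I' 𝓘(ℝ, G) (fun w ↦ c w (f w)) z :=
  mdifferentiableAt_bilin (ContinuousLinearMap.id ℝ (F →L[ℝ] G)) hc hf

theorem mvfderiv_clm_apply {G : Type*} [NormedAddCommGroup G] [NormedSpace ℝ G]
    {c : N → F →L[ℝ] G} {f : N → F} {z : N} (hc : MDifferentiableAt I' 𝓘(ℝ, F →L[ℝ] G) c z)
    (hf : MDifferentiableAt I' 𝓘(ℝ, F) f z) (U : TangentSpace I' z) :
    mvfderiv I' (fun w ↦ c w (f w)) z U = mvfderiv I' c z U (f z) + c z (mvfderiv I' f z U) :=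
  mvfderiv_bilin (ContinuousLinearMap.id ℝ (F →L[ℝ] G)) hc hf U

variable [IsManifold I' ∞ N]

theorem contMDiffAt_locCov {u : N → F} {X : Π z : N, TangentSpace I' z} {z : N}
    (hγ : ContMDiffAt I' 𝓘(ℝ, E →L[ℝ] E →L[ℝ] E) ∞ γ z) (hh : ContMDiffAt I' 𝓘(ℝ, E) ∞ h z)
    (hu : ContMDiffAt I' 𝓘(ℝ, F) ∞ u z)
    (hX : ContMDiffAt I' I'.tangent ∞ (fun w ↦ (⟨w, X w⟩ : TangentBundle I' N)) z) :
    ContMDiffAt I' 𝓘(ℝ, F) ∞ (fun w ↦ locCov I' ρ γ h u w (X w)) z := by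
  refine (contMDiffAt_mvfderiv_apply hu hX).add ?_
  have h1 := hγ.clm_apply (contMDiffAt_mvfderiv_apply hh hX)
  have h2 : ContMDiffAt I' 𝓘(ℝ, F →L[ℝ] F) ∞
      (fun w ↦ ρ (γ w (mvfderiv I' h w (X w)))) z :=
    (ρ.contMDiff (n := ∞)).contMDiffAt.comp z h1
  exact h2.clm_apply hu

/-- The Ricci identity for `locCov`. -/
theorem locCov_commutator [CompleteSpace E'] [Nontrivial E'] (hρ : IsLieAction ρ) {u : N → F}
    {X Y : Π z : N, TangentSpace I' z} {z : N}
    (hγ : ContMDiffAt I' 𝓘(ℝ, E →L[ℝ] E →L[ℝ] E) ∞ γ z) (hh : ContMDiffAt I' 𝓘(ℝ, E) ∞ h z)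
    (hu : ContMDiffAt I' 𝓘(ℝ, F) ∞ u z)
    (hX : ContMDiffAt I' I'.tangent ∞ (fun w ↦ (⟨w, X w⟩ : TangentBundle I' N)) z)
    (hY : ContMDiffAt I' I'.tangent ∞ (fun w ↦ (⟨w, Y w⟩ : TangentBundle I' N)) z) :
    locCov I' ρ γ h (fun w ↦ locCov I' ρ γ h u w (Y w)) z (X z) -
      locCov I' ρ γ h (fun w ↦ locCov I' ρ γ h u w (X w)) z (Y z) -
      locCov I' ρ γ h u z (VectorField.mlieBracket I' X Y z) =
      ρ (locCurv I' γ h z (X z) (Y z)) (u z) := by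
  have key : ∀ {A B : Π z : N, TangentSpace I' z},
      ContMDiffAt I' I'.tangent ∞ (fun w ↦ (⟨w, B w⟩ : TangentBundle I' N)) z →
      mvfderiv I' (fun w ↦ locCov I' ρ γ h u w (B w)) z (A z) =
        mvfderiv I' (fun w ↦ mvfderiv I' u w (B w)) z (A z) +
        (ρ (mvfderiv I' γ z (A z) (mvfderiv I' h z (B z)) +
          γ z (mvfderiv I' (fun w ↦ mvfderiv I' h w (B w)) z (A z))) (u z) +
        ρ (γ z (mvfderiv I' h z (B z))) (mvfderiv I' u z (A z))) := by
    intro A B hB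
    have d1 := (contMDiffAt_mvfderiv_apply hu hB).mdifferentiableAt (by simp)
    have d2 := (contMDiffAt_mvfderiv_apply hh hB).mdifferentiableAt (by simp)
    have dγ := hγ.mdifferentiableAt (by simp)
    have du := hu.mdifferentiableAt (by simp)
    have d3 : MDifferentiableAt I' 𝓘(ℝ, E →L[ℝ] E) (fun w ↦ γ w (mvfderiv I' h w (B w))) z :=
      mdifferentiableAt_clm_apply dγ d2
    have d4 : MDifferentiableAt I' 𝓘(ℝ, F) (fun w ↦ ρ (γ w (mvfderiv I' h w (B w))) (u w)) z :=
      mdifferentiableAt_bilin ρ d3 du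
    have e3 := mvfderiv_clm_apply dγ d2 (A z)
    have e4 := mvfderiv_bilin ρ d3 du (A z)
    change mvfderiv I' (fun w ↦ mvfderiv I' u w (B w) + ρ (γ w (mvfderiv I' h w (B w))) (u w)) z
      (A z) = _
    rw [mvfderiv_fun_add d1 d4, add_apply, e4, e3]
  have k1 := key (A := X) hY
  have k2 := key (A := Y) hX
  have l1 := mvfderiv_mlieBracket hu hX hY
  have l2 := mvfderiv_mlieBracket hh hX hY
  have hr := hρ (γ z (mvfderiv I' h z (X z))) (γ z (mvfderiv I' h z (Y z))) (u z)
  have u1 : ∀ A B : Π z : N, TangentSpace I' z,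
      locCov I' ρ γ h (fun w ↦ locCov I' ρ γ h u w (B w)) z (A z) =
      mvfderiv I' (fun w ↦ locCov I' ρ γ h u w (B w)) z (A z) +
      ρ (γ z (mvfderiv I' h z (A z))) (locCov I' ρ γ h u z (B z)) := fun _ _ ↦ rfl
  have u2 : locCov I' ρ γ h u z (VectorField.mlieBracket I' X Y z) =
      mvfderiv I' u z (VectorField.mlieBracket I' X Y z) +
      ρ (γ z (mvfderiv I' h z (VectorField.mlieBracket I' X Y z))) (u z) := rfl
  rw [u1, u1, u2, k1, k2, l1, l2, locCurv, map_add ρ (_ - _), add_apply, hr]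
  simp only [locCov, map_add, map_sub, add_apply, sub_apply]
  abel

end LocalConnection

section ProjectedConnection

variable {E' : Type*} [NormedAddCommGroup E'] [NormedSpace ℝ E'] [CompleteSpace E'] [Nontrivial E']
  {H' : Type*} [TopologicalSpace H'] {I' : ModelWithCorners ℝ E' H'}
  {N : Type*} [TopologicalSpace N] [ChartedSpace H' N] [IsManifold I' ∞ N]
  {E : Type*} [NormedAddCommGroup E] [NormedSpace ℝ E]
  {γ : N → E →L[ℝ] E →L[ℝ] E} {h : N → E} {j a : N → E →L[ℝ] E} {z : N}

/-- The covariant derivative projected onto the endomorphisms anticommuting with `j`. -/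
def projCov (I' : ModelWithCorners ℝ E' H') (γ : N → E →L[ℝ] E →L[ℝ] E) (h : N → E)
    (j a : N → E →L[ℝ] E) (z : N) (U : TangentSpace I' z) : E →L[ℝ] E :=
  antiProj (j z) (locCov I' (adAction E) γ h a z U)

theorem locCov_anticomm (hj : ∀ᶠ w in 𝓝 z, j w * j w = -1)
    (hjd : MDifferentiableAt I' 𝓘(ℝ, E →L[ℝ] E) j z) (U : TangentSpace I' z) :
    locCov I' (adAction E) γ h j z U * j z = -(j z * locCov I' (adAction E) γ h j z U) := by
  have e := locCov_mul (γ := γ) (h := h) hjd hjd U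
  have e' : locCov I' (adAction E) γ h (fun w ↦ j w * j w) z U = 0 := by
    rw [locCov_congr (v := fun _ ↦ -1) hj, locCov, mvfderiv_const]
    simp
  rw [e'] at e
  exact eq_neg_of_add_eq_zero_left e.symm

theorem locCov_anticomm' (ha : ∀ᶠ w in 𝓝 z, a w * j w = -(j w * a w))
    (hjd : MDifferentiableAt I' 𝓘(ℝ, E →L[ℝ] E) j z)
    (had : MDifferentiableAt I' 𝓘(ℝ, E →L[ℝ] E) a z) (U : TangentSpace I' z) :
    locCov I' (adAction E) γ h a z U * j z + a z * locCov I' (adAction E) γ h j z U =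
      -(locCov I' (adAction E) γ h j z U * a z + j z * locCov I' (adAction E) γ h a z U) := by
  rw [← locCov_mul had hjd, ← locCov_mul hjd had, eq_neg_iff_add_eq_zero,
    ← locCov_add (mdifferentiableAt_mul had hjd) (mdifferentiableAt_mul hjd had)]
  rw [locCov_congr (v := fun _ ↦ 0), locCov, mvfderiv_const]
  · simp
  · filter_upwards [ha] with w hw
    rw [hw, neg_add_cancel]

/-- The projected connection is complex linear. -/
theorem projCov_mul (hj : ∀ᶠ w in 𝓝 z, j w * j w = -1)
    (ha : a z * j z = -(j z * a z))
    (hjd : MDifferentiableAt I' 𝓘(ℝ, E →L[ℝ] E) j z)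
    (had : MDifferentiableAt I' 𝓘(ℝ, E →L[ℝ] E) a z) (U : TangentSpace I' z) :
    projCov I' γ h j (fun w ↦ j w * a w) z U = j z * projCov I' γ h j a z U := by
  have hv := locCov_anticomm (γ := γ) (h := h) hj hjd U
  have hj0 := hj.self_of_nhds
  rw [projCov, projCov, locCov_mul hjd had]
  set v := locCov I' (adAction E) γ h j z U
  set b := locCov I' (adAction E) γ h a z U
  have e : j z * (v * a z) * j z = -(v * a z) := by
    calc j z * (v * a z) * j z = -(-(j z * v)) * (a z * j z) := by noncomm_ring
      _ = v * (j z * j z) * a z := by rw [← hv, ha]; noncomm_ring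
      _ = _ := by rw [hj0]; noncomm_ring
  simp only [antiProj, mul_add, add_mul, e, mul_smul_comm]
  noncomm_ring

/-- The curvature of the projected connection. -/
theorem projCov_commutator {X Y : Π z : N, TangentSpace I' z}
    (hγ : ContMDiffAt I' 𝓘(ℝ, E →L[ℝ] E →L[ℝ] E) ∞ γ z) (hh : ContMDiffAt I' 𝓘(ℝ, E) ∞ h z)
    (hjs : ContMDiffAt I' 𝓘(ℝ, E →L[ℝ] E) ∞ j z) (has : ContMDiffAt I' 𝓘(ℝ, E →L[ℝ] E) ∞ a z)
    (hj : ∀ᶠ w in 𝓝 z, j w * j w = -1) (ha : ∀ᶠ w in 𝓝 z, a w * j w = -(j w * a w))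
    (hX : ContMDiffAt I' I'.tangent ∞ (fun w ↦ (⟨w, X w⟩ : TangentBundle I' N)) z)
    (hY : ContMDiffAt I' I'.tangent ∞ (fun w ↦ (⟨w, Y w⟩ : TangentBundle I' N)) z) :
    projCov I' γ h j (fun w ↦ projCov I' γ h j a w (Y w)) z (X z) -
      projCov I' γ h j (fun w ↦ projCov I' γ h j a w (X w)) z (Y z) -
      projCov I' γ h j a z (VectorField.mlieBracket I' X Y z) =
      antiProj (j z) (locCurv I' γ h z (X z) (Y z) * a z - a z * locCurv I' γ h z (X z) (Y z)) -
        (1 / 4 : ℝ) • vertTerm (a z) (locCov I' (adAction E) γ h j z (X z))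
          (locCov I' (adAction E) γ h j z (Y z)) := by
  have hjd := hjs.mdifferentiableAt (by simp : (∞ : WithTop ℕ∞) ≠ 0)
  have had := has.mdifferentiableAt (by simp : (∞ : WithTop ℕ∞) ≠ 0)
  have hj0 := hj.self_of_nhds
  have key : ∀ {A B : Π z : N, TangentSpace I' z},
      ContMDiffAt I' I'.tangent ∞ (fun w ↦ (⟨w, B w⟩ : TangentBundle I' N)) z →
      projCov I' γ h j (fun w ↦ projCov I' γ h j a w (B w)) z (A z) =
        antiProj (j z) (locCov I' (adAction E) γ h
          (fun w ↦ locCov I' (adAction E) γ h a w (B w)) z (A z)) -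
        (1 / 4 : ℝ) • (locCov I' (adAction E) γ h j z (A z) *
          (a z * locCov I' (adAction E) γ h j z (B z) + locCov I' (adAction E) γ h j z (B z) * a z)
          + (a z * locCov I' (adAction E) γ h j z (B z) + locCov I' (adAction E) γ h j z (B z) * a z)
          * locCov I' (adAction E) γ h j z (A z)) := by
    intro A B hB
    have hbd : MDifferentiableAt I' 𝓘(ℝ, E →L[ℝ] E)
        (fun w ↦ locCov I' (adAction E) γ h a w (B w)) z :=
      (contMDiffAt_locCov hγ hh has hB).mdifferentiableAt (by simp)
    have hv := locCov_anticomm (γ := γ) (h := h) hj hjd (A z)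
    have hb := locCov_anticomm' (γ := γ) (h := h) ha hjd had (B z)
    have hp := antiProj_deriv_proj hj0 hv hb
    have e : locCov I' (adAction E) γ h (fun w ↦ projCov I' γ h j a w (B w)) z (A z) =
        antiProj (j z) (locCov I' (adAction E) γ h
          (fun w ↦ locCov I' (adAction E) γ h a w (B w)) z (A z)) +
        (1 / 2 : ℝ) • (locCov I' (adAction E) γ h j z (A z) *
          locCov I' (adAction E) γ h a z (B z) * j z + j z * locCov I' (adAction E) γ h a z (B z) *
          locCov I' (adAction E) γ h j z (A z)) := by
      have hjb := mdifferentiableAt_mul hjd hbd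
      have hjbj := mdifferentiableAt_mul hjb hjd
      have hsum : MDifferentiableAt I' 𝓘(ℝ, E →L[ℝ] E)
          (fun w ↦ locCov I' (adAction E) γ h a w (B w) +
          j w * locCov I' (adAction E) γ h a w (B w) * j w) z := hbd.add hjbj
      change locCov I' (adAction E) γ h (fun w ↦ (1 / 2 : ℝ) •
        (locCov I' (adAction E) γ h a w (B w) +
          j w * locCov I' (adAction E) γ h a w (B w) * j w)) z (A z) = _
      rw [locCov_smul mdifferentiableAt_const hsum, locCov_add hbd hjbj,
        locCov_mul hjb hjd, locCov_mul hjd hbd, mvfderiv_const]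
      simp only [antiProj, zero_apply, zero_smul, add_zero, ← smul_add]
      congr 1
      noncomm_ring
    rw [projCov, e, antiProj_add, antiProj_idem hj0, hp]
    module
  have hc := locCov_commutator isLieAction_ad hγ hh has hX hY
  rw [key hY, key hX, projCov, ← adAction_apply, ← hc, antiProj_sub, antiProj_sub, vertTerm]
  module

end ProjectedConnection

end Quaternionic

namespace Quaternionic

section LocalCoordinates

variable {E : Type*} [NormedAddCommGroup E] [NormedSpace ℝ E]
  {H : Type*} [TopologicalSpace H] {I : ModelWithCorners ℝ E H}
  {M : Type*} [TopologicalSpace M] [ChartedSpace H M] [IsManifold I ∞ M]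

variable (I) in
/-- The domain of the trivialization of `TM` at `p`. -/
def trivDom (p : M) : Set M := (trivializationAt E (TangentSpace I : M → Type _) p).baseSet

theorem isOpen_trivDom (p : M) : IsOpen (trivDom I p) := Trivialization.open_baseSet _

theorem mem_trivDom (p : M) : p ∈ trivDom I p := FiberBundle.mem_baseSet_trivializationAt' p

variable (I) in
/-- The components of a tangent vector in the trivialization of `TM` at `p`. -/
def locVec (p q : M) : TangentSpace I q →L[ℝ] E :=
  (trivializationAt E (TangentSpace I : M → Type _) p).continuousLinearMapAt ℝ q

variable (I) in
/-- The tangent vector with given components in the trivialization of `TM` at `p`. -/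
def ofLocVec (p q : M) : E →L[ℝ] TangentSpace I q :=
  (trivializationAt E (TangentSpace I : M → Type _) p).symmL ℝ q

variable {p q : M}

@[simp]
theorem locVec_ofLocVec (hq : q ∈ trivDom I p) (v : E) : locVec I p q (ofLocVec I p q v) = v :=
  Trivialization.continuousLinearMapAt_symmL _ hq v

@[simp]
theorem ofLocVec_locVec (hq : q ∈ trivDom I p) (v : TangentSpace I q) :
    ofLocVec I p q (locVec I p q v) = v :=
  Trivialization.symmL_continuousLinearMapAt _ hq v

theorem locVec_eq_snd (hq : q ∈ trivDom I p) (v : TangentSpace I q) :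
    locVec I p q v = (trivializationAt E (TangentSpace I : M → Type _) p ⟨q, v⟩).2 := by
  rw [locVec, Trivialization.continuousLinearMapAt_apply, Trivialization.coe_linearMapAt_of_mem _ hq]

variable (I) in
/-- The matrix of an endomorphism in the trivialization of `TM` at `p`. -/
def locEnd (p q : M) : EndT I q →ₗ[ℝ] E →L[ℝ] E where
  toFun A := (locVec I p q).comp (A.comp (ofLocVec I p q))
  map_add' _ _ := by simp
  map_smul' _ _ := by simp

theorem locEnd_locVec (hq : q ∈ trivDom I p) (A : EndT I q) (v : TangentSpace I q) :
    locEnd I p q A (locVec I p q v) = locVec I p q (A v) := by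
  simp [locEnd, hq]

theorem locEnd_mul (hq : q ∈ trivDom I p) (A B : EndT I q) :
    locEnd I p q (A * B) = locEnd I p q A * locEnd I p q B := by
  ext v; simp [locEnd, hq]

theorem locEnd_one (hq : q ∈ trivDom I p) : locEnd I p q 1 = 1 := by
  ext v; simp [locEnd, hq]

theorem locEnd_injective (hq : q ∈ trivDom I p) : Function.Injective (locEnd I p q) := by
  intro A B h
  ext v
  have := congrArg (fun L : E →L[ℝ] E ↦ ofLocVec I p q (L (locVec I p q v))) h
  simpa [locEnd_locVec, hq] using this

theorem locEnd_surjective (hq : q ∈ trivDom I p) : Function.Surjective (locEnd I p q) := fun L ↦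
  ⟨(ofLocVec I p q).comp (L.comp (locVec I p q)), by ext v; simp [locEnd, hq]⟩

theorem trace_locEnd (hq : q ∈ trivDom I p) (A : EndT I q) :
    LinearMap.trace ℝ E (locEnd I p q A).toLinearMap =
      LinearMap.trace ℝ (TangentSpace I q) A.toLinearMap := by
  let φ : TangentSpace I q ≃ₗ[ℝ] E :=
    { (locVec I p q).toLinearMap with
      invFun := ofLocVec I p q
      left_inv := ofLocVec_locVec hq
      right_inv := locVec_ofLocVec hq }
  exact LinearMap.trace_conj' A.toLinearMap φ

theorem traceForm_locEnd (hq : q ∈ trivDom I p) (A B : EndT I q) :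
    traceForm (locEnd I p q A) (locEnd I p q B) = traceForm A B := by
  rw [traceForm, ← locEnd_mul hq, trace_locEnd hq, traceForm]

section Smoothness

variable {E' : Type*} [NormedAddCommGroup E'] [NormedSpace ℝ E']
  {H' : Type*} [TopologicalSpace H'] {I' : ModelWithCorners ℝ E' H'}
  {N : Type*} [TopologicalSpace N] [ChartedSpace H' N]

theorem contMDiffAt_end_iff {f : N → M} {s : Π z : N, EndT I (f z)} {z : N}
    (hz : f z ∈ trivDom I p) :
    ContMDiffAt I' (I.prod 𝓘(ℝ, E →L[ℝ] E)) ∞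
      (fun z ↦ TotalSpace.mk' (E →L[ℝ] E) (E := EndT I) (f z) (s z)) z ↔
    ContMDiffAt I' I ∞ f z ∧
      ContMDiffAt I' 𝓘(ℝ, E →L[ℝ] E) ∞ (fun w ↦ locEnd I p (f w) (s w)) z :=
  Trivialization.contMDiffAt_iff (e := trivializationAt (E →L[ℝ] E) (EndT I : M → Type _) p)
    (f := fun z ↦ TotalSpace.mk' (E →L[ℝ] E) (E := EndT I) (f z) (s z)) ⟨hz, hz⟩

theorem mdifferentiableAt_end_iff {s : Π q : M, EndT I q} (hq : q ∈ trivDom I p) :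
    MDifferentiableAt I (I.prod 𝓘(ℝ, E →L[ℝ] E))
      (fun q ↦ TotalSpace.mk' (E →L[ℝ] E) (E := EndT I) q (s q)) q ↔
    MDifferentiableAt I 𝓘(ℝ, E →L[ℝ] E) (fun w ↦ locEnd I p w (s w)) q :=
  Trivialization.mdifferentiableAt_section_iff I
    (trivializationAt (E →L[ℝ] E) (EndT I : M → Type _) p) s ⟨hq, hq⟩

theorem eventually_trivDom (hq : q ∈ trivDom I p) : ∀ᶠ w in 𝓝 q, w ∈ trivDom I p :=
  (isOpen_trivDom p).mem_nhds hq

theorem mdifferentiableAt_vec_iff {Y : Π q : M, TangentSpace I q} (hq : q ∈ trivDom I p) :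
    MDifferentiableAt I (I.prod 𝓘(ℝ, E)) (fun q ↦ TotalSpace.mk' E q (Y q)) q ↔
    MDifferentiableAt I 𝓘(ℝ, E) (fun w ↦ locVec I p w (Y w)) q := by
  rw [Trivialization.mdifferentiableAt_section_iff I
    (trivializationAt E (TangentSpace I : M → Type _) p) Y hq]
  refine Filter.EventuallyEq.mdifferentiableAt_iff ?_
  filter_upwards [eventually_trivDom hq] with w hw using (locVec_eq_snd hw _).symm

theorem contMDiffAt_vec_iff {Y : Π q : M, TangentSpace I q} (hq : q ∈ trivDom I p) :
    ContMDiffAt I (I.prod 𝓘(ℝ, E)) ∞ (fun q ↦ TotalSpace.mk' E q (Y q)) q ↔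
    ContMDiffAt I 𝓘(ℝ, E) ∞ (fun w ↦ locVec I p w (Y w)) q := by
  rw [Trivialization.contMDiffAt_section_iff
    (trivializationAt E (TangentSpace I : M → Type _) p) hq]
  refine Filter.EventuallyEq.contMDiffAt_iff ?_
  filter_upwards [eventually_trivDom hq] with w hw using (locVec_eq_snd hw _).symm

theorem contMDiffAt_ofLocVec (hq : q ∈ trivDom I p) (v : E) :
    ContMDiffAt I (I.prod 𝓘(ℝ, E)) ∞
      (fun q ↦ TotalSpace.mk' E (E := (TangentSpace I : M → Type _)) q (ofLocVec I p q v)) q := by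
  rw [contMDiffAt_vec_iff hq]
  refine (contMDiffAt_const (c := v)).congr_of_eventuallyEq ?_
  filter_upwards [eventually_trivDom hq] with w hw using locVec_ofLocVec hw v

theorem mdifferentiableAt_ofLocVec (hq : q ∈ trivDom I p) (v : E) :
    MDifferentiableAt I (I.prod 𝓘(ℝ, E))
      (fun q ↦ TotalSpace.mk' E (E := (TangentSpace I : M → Type _)) q (ofLocVec I p q v)) q :=
  (contMDiffAt_ofLocVec hq v).mdifferentiableAt (by simp)

end Smoothness

theorem trivDom_eq (p : M) : trivDom I p = (chartAt H p).source := by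
  simp [trivDom]

theorem contMDiffAt_chart (hq : q ∈ trivDom I p) :
    ContMDiffAt I 𝓘(ℝ, E) ∞ (extChartAt I p) q :=
  contMDiffAt_extChartAt' (by rwa [trivDom_eq] at hq)

theorem mvfderiv_chart (hq : q ∈ trivDom I p) (v : TangentSpace I q) :
    mvfderiv I (extChartAt I p) q v = locVec I p q v := by
  rw [trivDom_eq] at hq
  have := IsManifold.of_le (I := I) (M := M) (n := ∞) (m := 1) (by simp)
  rw [locVec, TangentBundle.continuousLinearMapAt_trivializationAt hq]
  rfl

end LocalCoordinates

end Quaternionic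

namespace Quaternionic

section CutOff

variable {E : Type*} [NormedAddCommGroup E] [NormedSpace ℝ E] [FiniteDimensional ℝ E]
  {H : Type*} [TopologicalSpace H] {I : ModelWithCorners ℝ E H}
  {M : Type*} [TopologicalSpace M] [T2Space M] [ChartedSpace H M] [IsManifold I ∞ M]

variable (I) in
theorem exists_cutOff {U : Set M} {p : M} (hU : U ∈ 𝓝 p) :
    ∃ f : M → ℝ, ContMDiff I 𝓘(ℝ, ℝ) ∞ f ∧ tsupport f ⊆ U ∧ f =ᶠ[𝓝 p] 1 := by
  obtain ⟨f, -, hf⟩ := (SmoothBumpFunction.nhds_basis_tsupport (I := I) p).mem_iff.1 hU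
  exact ⟨f, f.contMDiff, hf, f.eventuallyEq_one⟩

variable (I) in
/-- A smooth local section of a vector bundle agrees near a given point with a global one, which is
pointwise a multiple of it. -/
theorem exists_global_section (F : Type*) [NormedAddCommGroup F] [NormedSpace ℝ F]
    {V : M → Type*} [TopologicalSpace (TotalSpace F V)]
    [∀ x, AddCommGroup (V x)] [∀ x, Module ℝ (V x)] [∀ x : M, TopologicalSpace (V x)]
    [FiberBundle F V] [VectorBundle ℝ F V] {U : Set M} (hU : IsOpen U) {p : M} (hp : p ∈ U)
    {s : Π q : M, V q}
    (hs : ContMDiffOn I (I.prod 𝓘(ℝ, F)) ∞ (fun q ↦ TotalSpace.mk' F q (s q)) U) :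
    ∃ f : M → ℝ, f =ᶠ[𝓝 p] 1 ∧ (∀ q ∉ U, f q = 0) ∧
      ContMDiff I (I.prod 𝓘(ℝ, F)) ∞ (fun q ↦ TotalSpace.mk' F q ((f • s) q)) := by
  obtain ⟨f, hf, hsupp, h1⟩ := exists_cutOff I (hU.mem_nhds hp)
  exact ⟨f, h1, fun q hq ↦ image_eq_zero_of_notMem_tsupport fun h ↦ hq (hsupp h),
    ContMDiffOn.smul_section_of_tsupport hf.contMDiffOn hU hsupp hs⟩

end CutOff

section Christoffel

variable {E : Type*} [NormedAddCommGroup E] [NormedSpace ℝ E] [FiniteDimensional ℝ E]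
  {H : Type*} [TopologicalSpace H] {I : ModelWithCorners ℝ E H}
  {M : Type*} [TopologicalSpace M] [ChartedSpace H M] [IsManifold I ∞ M]
  (D : CovariantDerivative I E (TangentSpace I : M → Type _))

/-- The Christoffel symbols of `D` in the trivialization of `TM` at `p`. -/
def christoffel (p q : M) : E →L[ℝ] E →L[ℝ] E :=
  ∑ i, (ContinuousLinearMap.smulRightL ℝ E E
    (LinearMap.toContinuousLinearMap ((Module.finBasis ℝ E).coord i))).comp
    (locEnd I p q (D (fun w ↦ ofLocVec I p w (Module.finBasis ℝ E i)) q))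

variable {p q : M}

theorem christoffel_apply (x v : E) : christoffel D p q x v =
    ∑ i, (Module.finBasis ℝ E).coord i v •
      locEnd I p q (D (fun w ↦ ofLocVec I p w (Module.finBasis ℝ E i)) q) x := by
  simp [christoffel]

theorem covariantDerivative_sum {ι : Type*} (s : Finset ι) (f : ι → M → ℝ)
    (σ : ι → Π q : M, TangentSpace I q) (hf : ∀ i, MDifferentiableAt I 𝓘(ℝ, ℝ) (f i) q)
    (hσ : ∀ i, MDifferentiableAt I (I.prod 𝓘(ℝ, E)) (fun q ↦ TotalSpace.mk' E q (σ i q)) q) :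
    D (∑ i ∈ s, f i • σ i) q =
      ∑ i ∈ s, (f i q • D (σ i) q + (mvfderiv I (f i) q).smulRight (σ i q)) ∧
    MDifferentiableAt I (I.prod 𝓘(ℝ, E))
      (fun q ↦ TotalSpace.mk' E q ((∑ i ∈ s, f i • σ i) q)) q := by
  classical
  induction s using Finset.induction_on with
  | empty =>
    simp only [Finset.sum_empty]
    refine ⟨D.isCovariantDerivativeOnUniv.zero, mdifferentiableAt_zeroSection ..⟩
  | insert i s hi ih =>
    simp only [Finset.sum_insert hi]
    have h1 := (hf i).smul_section (hσ i)
    refine ⟨?_, mdifferentiableAt_add_section h1 ih.2⟩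
    rw [D.isCovariantDerivativeOnUniv.add h1 ih.2, ih.1,
      D.isCovariantDerivativeOnUniv.leibniz (hσ i) (hf i)]

/-- The covariant derivative of a vector field in local coordinates. -/
theorem locVec_covariantDerivative (hq : q ∈ trivDom I p) {Y : Π q : M, TangentSpace I q}
    (hY : MDifferentiableAt I (I.prod 𝓘(ℝ, E)) (fun q ↦ TotalSpace.mk' E q (Y q)) q)
    (x : TangentSpace I q) :
    locVec I p q (D Y q x) = mvfderiv I (fun w ↦ locVec I p w (Y w)) q x +
      christoffel D p q (locVec I p q x) (locVec I p q (Y q)) := by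
  set b := Module.finBasis ℝ E
  set f : Fin _ → M → ℝ := fun i w ↦ LinearMap.toContinuousLinearMap (b.coord i) (locVec I p w (Y w))
  set σ : Fin _ → Π q : M, TangentSpace I q := fun i w ↦ ofLocVec I p w (b i)
  have hYl := (mdifferentiableAt_vec_iff hq).1 hY
  have hf : ∀ i, MDifferentiableAt I 𝓘(ℝ, ℝ) (f i) q := fun i ↦ mdifferentiableAt_clm_comp _ hYl
  have hσ : ∀ i, MDifferentiableAt I (I.prod 𝓘(ℝ, E)) (fun q ↦ TotalSpace.mk' E q (σ i q)) q :=
    fun i ↦ mdifferentiableAt_ofLocVec hq (b i)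
  obtain ⟨h1, h2⟩ := covariantDerivative_sum D Finset.univ f σ hf hσ
  have hev : ∀ᶠ w in 𝓝 q, Y w = (∑ i, f i • σ i) w := by
    filter_upwards [eventually_trivDom hq] with w hw
    have := congrArg (ofLocVec I p w) (b.sum_repr (locVec I p w (Y w)))
    rw [ofLocVec_locVec hw, map_sum] at this
    rw [← this, Finset.sum_apply]
    exact Finset.sum_congr rfl fun i _ ↦ map_smul _ _ _
  have h3 : D Y q = D (∑ i, f i • σ i) q :=
    D.isCovariantDerivativeOnUniv.congr_of_eventuallyEq hY h2 Filter.univ_mem hev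
  rw [h3, h1, christoffel_apply]
  simp only [sum_apply, map_sum, add_apply, smul_apply,
    ContinuousLinearMap.smulRight_apply, map_add, map_smul, Finset.sum_add_distrib]
  rw [add_comm]
  congr 1
  · have : ∀ i, mvfderiv I (f i) q x = b.coord i (mvfderiv I (fun w ↦ locVec I p w (Y w)) q x) :=
      fun i ↦ mvfderiv_clm_comp _ hYl x
    simp only [this, σ, locVec_ofLocVec hq]
    exact b.sum_repr _
  · refine Finset.sum_congr rfl fun i _ ↦ ?_
    rw [locEnd_locVec hq]
    rfl

/-- The covariant derivative of a vector field in local coordinates. -/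
theorem locVec_covariantDerivative_eq_locCov (hq : q ∈ trivDom I p) {Y : Π q : M, TangentSpace I q}
    (hY : MDifferentiableAt I (I.prod 𝓘(ℝ, E)) (fun q ↦ TotalSpace.mk' E q (Y q)) q)
    (x : TangentSpace I q) :
    locVec I p q (D Y q x) = locCov I (ContinuousLinearMap.id ℝ (E →L[ℝ] E)) (christoffel D p)
      (extChartAt I p) (fun w ↦ locVec I p w (Y w)) q x := by
  rw [locVec_covariantDerivative D hq hY, locCov, mvfderiv_chart hq]
  rfl

theorem endCov_apply {A : Π q : M, EndT I q}
    (hA : MDifferentiableAt I (I.prod 𝓘(ℝ, E →L[ℝ] E))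
      (fun q ↦ TotalSpace.mk' (E →L[ℝ] E) (E := EndT I) q (A q)) q)
    {Y : Π q : M, TangentSpace I q}
    (hY : MDifferentiableAt I (I.prod 𝓘(ℝ, E)) (fun q ↦ TotalSpace.mk' E q (Y q)) q)
    (x : TangentSpace I q) :
    endCov D A q x (Y q) = D (fun w ↦ A w (Y w)) q x - A q (D Y q x) := by
  have h : endCov D A q = _ := dif_pos hA
  have hx := mdifferentiableAt_extend I E x
  have e : extend E x q = x := by simp
  rw [h]
  conv_lhs => rw [← e]
  rw [TensorialAt.mkHom₂_apply _ _ hx hY, e]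

/-- The induced covariant derivative of an endomorphism field in local coordinates. -/
theorem locEnd_endCov (hq : q ∈ trivDom I p) {A : Π q : M, EndT I q}
    (hA : MDifferentiableAt I (I.prod 𝓘(ℝ, E →L[ℝ] E))
      (fun q ↦ TotalSpace.mk' (E →L[ℝ] E) (E := EndT I) q (A q)) q) (x : TangentSpace I q) :
    locEnd I p q (endCov D A q x) = locCov I (adAction E) (christoffel D p) (extChartAt I p)
      (fun w ↦ locEnd I p w (A w)) q x := by
  ext v
  set Y : Π q : M, TangentSpace I q := fun w ↦ ofLocVec I p w v
  have hY : MDifferentiableAt I (I.prod 𝓘(ℝ, E)) (fun q ↦ TotalSpace.mk' E q (Y q)) q :=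
    mdifferentiableAt_ofLocVec hq v
  have hv : locVec I p q (Y q) = v := locVec_ofLocVec hq v
  have hAY : MDifferentiableAt I (I.prod 𝓘(ℝ, E)) (fun q ↦ TotalSpace.mk' E q (A q (Y q))) q :=
    hA.clm_bundle_apply hY
  have hAl := (mdifferentiableAt_end_iff hq).1 hA
  have hev : (fun w ↦ locVec I p w (A w (Y w))) =ᶠ[𝓝 q] fun w ↦ locEnd I p w (A w) v := by
    filter_upwards [eventually_trivDom hq] with w hw
    rw [← locEnd_locVec hw, locVec_ofLocVec hw]
  have hev' : (fun w ↦ locVec I p w (Y w)) =ᶠ[𝓝 q] fun w ↦ v := by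
    filter_upwards [eventually_trivDom hq] with w hw using locVec_ofLocVec hw v
  conv_lhs => rw [← hv]
  rw [locEnd_locVec hq, endCov_apply D hA hY, map_sub, locVec_covariantDerivative D hq hAY,
    ← locEnd_locVec hq, ← locEnd_locVec hq, locVec_covariantDerivative D hq hY,
    mvfderiv_congr_of_eventuallyEq hev, mvfderiv_congr_of_eventuallyEq hev', mvfderiv_const,
    mvfderiv_clm_apply hAl mdifferentiableAt_const, mvfderiv_const, hv, locCov, mvfderiv_chart hq]
  simp
  abel

theorem contMDiffAt_christoffel [T2Space M] (hD : D.ContMDiffCovariantDerivative ∞)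
    (hq : q ∈ trivDom I p) :
    ContMDiffAt I 𝓘(ℝ, E →L[ℝ] E →L[ℝ] E) ∞ (christoffel D p) q := by
  set b := Module.finBasis ℝ E
  have key : ∀ i, ContMDiffAt I 𝓘(ℝ, E →L[ℝ] E) ∞
      (fun w ↦ locEnd I p w (D (fun w ↦ ofLocVec I p w (b i)) w)) q := by
    intro i
    obtain ⟨f, hf, -, hs⟩ := exists_global_section I E (isOpen_trivDom p) hq
      (s := fun w ↦ ofLocVec I p w (b i))
      (fun w hw ↦ (contMDiffAt_ofLocVec hw (b i)).contMDiffWithinAt)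
    have h1 := hD.contMDiff.contMDiff (hs.contMDiffOn (s := Set.univ))
    have h2 := ((contMDiffAt_end_iff (f := id) hq).1 (h1.contMDiffAt Filter.univ_mem)).2
    refine h2.congr_of_eventuallyEq ?_
    filter_upwards [eventually_trivDom hq, hf.eventuallyEq_nhds] with w hw hfw
    congr 1
    refine D.isCovariantDerivativeOnUniv.congr_of_eventuallyEq (mdifferentiableAt_ofLocVec hw (b i))
      (hs.mdifferentiable (by simp) w) Filter.univ_mem ?_
    filter_upwards [hfw] with y hy
    simp [hy]
  refine ContMDiffAt.sum fun i _ ↦ ?_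
  exact contMDiffAt_const.clm_comp (key i)

theorem christoffel_symm [Nontrivial E] (hD : D.torsion = 0) (hq : q ∈ trivDom I p) (x v : E) :
    christoffel D p q x v = christoffel D p q v x := by
  have ev : ∀ v : E, (fun w ↦ locVec I p w (ofLocVec I p w v)) =ᶠ[𝓝 q] fun w ↦ v := fun v ↦ by
    filter_upwards [eventually_trivDom hq] with w hw using locVec_ofLocVec hw v
  have key : ∀ x v : E, locVec I p q (D (fun w ↦ ofLocVec I p w v) q (ofLocVec I p q x)) =
      christoffel D p q x v := by
    intro x v
    rw [locVec_covariantDerivative D hq (mdifferentiableAt_ofLocVec hq v),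
      mvfderiv_congr_of_eventuallyEq (ev v), mvfderiv_const, locVec_ofLocVec hq, locVec_ofLocVec hq]
    simp
  have h1 := (CovariantDerivative.torsion_eq_zero_iff D).1 hD (mdifferentiableAt_ofLocVec hq x)
    (mdifferentiableAt_ofLocVec hq v)
  have h2 := mvfderiv_mlieBracket (contMDiffAt_chart hq) (contMDiffAt_ofLocVec hq x)
    (contMDiffAt_ofLocVec hq v)
  have ev' : ∀ v : E, (fun w ↦ mvfderiv I (extChartAt I p) w (ofLocVec I p w v)) =ᶠ[𝓝 q]
      fun w ↦ v := fun v ↦ by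
    filter_upwards [eventually_trivDom hq] with w hw
    rw [mvfderiv_chart hw, locVec_ofLocVec hw]
  rw [mvfderiv_congr_of_eventuallyEq (ev' x), mvfderiv_congr_of_eventuallyEq (ev' v),
    mvfderiv_const, mvfderiv_const, mvfderiv_chart hq, ← h1, map_sub, key, key] at h2
  simpa [sub_eq_zero] using h2

end Christoffel

end Quaternionic

namespace Quaternionic

section Curvature

/-- The bilinear map `P(x)y - P(y)x + [G(x), G(y)]`. -/
def curvatureOf {W A : Type*} [NormedAddCommGroup W] [NormedSpace ℝ W] [NormedRing A]
    [NormedAlgebra ℝ A] (P : W → W →L[ℝ] A) (G : W →L[ℝ] A)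
    (hadd : ∀ x y, P (x + y) = P x + P y) (hsmul : ∀ (c : ℝ) x, P (c • x) = c • P x) :
    W →ₗ[ℝ] W →ₗ[ℝ] A :=
  LinearMap.mk₂ ℝ (fun x y ↦ P x y - P y x + (G x * G y - G y * G x))
    (fun x y z ↦ by simp only [hadd, map_add, add_apply, add_mul, mul_add]; abel)
    (fun c x y ↦ by
      simp only [hsmul, map_smul, smul_apply, smul_mul_assoc, mul_smul_comm]; module)
    (fun x y z ↦ by simp only [hadd, map_add, add_apply, add_mul, mul_add]; abel)
    (fun c x y ↦ by
      simp only [hsmul, map_smul, smul_apply, smul_mul_assoc, mul_smul_comm]; module)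

variable {E : Type*} [NormedAddCommGroup E] [NormedSpace ℝ E] [FiniteDimensional ℝ E]
  {H : Type*} [TopologicalSpace H] {I : ModelWithCorners ℝ E H}
  {M : Type*} [TopologicalSpace M] [T2Space M] [ChartedSpace H M] [IsManifold I ∞ M]
  (D : CovariantDerivative I E (TangentSpace I : M → Type _))

theorem mvfderiv_map_add {F : Type*} [NormedAddCommGroup F] [NormedSpace ℝ F] (f : M → F) (p : M)
    (x y : TangentSpace I p) : mvfderiv I f p (x + y) = mvfderiv I f p x + mvfderiv I f p y :=
  map_add _ _ _

theorem mvfderiv_map_smul {F : Type*} [NormedAddCommGroup F] [NormedSpace ℝ F] (f : M → F) (p : M)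
    (c : ℝ) (x : TangentSpace I p) : mvfderiv I f p (c • x) = c • mvfderiv I f p x :=
  map_smul _ _ _

/-- The curvature tensor of `D` at `p`, in the trivialization of `TM` at `p`. -/
def curvForm (p : M) : E →ₗ[ℝ] E →ₗ[ℝ] E →L[ℝ] E :=
  curvatureOf (fun x ↦ mvfderiv I (christoffel D p) p (ofLocVec I p p x)) (christoffel D p p)
    (fun x y ↦ by rw [map_add, mvfderiv_map_add]) (fun c x ↦ by rw [map_smul, mvfderiv_map_smul])

variable {p : M}

theorem curvForm_locVec (x y : TangentSpace I p) :
    curvForm D p (locVec I p p x) (locVec I p p y) =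
      locCurv I (christoffel D p) (extChartAt I p) p x y := by
  rw [curvForm, curvatureOf, LinearMap.mk₂_apply, ofLocVec_locVec (mem_trivDom p),
    ofLocVec_locVec (mem_trivDom p), locCurv, mvfderiv_chart (mem_trivDom p),
    mvfderiv_chart (mem_trivDom p)]

theorem curvForm_alt (x y : E) : curvForm D p y x = -curvForm D p x y := by
  simp only [curvForm, curvatureOf, LinearMap.mk₂_apply]
  abel

theorem curvForm_bianchi [Nontrivial E] (hD : D.ContMDiffCovariantDerivative ∞)
    (hD' : D.torsion = 0) (x y z : E) :
    curvForm D p x y z + curvForm D p y z x + curvForm D p z x y = 0 := by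
  have hΓ := (contMDiffAt_christoffel D hD (mem_trivDom p)).mdifferentiableAt (by simp)
  have hsymm : ∀ x y z : E, mvfderiv I (christoffel D p) p (ofLocVec I p p x) y z =
      mvfderiv I (christoffel D p) p (ofLocVec I p p x) z y := by
    intro x y z
    have h : ∀ y z : E, mvfderiv I (fun w ↦ christoffel D p w y z) p (ofLocVec I p p x) =
        mvfderiv I (christoffel D p) p (ofLocVec I p p x) y z := by
      intro y z
      have h1 : MDifferentiableAt I 𝓘(ℝ, E →L[ℝ] E) (fun w ↦ christoffel D p w y) p :=
        mdifferentiableAt_clm_apply hΓ mdifferentiableAt_const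
      rw [mvfderiv_clm_apply h1 mdifferentiableAt_const,
        mvfderiv_clm_apply hΓ mdifferentiableAt_const, mvfderiv_const, mvfderiv_const]
      simp
    rw [← h, ← h, mvfderiv_congr_of_eventuallyEq (g := fun w ↦ christoffel D p w z y)]
    filter_upwards [eventually_trivDom (mem_trivDom (I := I) p)] with w hw
    exact christoffel_symm D hD' hw y z
  have hm : ∀ (A B : E →L[ℝ] E) (v : E), (A * B) v = A (B v) := fun _ _ _ ↦ rfl
  have s := fun x y ↦ christoffel_symm D hD' (mem_trivDom p) x y
  simp only [curvForm, curvatureOf, LinearMap.mk₂_apply, add_apply, sub_apply, hm]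
  rw [hsymm x y z, hsymm y z x, hsymm z x y, s x z, s y x, s z y]
  abel

end Curvature

section PullBack

variable {E : Type*} [NormedAddCommGroup E] [NormedSpace ℝ E] [FiniteDimensional ℝ E]
  {H : Type*} [TopologicalSpace H] {I : ModelWithCorners ℝ E H}
  {M : Type*} [TopologicalSpace M] [ChartedSpace H M] [IsManifold I ∞ M]
  (D : CovariantDerivative I E (TangentSpace I : M → Type _))
  {E' : Type*} [NormedAddCommGroup E'] [NormedSpace ℝ E']
  {H' : Type*} [TopologicalSpace H'] {I' : ModelWithCorners ℝ E' H'}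
  {N : Type*} [TopologicalSpace N] [ChartedSpace H' N] {f : N → M} {z : N} {p : M}

/-- The pulled back connection on endomorphism fields in local coordinates. -/
theorem locEnd_pullbackCov (hf : MDifferentiableAt I' I f z) (hz : f z ∈ trivDom I p)
    {s : Π z : N, EndT I (f z)}
    (hs : MDifferentiableAt I' 𝓘(ℝ, E →L[ℝ] E) (fun w ↦ locEnd I (f z) (f w) (s w)) z)
    (U : TangentSpace I' z) :
    locEnd I p (f z) (pullbackCov (endCov D) I' f s z U) =
      locCov I' (adAction E) (fun w ↦ christoffel D p (f w)) (fun w ↦ extChartAt I p (f w))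
        (fun w ↦ locEnd I p (f w) (s w)) z U := by
  set e := trivializationAt (E →L[ℝ] E) (EndT I : M → Type _) (f z) with he
  set e' := trivializationAt (E →L[ℝ] E) (EndT I : M → Type _) p with he'
  set C : M → (E →L[ℝ] E) →L[ℝ] (E →L[ℝ] E) := fun w ↦ (e.coordChangeL ℝ e' w : _ →L[ℝ] _)
  have hze : f z ∈ e.baseSet := FiberBundle.mem_baseSet_trivializationAt' _
  have hze' : f z ∈ e'.baseSet := ⟨hz, hz⟩
  have hb : ∀ᶠ w in 𝓝 (f z), w ∈ e.baseSet ∩ e'.baseSet :=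
    (e.open_baseSet.inter e'.open_baseSet).mem_nhds ⟨hze, hze'⟩
  have hC : MDifferentiableAt I 𝓘(ℝ, (E →L[ℝ] E) →L[ℝ] (E →L[ℝ] E)) C (f z) :=
    ((contMDiffOn_coordChangeL (n := ∞) (IB := I) e e').contMDiffAt hb).mdifferentiableAt (by simp)
  have hCs : ∀ w ∈ e.baseSet ∩ e'.baseSet, ∀ a, C w a = locEnd I p w (e.symm w a) := fun w hw a ↦
    Trivialization.coordChangeL_apply e e' hw a
  have hCs' : ∀ w ∈ e.baseSet ∩ e'.baseSet, ∀ A : EndT I w,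
      C w (locEnd I (f z) w A) = locEnd I p w A := fun w hw A ↦ by
    rw [hCs w hw]
    congr 1
    exact e.symm_apply_apply_mk hw.1 A
  have hext : ∀ᶠ w in 𝓝 (f z), locEnd I p w (extend (E →L[ℝ] E) (s z) w) =
      C w (locEnd I (f z) (f z) (s z)) := by
    filter_upwards [hb] with w hw
    rw [hCs w hw]
    rfl
  have hev : ∀ᶠ w in 𝓝 z, locEnd I p (f w) (s w) = C (f w) (locEnd I (f z) (f w) (s w)) := by
    filter_upwards [hf.continuousAt.eventually hb] with w hw
    rw [hCs' _ hw]
  have hCf : MDifferentiableAt I' 𝓘(ℝ, (E →L[ℝ] E) →L[ℝ] (E →L[ℝ] E)) (fun w ↦ C (f w)) z :=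
    hC.comp z hf
  have h1 : mvfderiv I' (fun w ↦ locEnd I p (f w) (s w)) z U =
      mvfderiv I C (f z) (mfderiv I' I f z U) (locEnd I (f z) (f z) (s z)) +
        C (f z) (mvfderiv I' (fun w ↦ locEnd I (f z) (f w) (s w)) z U) := by
    rw [mvfderiv_congr_of_eventuallyEq hev, mvfderiv_clm_apply hCf hs, mvfderiv_comp_map hC hf]
  have h2 := locEnd_endCov D hz (mdifferentiableAt_extend I (E →L[ℝ] E) (s z))
    (mfderiv I' I f z U)
  have hchart := (contMDiffAt_chart hz).mdifferentiableAt (by simp)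
  have hss : extend (E →L[ℝ] E) (s z) (f z) = s z := by simp
  rw [locCov, mvfderiv_congr_of_eventuallyEq hext, mvfderiv_clm_apply hC mdifferentiableAt_const,
    mvfderiv_const, hss] at h2
  rw [locCov, mvfderiv_comp_map hchart hf, h1]
  have h3 : locEnd I p (f z) (e.symmL ℝ (f z)
      (mvfderiv I' (fun w ↦ locEnd I (f z) (f w) (s w)) z U)) =
      C (f z) (mvfderiv I' (fun w ↦ locEnd I (f z) (f w) (s w)) z U) :=
    by rw [hCs _ ⟨hze, hze'⟩, Trivialization.symmL_apply e hze]
  have h4 : pullbackCov (endCov D) I' f s z U =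
      endCov D (extend (E →L[ℝ] E) (s z)) (f z) (mfderiv I' I f z U) +
      e.symmL ℝ (f z) (mvfderiv I' (fun w ↦ locEnd I (f z) (f w) (s w)) z U) := rfl
  rw [h4, map_add, h2, h3]
  simp
  abel

end PullBack

end Quaternionic

namespace Quaternionic

theorem IsQuaternionTriple.locEnd {E : Type*} [NormedAddCommGroup E] [NormedSpace ℝ E]
    {H : Type*} [TopologicalSpace H] {I : ModelWithCorners ℝ E H}
    {M : Type*} [TopologicalSpace M] [ChartedSpace H M] [IsManifold I ∞ M] {p q : M}
    (hq : q ∈ trivDom I p) {J : Fin 3 → EndT I q} (hJ : IsQuaternionTriple J) :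
    IsQuaternionTriple fun i ↦ Quaternionic.locEnd I p q (J i) where
  sq i := by rw [← locEnd_mul hq, hJ.sq, map_neg, locEnd_one hq]
  mul := by rw [← locEnd_mul hq, hJ.mul]

namespace AlmostQuaternionicStructure

variable {n : ℕ} {M : Type*} [TopologicalSpace M]
  [ChartedSpace (EuclideanSpace ℝ (Fin (4 * n))) M] [IsManifold (𝓡 (4 * n)) ∞ M]
  (Q : AlmostQuaternionicStructure n M)
  {D : CovariantDerivative (𝓡 (4 * n)) (EuclideanSpace ℝ (Fin (4 * n)))
    (TangentSpace (𝓡 (4 * n)) : M → Type _)}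

theorem nontrivial_model (Q : AlmostQuaternionicStructure n M) :
    Nontrivial (EuclideanSpace ℝ (Fin (4 * n))) := by
  have := Q.two_le
  refine Module.nontrivial_of_finrank_pos (R := ℝ) ?_
  rw [finrank_euclideanSpace_fin]
  omega

/-- The fibre `Q_q` in the trivialization of `TM` at `p`. -/
def locFiber (p q : M) : Submodule ℝ (EndF n) := (Q.fiber q).map (locEnd (𝓡 (4 * n)) p q)

theorem locFiber_eq_span (p q r : M) : Q.locFiber p q =
    Submodule.span ℝ (Set.range fun i ↦ locEnd (𝓡 (4 * n)) p q (Q.frame r i q)) := by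
  rw [locFiber, Q.fiber_eq r q, Submodule.map_span, ← Set.range_comp]
  rfl

variable {Q}

theorem locEnd_mem_locFiber {p q : M} {A : EndT (𝓡 (4 * n)) q} (hA : A ∈ Q.fiber q) :
    locEnd (𝓡 (4 * n)) p q A ∈ Q.locFiber p q :=
  Submodule.mem_map_of_mem hA

theorem mem_fiber_of_locEnd {p q : M} (hq : q ∈ trivDom (𝓡 (4 * n)) p) {A : EndT (𝓡 (4 * n)) q}
    (hA : locEnd (𝓡 (4 * n)) p q A ∈ Q.locFiber p q) : A ∈ Q.fiber q := by
  obtain ⟨B, hB, e⟩ := hA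
  rwa [← locEnd_injective hq e]

/-- A complex structure in `Q_q` is a member of a triple spanning `Q_q`, in local coordinates. -/
theorem exists_adapted {p q : M} (hq : q ∈ trivDom (𝓡 (4 * n)) p) {j : EndT (𝓡 (4 * n)) q}
    (hj : j ∈ Q.fiber q) (hj2 : j * j = -1) :
    ∃ K : Fin 3 → EndF n, IsQuaternionTriple K ∧ K 0 = locEnd (𝓡 (4 * n)) p q j ∧
      Submodule.span ℝ (Set.range K) = Q.locFiber p q := by
  have := Q.nontrivial_model
  have hJ := (Q.frame_triple q q).locEnd hq
  obtain ⟨K, h1, h2, h3⟩ := hJ.exists_adapted (j := locEnd (𝓡 (4 * n)) p q j)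
    (by rw [← locFiber_eq_span]; exact locEnd_mem_locFiber hj)
    (by rw [← locEnd_mul hq, hj2, map_neg, locEnd_one hq])
  exact ⟨K, h1, h2, by rw [h3, ← locFiber_eq_span]⟩

variable [T2Space M]

/-- A quaternionic connection preserves the local sections of `Q`. -/
theorem endCov_mem (hD : Q.IsQuaternionicConnection D) {A : Π q : M, EndT (𝓡 (4 * n)) q}
    {U : Set M} (hU : IsOpen U)
    (hA : ContMDiffOn (𝓡 (4 * n)) ((𝓡 (4 * n)).prod 𝓘(ℝ, EndF n)) ∞
      (fun q ↦ TotalSpace.mk' (EndF n) (E := EndT (𝓡 (4 * n))) q (A q)) U)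
    (hAQ : ∀ q ∈ U, A q ∈ Q.fiber q) {q : M} (hq : q ∈ U) (x : TangentSpace (𝓡 (4 * n)) q) :
    endCov D A q x ∈ Q.fiber q := by
  obtain ⟨f, hf, hf0, hs⟩ := exists_global_section (𝓡 (4 * n)) (EndF n) hU hq hA
  have h1 := hD.preserves (f • A) hs (fun w ↦ ?_) q x
  · have e : endCov D A q = endCov D (f • A) q := by
      refine (endCov D).isCovariantDerivativeOnUniv.congr_of_eventuallyEq
        ((hA.contMDiffAt (hU.mem_nhds hq)).mdifferentiableAt (by simp))
        (hs.mdifferentiable (by simp) q) Filter.univ_mem ?_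
      filter_upwards [hf] with w hw
      simp [hw]
    rwa [e]
  · by_cases hw : w ∈ U
    · exact Submodule.smul_mem _ _ (hAQ w hw)
    · simp [hf0 w hw]

theorem curvForm_normalizes (hD : Q.IsQuaternionicConnection D) (p : M)
    (x y : EuclideanSpace ℝ (Fin (4 * n))) {a : EndF n} (ha : a ∈ Q.locFiber p p) :
    curvForm D p x y * a - a * curvForm D p x y ∈ Q.locFiber p p := by
  have := Q.nontrivial_model
  rw [Q.locFiber_eq_span p p p, Submodule.mem_span_range_iff_exists_fun] at ha
  obtain ⟨c, rfl⟩ := ha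
  set U : Set M := Q.dom p ∩ trivDom (𝓡 (4 * n)) p
  have hU : IsOpen U := (Q.isOpen_dom p).inter (isOpen_trivDom p)
  have hpU : p ∈ U := ⟨Q.mem_dom p, mem_trivDom p⟩
  set A : Π q : M, EndT (𝓡 (4 * n)) q := fun q ↦ ∑ i, c i • Q.frame p i q
  have hA : ContMDiffOn (𝓡 (4 * n)) ((𝓡 (4 * n)).prod 𝓘(ℝ, EndF n)) ∞
      (fun q ↦ TotalSpace.mk' (EndF n) (E := EndT (𝓡 (4 * n))) q (A q)) U :=
    Q.contMDiffOn_sum_frame p (f := id) (a := fun _ ↦ c) contMDiffOn_id (fun q hq ↦ hq.1)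
      (fun i ↦ contMDiffOn_const)
  have hAQ : ∀ q, A q ∈ Q.fiber q := fun q ↦ by
    rw [Q.fiber_eq p q]
    exact Submodule.sum_mem _ fun i _ ↦ Submodule.smul_mem _ _ (Submodule.subset_span ⟨i, rfl⟩)
  set X : EuclideanSpace ℝ (Fin (4 * n)) → Π q : M, TangentSpace (𝓡 (4 * n)) q := fun x q ↦ ofLocVec (𝓡 (4 * n)) p q x
  set B : EuclideanSpace ℝ (Fin (4 * n)) → Π q : M, EndT (𝓡 (4 * n)) q := fun x q ↦ endCov D A q (X x q)
  set a : M → EndF n := fun q ↦ locEnd (𝓡 (4 * n)) p q (A q)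
  have haU : ∀ q ∈ U, ContMDiffAt (𝓡 (4 * n)) 𝓘(ℝ, EndF n) ∞ a q := fun q hq ↦
    ((contMDiffAt_end_iff (f := id) hq.2).1 (hA.contMDiffAt (hU.mem_nhds hq))).2
  have hB : ∀ x, ∀ q ∈ U, locEnd (𝓡 (4 * n)) p q (B x q) = locCov (𝓡 (4 * n)) (adAction _)
      (christoffel D p) (extChartAt (𝓡 (4 * n)) p) a q (X x q) := fun x q hq ↦
    locEnd_endCov D hq.2 ((hA.contMDiffAt (hU.mem_nhds hq)).mdifferentiableAt (by simp)) _
  have hBs : ∀ x, ContMDiffOn (𝓡 (4 * n)) ((𝓡 (4 * n)).prod 𝓘(ℝ, EndF n)) ∞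
      (fun q ↦ TotalSpace.mk' (EndF n) (E := EndT (𝓡 (4 * n))) q (B x q)) U := by
    intro x q hq
    refine ((contMDiffAt_end_iff (f := id) hq.2).2 ⟨contMDiffAt_id, ?_⟩).contMDiffWithinAt
    refine (contMDiffAt_locCov (ρ := adAction _) (contMDiffAt_christoffel D hD.smooth hq.2) (contMDiffAt_chart hq.2)
      (haU q hq) (contMDiffAt_ofLocVec hq.2 x)).congr_of_eventuallyEq ?_
    filter_upwards [hU.mem_nhds hq] with w hw using hB x w hw
  have hBQ : ∀ x, ∀ q ∈ U, B x q ∈ Q.fiber q := fun x q hq ↦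
    endCov_mem hD hU hA (fun q _ ↦ hAQ q) hq _
  have hBB : ∀ x y, locCov (𝓡 (4 * n)) (adAction _) (christoffel D p) (extChartAt (𝓡 (4 * n)) p)
      (fun q ↦ locCov (𝓡 (4 * n)) (adAction _) (christoffel D p) (extChartAt (𝓡 (4 * n)) p) a q
        (X y q)) p (X x p) ∈ Q.locFiber p p := by
    intro x y
    have h := locEnd_mem_locFiber (p := p) (endCov_mem hD hU (hBs y) (hBQ y) hpU (X x p))
    rw [locEnd_endCov D (mem_trivDom p)
      (((hBs y).contMDiffAt (hU.mem_nhds hpU)).mdifferentiableAt (by simp))] at h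
    rwa [locCov_congr (v := fun q ↦ locCov (𝓡 (4 * n)) (adAction _) (christoffel D p)
      (extChartAt (𝓡 (4 * n)) p) a q (X y q))] at h
    filter_upwards [hU.mem_nhds hpU] with w hw using hB y w hw
  have h1 := locCov_commutator isLieAction_ad (contMDiffAt_christoffel D hD.smooth (mem_trivDom p))
    (contMDiffAt_chart (mem_trivDom p)) (haU p hpU) (contMDiffAt_ofLocVec (mem_trivDom p) x)
    (contMDiffAt_ofLocVec (mem_trivDom p) y)
  have h2 : locCov (𝓡 (4 * n)) (adAction _) (christoffel D p) (extChartAt (𝓡 (4 * n)) p) a p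
      (VectorField.mlieBracket (𝓡 (4 * n)) (X x) (X y) p) ∈ Q.locFiber p p := by
    rw [← locEnd_endCov D (mem_trivDom p)
      ((hA.contMDiffAt (hU.mem_nhds hpU)).mdifferentiableAt (by simp))]
    exact locEnd_mem_locFiber (endCov_mem hD hU hA (fun q _ ↦ hAQ q) hpU _)
  have h3 := sub_mem (sub_mem (hBB x y) (hBB y x)) h2
  rw [h1, ← curvForm_locVec, locVec_ofLocVec (mem_trivDom p), locVec_ofLocVec (mem_trivDom p)] at h3
  have e : a p = ∑ i, c i • locEnd (𝓡 (4 * n)) p p (Q.frame p i p) := by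
    simp only [a, A, map_sum, map_smul]
  rw [← e]
  exact h3

theorem isQuaternionicCurvature_curvForm (hD : Q.IsQuaternionicConnection D) (p : M)
    {K : Fin 3 → EndF n} (hK : Submodule.span ℝ (Set.range K) = Q.locFiber p p) :
    IsQuaternionicCurvature K (curvForm D p) := by
  have := Q.nontrivial_model
  refine ⟨fun x y ↦ curvForm_alt D x y, curvForm_bianchi D hD.smooth hD.torsion_free, ?_⟩
  rw [hK]
  exact fun x y a ha ↦ curvForm_normalizes hD p x y ha

end AlmostQuaternionicStructure

end Quaternionic

namespace Quaternionic

namespace AlmostQuaternionicStructure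

variable {n : ℕ} {M : Type*} [TopologicalSpace M]
  [ChartedSpace (EuclideanSpace ℝ (Fin (4 * n))) M] [IsManifold (𝓡 (4 * n)) ∞ M]
  (Q : AlmostQuaternionicStructure n M)
  {D : CovariantDerivative (𝓡 (4 * n)) (EuclideanSpace ℝ (Fin (4 * n)))
    (TangentSpace (𝓡 (4 * n)) : M → Type _)}

theorem continuous_proj : Continuous Q.proj :=
  (FiberBundle.continuous_proj _ _).comp continuous_subtype_val

theorem contMDiffAt_triv_proj (z : Q.Twistor) :
    ContMDiffAt ((𝓡 (4 * n)).prod (𝓡 2)) ((𝓡 (4 * n)).prod (𝓡 2)) ∞ (Q.triv (Q.proj z)) z := by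
  set e := chartAt (ModelProd (EuclideanSpace ℝ (Fin (4 * n))) (EuclideanSpace ℝ (Fin 2)))
      (Q.triv (Q.proj z) z) with he
  have h1 : ContMDiffAt ((𝓡 (4 * n)).prod (𝓡 2)) ((𝓡 (4 * n)).prod (𝓡 2)) ∞
      (chartAt (ModelProd (EuclideanSpace ℝ (Fin (4 * n))) (EuclideanSpace ℝ (Fin 2))) z) z :=
    contMDiffOn_chart.contMDiffAt ((chartAt _ z).open_source.mem_nhds (mem_chart_source _ z))
  have h2 : ContMDiffAt ((𝓡 (4 * n)).prod (𝓡 2)) ((𝓡 (4 * n)).prod (𝓡 2)) ∞ e.symm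
      (e (Q.triv (Q.proj z) z)) :=
    contMDiffOn_chart_symm.contMDiffAt (e.open_target.mem_nhds (e.map_source (mem_chart_source _ _)))
  refine (h2.comp z h1).congr_of_eventuallyEq ?_
  filter_upwards [(chartAt (ModelProd (EuclideanSpace ℝ (Fin (4 * n))) (EuclideanSpace ℝ (Fin 2)))
    z).open_source.mem_nhds (mem_chart_source _ z)] with w hw
  exact (e.left_inv hw.2).symm

theorem contMDiffAt_triv_proj_symm (z : Q.Twistor) :
    ContMDiffAt ((𝓡 (4 * n)).prod (𝓡 2)) ((𝓡 (4 * n)).prod (𝓡 2)) ∞ (Q.triv (Q.proj z)).symm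
      (Q.triv (Q.proj z) z) := by
  set e := chartAt (ModelProd (EuclideanSpace ℝ (Fin (4 * n))) (EuclideanSpace ℝ (Fin 2)))
      (Q.triv (Q.proj z) z) with he
  set c := chartAt (ModelProd (EuclideanSpace ℝ (Fin (4 * n))) (EuclideanSpace ℝ (Fin 2))) z with hc
  have hz : z ∈ c.source := mem_chart_source _ z
  have h1 : ContMDiffAt ((𝓡 (4 * n)).prod (𝓡 2)) ((𝓡 (4 * n)).prod (𝓡 2)) ∞ c.symm (c z) :=
    contMDiffOn_chart_symm.contMDiffAt (c.open_target.mem_nhds (c.map_source hz))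
  have h2 : ContMDiffAt ((𝓡 (4 * n)).prod (𝓡 2)) ((𝓡 (4 * n)).prod (𝓡 2)) ∞ e
      (Q.triv (Q.proj z) z) :=
    contMDiffOn_chart.contMDiffAt (e.open_source.mem_nhds (mem_chart_source _ _))
  refine (h1.comp (Q.triv (Q.proj z) z) h2).congr_of_eventuallyEq ?_
  filter_upwards [e.open_source.mem_nhds (mem_chart_source _ _)] with w hw
  exact congrArg (Q.triv (Q.proj z)).symm (e.left_inv hw).symm

variable {Q}

theorem contMDiffAt_triv {p : M} {z : Q.Twistor} (hz : Q.proj z ∈ Q.dom p) :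
    ContMDiffAt ((𝓡 (4 * n)).prod (𝓡 2)) ((𝓡 (4 * n)).prod (𝓡 2)) ∞ (Q.triv p) z := by
  set t := (Q.triv (Q.proj z)).symm ≫ₕ Q.triv p
  have hz0 : z ∈ (Q.triv (Q.proj z)).source := Q.mem_dom _
  have hx : Q.triv (Q.proj z) z ∈ t.source := ⟨(Q.triv (Q.proj z)).map_source hz0, by
    change (Q.triv (Q.proj z)).symm (Q.triv (Q.proj z) z) ∈ (Q.triv p).source
    rw [(Q.triv (Q.proj z)).left_inv hz0]
    exact hz⟩
  have h := (Q.contMDiffOn_transition (Q.proj z) p).contMDiffAt (t.open_source.mem_nhds hx)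
  refine (h.comp z (Q.contMDiffAt_triv_proj z)).congr_of_eventuallyEq ?_
  filter_upwards [(Q.triv (Q.proj z)).open_source.mem_nhds hz0] with w hw
  exact congrArg (Q.triv p) ((Q.triv (Q.proj z)).left_inv hw).symm

theorem contMDiffAt_triv_symm {p : M} {z : Q.Twistor} (hz : Q.proj z ∈ Q.dom p) :
    ContMDiffAt ((𝓡 (4 * n)).prod (𝓡 2)) ((𝓡 (4 * n)).prod (𝓡 2)) ∞ (Q.triv p).symm
      (Q.triv p z) := by
  set t := (Q.triv p).symm ≫ₕ Q.triv (Q.proj z)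
  have hz0 : z ∈ (Q.triv p).source := hz
  have hx : Q.triv p z ∈ t.source := ⟨(Q.triv p).map_source hz0, by
    change (Q.triv p).symm (Q.triv p z) ∈ (Q.triv (Q.proj z)).source
    rw [(Q.triv p).left_inv hz0]
    exact Q.mem_dom _⟩
  have h := (Q.contMDiffOn_transition p (Q.proj z)).contMDiffAt (t.open_source.mem_nhds hx)
  have h2 := Q.contMDiffAt_triv_proj_symm z
  have e : t (Q.triv p z) = Q.triv (Q.proj z) z :=
    congrArg (Q.triv (Q.proj z)) ((Q.triv p).left_inv hz0)
  rw [← e] at h2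
  refine (h2.comp (Q.triv p z) h).congr_of_eventuallyEq ?_
  filter_upwards [t.open_source.mem_nhds hx] with w hw
  exact ((Q.triv (Q.proj z)).left_inv hw.2).symm

variable (Q) in
theorem contMDiff_proj : ContMDiff ((𝓡 (4 * n)).prod (𝓡 2)) (𝓡 (4 * n)) ∞ Q.proj := fun z ↦
  contMDiffAt_fst.comp z (Q.contMDiffAt_triv_proj z)

variable (Q) in
theorem contMDiff_taut : ContMDiff ((𝓡 (4 * n)).prod (𝓡 2)) ((𝓡 (4 * n)).prod 𝓘(ℝ, EndF n)) ∞
    (fun z ↦ TotalSpace.mk' (EndF n) (E := EndT (𝓡 (4 * n))) (Q.proj z) (Q.taut z)) := by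
  intro z
  have hs : IsOpen (Q.proj ⁻¹' Q.dom (Q.proj z)) := (Q.isOpen_dom _).preimage Q.continuous_proj
  have h := Q.contMDiffOn_sum_frame (Q.proj z) (f := Q.proj) (s := Q.proj ⁻¹' Q.dom (Q.proj z))
    (a := fun w ↦ Q.coord (Q.proj z) (Q.taut w)) Q.contMDiff_proj.contMDiffOn (fun _ h ↦ h)
    (fun i w hw ↦ by
      have h1 := contMDiff_coe_sphere₂.contMDiffAt.comp w
        (contMDiffAt_snd.comp w (contMDiffAt_triv (p := Q.proj z) hw))
      exact ((EuclideanSpace.proj (𝕜 := ℝ) i).contMDiff.contMDiffAt.comp w h1).contMDiffWithinAt)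
  refine (h.contMDiffAt (hs.mem_nhds (Q.mem_dom _))).congr_of_eventuallyEq ?_
  filter_upwards with w
  rw [Q.sum_coord (Q.proj z) (show Q.taut w ∈ Q.fiber (Q.proj w) from w.2.1)]

instance [T2Space M] : T2Space Q.Twistor := by
  refine ⟨fun z w hzw ↦ ?_⟩
  by_cases h : Q.proj z = Q.proj w
  · set t := Q.triv (Q.proj z)
    have hz : z ∈ t.source := Q.mem_dom _
    have hw : w ∈ t.source := by change Q.proj w ∈ Q.dom _; rw [← h]; exact Q.mem_dom _
    obtain ⟨u, v, hu, hv, hzu, hwv, huv⟩ := t2_separation (fun e ↦ hzw (t.injOn hz hw e))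
    refine ⟨t.source ∩ t ⁻¹' u, t.source ∩ t ⁻¹' v, t.isOpen_inter_preimage hu,
      t.isOpen_inter_preimage hv, ⟨hz, hzu⟩, ⟨hw, hwv⟩, ?_⟩
    exact ((huv.preimage t).mono Set.inter_subset_right Set.inter_subset_right)
  · obtain ⟨u, v, hu, hv, hzu, hwv, huv⟩ := t2_separation h
    exact ⟨Q.proj ⁻¹' u, Q.proj ⁻¹' v, hu.preimage Q.continuous_proj, hv.preimage Q.continuous_proj,
      hzu, hwv, huv.preimage _⟩

theorem taut_mem (z : Q.Twistor) : Q.taut z ∈ Q.fiber (Q.proj z) := z.2.1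

theorem taut_sq (z : Q.Twistor) : Q.taut z * Q.taut z = -1 := z.2.2

variable (Q) in
/-- An endomorphism field along `π` in the trivialization of `TM` at `p`. -/
def locSection (p : M) (s : Π z : Q.Twistor, EndT (𝓡 (4 * n)) (Q.proj z)) (z : Q.Twistor) : EndF n :=
  locEnd (𝓡 (4 * n)) p (Q.proj z) (s z)

variable (D) in
variable (Q) in
/-- The covariant derivative `π^*D` on endomorphism fields in the trivialization of `TM` at `p`. -/
def piLoc (p : M) (a : Q.Twistor → EndF n) (z : Q.Twistor)
    (U : TangentSpace ((𝓡 (4 * n)).prod (𝓡 2)) z) : EndF n :=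
  locCov ((𝓡 (4 * n)).prod (𝓡 2)) (adAction (EuclideanSpace ℝ (Fin (4 * n))))
    (fun w ↦ christoffel D p (Q.proj w)) (fun w ↦ extChartAt (𝓡 (4 * n)) p (Q.proj w)) a z U

variable {p : M} {z : Q.Twistor} {s : Π z : Q.Twistor, EndT (𝓡 (4 * n)) (Q.proj z)}

theorem contMDiffAt_locSection_iff (hz : Q.proj z ∈ trivDom (𝓡 (4 * n)) p) :
    ContMDiffAt ((𝓡 (4 * n)).prod (𝓡 2)) ((𝓡 (4 * n)).prod 𝓘(ℝ, EndF n)) ∞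
      (fun z ↦ TotalSpace.mk' (EndF n) (E := EndT (𝓡 (4 * n))) (Q.proj z) (s z)) z ↔
    ContMDiffAt ((𝓡 (4 * n)).prod (𝓡 2)) 𝓘(ℝ, EndF n) ∞ (Q.locSection p s) z := by
  rw [contMDiffAt_end_iff hz]
  exact and_iff_right Q.contMDiff_proj.contMDiffAt

theorem locEnd_piCov (hz : Q.proj z ∈ trivDom (𝓡 (4 * n)) p)
    (hs : ContMDiffAt ((𝓡 (4 * n)).prod (𝓡 2)) ((𝓡 (4 * n)).prod 𝓘(ℝ, EndF n)) ∞
      (fun z ↦ TotalSpace.mk' (EndF n) (E := EndT (𝓡 (4 * n))) (Q.proj z) (s z)) z)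
    (U : TangentSpace ((𝓡 (4 * n)).prod (𝓡 2)) z) :
    locEnd (𝓡 (4 * n)) p (Q.proj z) (Q.piCov D s z U) = Q.piLoc D p (Q.locSection p s) z U :=
  locEnd_pullbackCov D (Q.contMDiff_proj.mdifferentiable (by simp) z) hz
    (((contMDiffAt_locSection_iff (mem_trivDom _)).1 hs).mdifferentiableAt (by simp)) U

end AlmostQuaternionicStructure

end Quaternionic

namespace Quaternionic

namespace AlmostQuaternionicStructure

variable {n : ℕ} {M : Type*} [TopologicalSpace M]
  [ChartedSpace (EuclideanSpace ℝ (Fin (4 * n))) M] [IsManifold (𝓡 (4 * n)) ∞ M]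
  {Q : AlmostQuaternionicStructure n M}
  {D : CovariantDerivative (𝓡 (4 * n)) (EuclideanSpace ℝ (Fin (4 * n)))
    (TangentSpace (𝓡 (4 * n)) : M → Type _)}
  {p : M} {z : Q.Twistor} {s : Π z : Q.Twistor, EndT (𝓡 (4 * n)) (Q.proj z)}

theorem mdifferentiableAt_proj (z : Q.Twistor) :
    MDifferentiableAt ((𝓡 (4 * n)).prod (𝓡 2)) (𝓡 (4 * n)) Q.proj z :=
  Q.contMDiff_proj.mdifferentiable (by simp) z

theorem mvfderiv_comp_proj {F : Type*} [NormedAddCommGroup F] [NormedSpace ℝ F] {b : M → F}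
    (hb : MDifferentiableAt (𝓡 (4 * n)) 𝓘(ℝ, F) b (Q.proj z))
    (U : TangentSpace ((𝓡 (4 * n)).prod (𝓡 2)) z) :
    mvfderiv ((𝓡 (4 * n)).prod (𝓡 2)) (fun w ↦ b (Q.proj w)) z U =
      mvfderiv (𝓡 (4 * n)) b (Q.proj z) (Q.dproj z U) :=
  mvfderiv_comp_map hb (mdifferentiableAt_proj z) U

theorem mvfderiv_chart_proj (hz : Q.proj z ∈ trivDom (𝓡 (4 * n)) p)
    (U : TangentSpace ((𝓡 (4 * n)).prod (𝓡 2)) z) :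
    mvfderiv ((𝓡 (4 * n)).prod (𝓡 2)) (fun w ↦ extChartAt (𝓡 (4 * n)) p (Q.proj w)) z U =
      locVec (𝓡 (4 * n)) p (Q.proj z) (Q.dproj z U) := by
  rw [mvfderiv_comp_proj ((contMDiffAt_chart hz).mdifferentiableAt (by simp)), mvfderiv_chart hz]

theorem piLoc_eq (hz : Q.proj z ∈ trivDom (𝓡 (4 * n)) p) (a : Q.Twistor → EndF n)
    (U : TangentSpace ((𝓡 (4 * n)).prod (𝓡 2)) z) :
    Q.piLoc D p a z U = mvfderiv ((𝓡 (4 * n)).prod (𝓡 2)) a z U +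
      (christoffel D p (Q.proj z) (locVec (𝓡 (4 * n)) p (Q.proj z) (Q.dproj z U)) * a z -
        a z * christoffel D p (Q.proj z) (locVec (𝓡 (4 * n)) p (Q.proj z) (Q.dproj z U))) := by
  rw [piLoc, locCov, mvfderiv_chart_proj hz, adAction_apply]

theorem piLoc_comp_proj (hz : Q.proj z ∈ trivDom (𝓡 (4 * n)) p) {b : M → EndF n}
    (hb : MDifferentiableAt (𝓡 (4 * n)) 𝓘(ℝ, EndF n) b (Q.proj z))
    (U : TangentSpace ((𝓡 (4 * n)).prod (𝓡 2)) z) :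
    Q.piLoc D p (fun w ↦ b (Q.proj w)) z U =
      locCov (𝓡 (4 * n)) (adAction _) (christoffel D p) (extChartAt (𝓡 (4 * n)) p) b (Q.proj z)
        (Q.dproj z U) := by
  rw [piLoc_eq hz, mvfderiv_comp_proj hb, locCov, mvfderiv_chart hz, adAction_apply]

theorem contMDiffAt_locSection (hz : Q.proj z ∈ trivDom (𝓡 (4 * n)) p)
    (hs : ContMDiff ((𝓡 (4 * n)).prod (𝓡 2)) ((𝓡 (4 * n)).prod 𝓘(ℝ, EndF n)) ∞
      (fun z ↦ TotalSpace.mk' (EndF n) (E := EndT (𝓡 (4 * n))) (Q.proj z) (s z))) :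
    ContMDiffAt ((𝓡 (4 * n)).prod (𝓡 2)) 𝓘(ℝ, EndF n) ∞ (Q.locSection p s) z :=
  (contMDiffAt_locSection_iff hz).1 hs.contMDiffAt

theorem mdifferentiableAt_locSection (hz : Q.proj z ∈ trivDom (𝓡 (4 * n)) p)
    (hs : ContMDiff ((𝓡 (4 * n)).prod (𝓡 2)) ((𝓡 (4 * n)).prod 𝓘(ℝ, EndF n)) ∞
      (fun z ↦ TotalSpace.mk' (EndF n) (E := EndT (𝓡 (4 * n))) (Q.proj z) (s z))) :
    MDifferentiableAt ((𝓡 (4 * n)).prod (𝓡 2)) 𝓘(ℝ, EndF n) (Q.locSection p s) z :=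
  (contMDiffAt_locSection hz hs).mdifferentiableAt (by simp)

theorem eventually_proj_mem {U : Set M} (hU : IsOpen U) (hz : Q.proj z ∈ U) :
    ∀ᶠ w in 𝓝 z, Q.proj w ∈ U :=
  Q.continuous_proj.continuousAt.eventually (hU.mem_nhds hz)

/-- The pulled back connection preserves `π^*Q`. -/
theorem piCov_mem [T2Space M] (hD : Q.IsQuaternionicConnection D)
    (hs : ContMDiff ((𝓡 (4 * n)).prod (𝓡 2)) ((𝓡 (4 * n)).prod 𝓘(ℝ, EndF n)) ∞
      (fun z ↦ TotalSpace.mk' (EndF n) (E := EndT (𝓡 (4 * n))) (Q.proj z) (s z)))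
    (hsQ : ∀ w, s w ∈ Q.fiber (Q.proj w)) (U : TangentSpace ((𝓡 (4 * n)).prod (𝓡 2)) z) :
    Q.piCov D s z U ∈ Q.fiber (Q.proj z) := by
  set q := Q.proj z with hq
  have hzq : Q.proj z ∈ trivDom (𝓡 (4 * n)) q := mem_trivDom q
  have hzd : Q.proj z ∈ Q.dom q := Q.mem_dom q
  refine mem_fiber_of_locEnd hzq ?_
  rw [locEnd_piCov hzq hs.contMDiffAt]
  set b : Fin 3 → M → EndF n := fun i w ↦ locEnd (𝓡 (4 * n)) q w (Q.frame q i w)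
  set c : Fin 3 → Q.Twistor → ℝ := fun i w ↦ qInner (Q.frame q i (Q.proj w)) (s w)
  have hframe : ∀ i, ContMDiffAt (𝓡 (4 * n)) ((𝓡 (4 * n)).prod 𝓘(ℝ, EndF n)) ∞
      (fun q' ↦ TotalSpace.mk' (EndF n) (E := EndT (𝓡 (4 * n))) q' (Q.frame q i q')) q := fun i ↦
    (Q.contMDiffOn_frame q i).contMDiffAt ((Q.isOpen_dom q).mem_nhds hzd)
  have hb : ∀ i, MDifferentiableAt (𝓡 (4 * n)) 𝓘(ℝ, EndF n) (b i) (Q.proj z) := fun i ↦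
    (mdifferentiableAt_end_iff hzq).1 ((hframe i).mdifferentiableAt (by simp))
  have hbπ : ∀ i, MDifferentiableAt ((𝓡 (4 * n)).prod (𝓡 2)) 𝓘(ℝ, EndF n)
      (fun w ↦ b i (Q.proj w)) z := fun i ↦ (hb i).comp z (mdifferentiableAt_proj z)
  have hc : ∀ i, MDifferentiableAt ((𝓡 (4 * n)).prod (𝓡 2)) 𝓘(ℝ, ℝ) (c i) z := fun i ↦ by
    have h1 : ContMDiffAt ((𝓡 (4 * n)).prod (𝓡 2)) 𝓘(ℝ, ℝ) ∞ (c i) z := by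
      rw [← contMDiffWithinAt_univ]
      refine contMDiffWithinAt_qInner (f := Q.proj) ?_ hs.contMDiffAt
      exact ((hframe i).comp z Q.contMDiff_proj.contMDiffAt).contMDiffWithinAt
    exact h1.mdifferentiableAt (by simp)
  have hcb : ∀ i, MDifferentiableAt ((𝓡 (4 * n)).prod (𝓡 2)) 𝓘(ℝ, EndF n)
      (fun w ↦ c i w • b i (Q.proj w)) z := fun i ↦ (hc i).smul (hbπ i)
  have hcb01 : MDifferentiableAt ((𝓡 (4 * n)).prod (𝓡 2)) 𝓘(ℝ, EndF n)
      (fun w ↦ c 0 w • b 0 (Q.proj w) + c 1 w • b 1 (Q.proj w)) z := (hcb 0).add (hcb 1)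
  have hev : ∀ w, Q.locSection q s w = c 0 w • b 0 (Q.proj w) + c 1 w • b 1 (Q.proj w) +
      c 2 w • b 2 (Q.proj w) := by
    intro w
    have h := congrArg (locEnd (𝓡 (4 * n)) q (Q.proj w)) (Q.sum_coord q (hsQ w))
    rw [Fin.sum_univ_three] at h
    simp only [map_add, map_smul] at h
    exact h.symm
  have hterm : ∀ i, Q.piLoc D q (fun w ↦ c i w • b i (Q.proj w)) z U ∈ Q.locFiber q (Q.proj z) := by
    intro i
    have h1 : Q.piLoc D q (fun w ↦ c i w • b i (Q.proj w)) z U = _ := locCov_smul (hc i) (hbπ i) U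
    rw [h1]
    refine add_mem (Submodule.smul_mem _ _ ?_) (Submodule.smul_mem _ _ ?_)
    · change Q.piLoc D q (fun w ↦ b i (Q.proj w)) z U ∈ _
      rw [piLoc_comp_proj hzq (hb i), ← locEnd_endCov D hzq ((hframe i).mdifferentiableAt (by simp))]
      refine locEnd_mem_locFiber (endCov_mem hD (Q.isOpen_dom q) (Q.contMDiffOn_frame q i) ?_ hzd _)
      intro w _
      rw [Q.fiber_eq q w]
      exact Submodule.subset_span ⟨i, rfl⟩
    · refine locEnd_mem_locFiber ?_
      rw [Q.fiber_eq q]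
      exact Submodule.subset_span ⟨i, rfl⟩
  rw [funext hev]
  have e : Q.piLoc D q (fun w ↦ c 0 w • b 0 (Q.proj w) + c 1 w • b 1 (Q.proj w) +
      c 2 w • b 2 (Q.proj w)) z U = Q.piLoc D q (fun w ↦ c 0 w • b 0 (Q.proj w)) z U +
      Q.piLoc D q (fun w ↦ c 1 w • b 1 (Q.proj w)) z U +
      Q.piLoc D q (fun w ↦ c 2 w • b 2 (Q.proj w)) z U :=
    (locCov_add hcb01 (hcb 2) U).trans (congrArg (· + _) (locCov_add (hcb 0) (hcb 1) U))
  rw [e]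
  exact add_mem (add_mem (hterm 0) (hterm 1)) (hterm 2)

theorem locSection_taut_sq (hz : Q.proj z ∈ trivDom (𝓡 (4 * n)) p) :
    Q.locSection p Q.taut z * Q.locSection p Q.taut z = -1 := by
  rw [locSection, ← locEnd_mul hz, taut_sq, map_neg, locEnd_one hz]

theorem eventually_locSection_taut_sq (hz : Q.proj z ∈ trivDom (𝓡 (4 * n)) p) :
    ∀ᶠ w in 𝓝 z, Q.locSection p Q.taut w * Q.locSection p Q.taut w = -1 := by
  filter_upwards [eventually_proj_mem (isOpen_trivDom p) hz] with w hw using locSection_taut_sq hw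

theorem locEnd_vert (hz : Q.proj z ∈ trivDom (𝓡 (4 * n)) p)
    (U : TangentSpace ((𝓡 (4 * n)).prod (𝓡 2)) z) :
    locEnd (𝓡 (4 * n)) p (Q.proj z) (Q.vert D z U) = Q.piLoc D p (Q.locSection p Q.taut) z U :=
  locEnd_piCov hz Q.contMDiff_taut.contMDiffAt U

theorem vert_mem_Theta [T2Space M] (hD : Q.IsQuaternionicConnection D)
    (U : TangentSpace ((𝓡 (4 * n)).prod (𝓡 2)) z) : Q.vert D z U ∈ Q.Theta z := by
  refine ⟨piCov_mem hD Q.contMDiff_taut taut_mem U, ?_⟩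
  have hz : Q.proj z ∈ trivDom (𝓡 (4 * n)) (Q.proj z) := mem_trivDom _
  refine locEnd_injective hz ?_
  rw [map_neg, locEnd_mul hz, locEnd_mul hz, locEnd_vert hz]
  exact locCov_anticomm (eventually_locSection_taut_sq hz)
    (mdifferentiableAt_locSection hz Q.contMDiff_taut) U

theorem exists_dproj_eq (z : Q.Twistor) (x : TangentSpace (𝓡 (4 * n)) (Q.proj z)) :
    ∃ W, Q.dproj z W = x := by
  set t := Q.triv (Q.proj z)
  set σ : M → Q.Twistor := fun q ↦ t.symm (q, (t z).2)
  have hzs : z ∈ t.source := Q.mem_dom _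
  have hσz : σ (Q.proj z) = z := t.left_inv hzs
  have hσ : ContMDiffAt (𝓡 (4 * n)) ((𝓡 (4 * n)).prod (𝓡 2)) ∞ σ (Q.proj z) :=
    (contMDiffAt_triv_symm (Q.mem_dom (Q.proj z))).comp (Q.proj z)
      (contMDiffAt_id.prodMk contMDiffAt_const)
  have hid : Q.proj ∘ σ = id := rfl
  have h := mfderiv_comp (Q.proj z) (mdifferentiableAt_proj (σ (Q.proj z)))
    (hσ.mdifferentiableAt (by simp))
  rw [hid, mfderiv_id] at h
  have h' := congrArg (fun L : EuclideanSpace ℝ (Fin (4 * n)) →L[ℝ] EuclideanSpace ℝ (Fin (4 * n)) ↦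
    L x) h
  rw [← hσz]
  exact ⟨mfderiv (𝓡 (4 * n)) ((𝓡 (4 * n)).prod (𝓡 2)) σ (Q.proj z) x, h'.symm⟩

theorem inner_coord (p : M) {q : M} {A B : EndT (𝓡 (4 * n)) q} (hA : A ∈ Q.fiber q) :
    inner ℝ (Q.coord p A) (Q.coord p B) = qInner A B := by
  have h : qInner A B = ∑ i, Q.coord p A i * Q.coord p B i := by
    conv_lhs => rw [← Q.sum_coord p hA]
    rw [qInner, traceForm_comm, traceForm_sum, Finset.mul_sum]
    refine Finset.sum_congr rfl fun i _ ↦ ?_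
    change _ = _ * (-(1 / (4 * n : ℝ)) * traceForm (Q.frame p i q) B)
    rw [traceForm_comm]
    ring
  rw [h, PiLp.inner_apply]
  refine Finset.sum_congr rfl fun i _ ↦ ?_
  simp [mul_comm]

theorem qInner_eq_zero_of_anticomm {q : M} {A j : EndT (𝓡 (4 * n)) q} (h : A * j = -(j * A)) :
    qInner j A = 0 := by
  have h1 : traceForm j A = -traceForm j A := by
    conv_lhs => rw [traceForm_comm, traceForm, h]
    rw [ContinuousLinearMap.toLinearMap_neg, map_neg]
    rfl
  rw [qInner, show traceForm j A = 0 by linarith, mul_zero]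

theorem exists_velocity {E₁ E₂ E₃ : Type*} [NormedAddCommGroup E₁] [NormedSpace ℝ E₁]
    [NormedAddCommGroup E₂] [NormedSpace ℝ E₂] [NormedAddCommGroup E₃] [NormedSpace ℝ E₃]
    {H₁ H₂ H₃ : Type*} [TopologicalSpace H₁] [TopologicalSpace H₂] [TopologicalSpace H₃]
    {I₁ : ModelWithCorners ℝ E₁ H₁} {I₂ : ModelWithCorners ℝ E₂ H₂} {I₃ : ModelWithCorners ℝ E₃ H₃}
    {S N P : Type*} [TopologicalSpace S] [ChartedSpace H₁ S] [TopologicalSpace N] [ChartedSpace H₂ N]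
    [TopologicalSpace P] [ChartedSpace H₃ P] {F : Type*} [NormedAddCommGroup F] [NormedSpace ℝ F]
    {σ : S → N} {a : S} {z : N} (hσz : σ a = z) (hσ : MDifferentiableAt I₁ I₂ σ a)
    {f : N → F} (hf : MDifferentiableAt I₂ 𝓘(ℝ, F) f z) {g : N → P} (hg : MDifferentiableAt I₂ I₃ g z)
    {c : P} (hc : ∀ b, g (σ b) = c) (V : TangentSpace I₁ a) :
    ∃ W : TangentSpace I₂ z, mfderiv I₂ I₃ g z W = 0 ∧
      mvfderiv I₂ f z W = mvfderiv I₁ (fun b ↦ f (σ b)) a V := by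
  subst hσz
  refine ⟨mfderiv I₁ I₂ σ a V, ?_, (mvfderiv_comp_map hf hσ V).symm⟩
  have h := mfderiv_comp a hg hσ
  rw [show g ∘ σ = fun _ ↦ c from funext hc, mfderiv_const] at h
  exact (congrArg (fun L : E₁ →L[ℝ] E₃ ↦ L V) h).symm

theorem exists_vertical {A : EndT (𝓡 (4 * n)) (Q.proj z)} (hA : A ∈ Q.Theta z) :
    ∃ W, Q.dproj z W = 0 ∧ Q.vert D z W = A := by
  have hzq : Q.proj z ∈ trivDom (𝓡 (4 * n)) (Q.proj z) := mem_trivDom _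
  set t := Q.triv (Q.proj z)
  have hzs : z ∈ t.source := Q.mem_dom _
  set σ : Metric.sphere (0 : EuclideanSpace ℝ (Fin 3)) 1 → Q.Twistor := fun a ↦
    t.symm (Q.proj z, a)
  set a₀ := (t z).2 with ha₀
  have hσz : σ a₀ = z := t.left_inv hzs
  have hσ : MDifferentiableAt (𝓡 2) ((𝓡 (4 * n)).prod (𝓡 2)) σ a₀ :=
    ((contMDiffAt_triv_symm (Q.mem_dom (Q.proj z))).comp a₀
      (contMDiffAt_const.prodMk contMDiffAt_id)).mdifferentiableAt (by simp)
  have : Fact (Module.finrank ℝ (EuclideanSpace ℝ (Fin 3)) = 2 + 1) :=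
    ⟨finrank_euclideanSpace_fin⟩
  have horth : Q.coord (Q.proj z) A ∈ (ℝ ∙ (a₀ : EuclideanSpace ℝ (Fin 3)))ᗮ := by
    rw [Submodule.mem_orthogonal_singleton_iff_inner_right]
    exact (inner_coord (Q.proj z) (taut_mem z)).trans (qInner_eq_zero_of_anticomm hA.2)
  rw [← range_mvfderiv_subtypeVal (n := 2)] at horth
  obtain ⟨V, hV⟩ := horth
  obtain ⟨W, hW, hW'⟩ := exists_velocity hσz hσ (mdifferentiableAt_locSection hzq Q.contMDiff_taut)
    (mdifferentiableAt_proj z) (c := Q.proj z) (fun _ ↦ rfl) V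
  refine ⟨W, hW, locEnd_injective hzq ?_⟩
  let L : EuclideanSpace ℝ (Fin 3) →L[ℝ] EndF n := ∑ i, (EuclideanSpace.proj (𝕜 := ℝ) i).smulRight
    (locEnd (𝓡 (4 * n)) (Q.proj z) (Q.proj z) (Q.frame (Q.proj z) i (Q.proj z)))
  have hL : ∀ c, L c = locEnd (𝓡 (4 * n)) (Q.proj z) (Q.proj z)
      (∑ i, c i • Q.frame (Q.proj z) i (Q.proj z)) := fun c ↦ by
    simp [L, map_sum]
  have hsec : (fun a ↦ Q.locSection (Q.proj z) Q.taut (σ a)) = fun a ↦ L a.1 :=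
    funext fun a ↦ (hL a.1).symm
  have hd : MDifferentiableAt (𝓡 2) 𝓘(ℝ, EuclideanSpace ℝ (Fin 3))
      ((↑) : Metric.sphere (0 : EuclideanSpace ℝ (Fin 3)) 1 → EuclideanSpace ℝ (Fin 3)) a₀ :=
    contMDiff_coe_sphere₂.contMDiffAt.mdifferentiableAt (by simp)
  have h0 : Q.dproj z W = 0 := hW
  have hV' : mvfderiv (𝓡 2)
      ((↑) : Metric.sphere (0 : EuclideanSpace ℝ (Fin 3)) 1 → EuclideanSpace ℝ (Fin 3)) a₀ V =
      Q.coord (Q.proj z) A := hV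
  rw [locEnd_vert hzq, piLoc_eq hzq, h0, hW', hsec, mvfderiv_clm_comp L hd, hV', hL,
    Q.sum_coord _ hA.1]
  simp

variable [T2Space M]

theorem exists_dproj_vert (hD : Q.IsQuaternionicConnection D) (x : TangentSpace (𝓡 (4 * n)) (Q.proj z))
    {A : EndT (𝓡 (4 * n)) (Q.proj z)} (hA : A ∈ Q.Theta z) :
    ∃ W, Q.dproj z W = x ∧ Q.vert D z W = A := by
  obtain ⟨W, hW⟩ := exists_dproj_eq z x
  obtain ⟨W', h1, h2⟩ := exists_vertical (D := D) (sub_mem hA (vert_mem_Theta hD W))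
  exact ⟨W + W', by rw [map_add, hW, h1, add_zero], by rw [map_add, h2, add_sub_cancel]⟩

theorem taut_mul_mem_Theta {A : EndT (𝓡 (4 * n)) (Q.proj z)} (hA : A ∈ Q.Theta z) :
    Q.taut z * A ∈ Q.Theta z := by
  have hz : Q.proj z ∈ trivDom (𝓡 (4 * n)) (Q.proj z) := mem_trivDom _
  have := Q.nontrivial_model
  refine ⟨mem_fiber_of_locEnd hz ?_, by rw [mul_assoc, hA.2, mul_neg]⟩
  obtain ⟨K, hK, hK0, hKs⟩ := exists_adapted hz (taut_mem z) (taut_sq z)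
  have hA' : locEnd (𝓡 (4 * n)) (Q.proj z) (Q.proj z) A ∈ Submodule.span ℝ (Set.range K) := by
    rw [hKs]; exact locEnd_mem_locFiber hA.1
  have hA'' : locEnd (𝓡 (4 * n)) (Q.proj z) (Q.proj z) A * K 0 =
      -(K 0 * locEnd (𝓡 (4 * n)) (Q.proj z) (Q.proj z) A) := by
    rw [hK0, ← locEnd_mul hz, hA.2, map_neg, locEnd_mul hz]
  obtain ⟨a, b, hab⟩ := hK.exists_coeff_of_anticomm hA' hA''
  rw [locEnd_mul hz, ← hK0, hab, ← hKs, mul_add, mul_smul_comm, mul_smul_comm, hK.mul01, hK.mul02]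
  exact add_mem (Submodule.smul_mem _ _ (Submodule.subset_span ⟨2, rfl⟩))
    (Submodule.smul_mem _ _ (neg_mem (Submodule.subset_span ⟨1, rfl⟩)))

theorem twistorJ_spec (hD : Q.IsQuaternionicConnection D)
    (U : TangentSpace ((𝓡 (4 * n)).prod (𝓡 2)) z) :
    Q.dproj z (Q.twistorJ D z U) = Q.taut z (Q.dproj z U) ∧
      Q.vert D z (Q.twistorJ D z U) = Q.taut z * Q.vert D z U :=
  Classical.epsilon_spec (p := fun W ↦
    Q.dproj z W = Q.taut z (Q.dproj z U) ∧ Q.vert D z W = Q.taut z * Q.vert D z U)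
    (exists_dproj_vert hD _ (taut_mul_mem_Theta (vert_mem_Theta hD U)))

end AlmostQuaternionicStructure

end Quaternionic

namespace Quaternionic

namespace AlmostQuaternionicStructure

variable {n : ℕ} {M : Type*} [TopologicalSpace M] [T2Space M]
  [ChartedSpace (EuclideanSpace ℝ (Fin (4 * n))) M] [IsManifold (𝓡 (4 * n)) ∞ M]
  {Q : AlmostQuaternionicStructure n M}
  {D D₀ : CovariantDerivative (𝓡 (4 * n)) (EuclideanSpace ℝ (Fin (4 * n)))
    (TangentSpace (𝓡 (4 * n)) : M → Type _)}
  {p : M} {z : Q.Twistor} {s t : Π z : Q.Twistor, EndT (𝓡 (4 * n)) (Q.proj z)}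

theorem finrank_model : Module.finrank ℝ (EuclideanSpace ℝ (Fin (4 * n))) = 4 * n :=
  finrank_euclideanSpace_fin

/-- The complex structure of `Z` does not depend on the quaternionic connection by which it is
defined. -/
theorem vert_twistorJ (hD₀ : Q.IsQuaternionicConnection D₀) (hD : Q.IsQuaternionicConnection D)
    (U : TangentSpace ((𝓡 (4 * n)).prod (𝓡 2)) z) :
    Q.vert D z (Q.twistorJ D₀ z U) = Q.taut z * Q.vert D z U := by
  have := Q.nontrivial_model
  have hz : Q.proj z ∈ trivDom (𝓡 (4 * n)) (Q.proj z) := mem_trivDom _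
  obtain ⟨K, hK, hK0, hKs⟩ := exists_adapted hz (taut_mem z) (taut_sq z)
  obtain ⟨h1, h2⟩ := twistorJ_spec hD₀ U
  set φ := locVec (𝓡 (4 * n)) (Q.proj z) (Q.proj z)
  let S : EuclideanSpace ℝ (Fin (4 * n)) →ₗ[ℝ] EndF n :=
    (christoffel D (Q.proj z) (Q.proj z)).toLinearMap -
      (christoffel D₀ (Q.proj z) (Q.proj z)).toLinearMap
  have hS : ∀ x, S x = christoffel D (Q.proj z) (Q.proj z) x -
      christoffel D₀ (Q.proj z) (Q.proj z) x := fun _ ↦ rfl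
  have hdiff : ∀ W, locEnd (𝓡 (4 * n)) (Q.proj z) (Q.proj z) (Q.vert D z W) =
      locEnd (𝓡 (4 * n)) (Q.proj z) (Q.proj z) (Q.vert D₀ z W) +
      (S (φ (Q.dproj z W)) * K 0 - K 0 * S (φ (Q.dproj z W))) := by
    intro W
    rw [locEnd_vert hz, locEnd_vert hz, piLoc_eq hz, piLoc_eq hz, hS, hK0]
    change _ + (_ * Q.locSection (Q.proj z) Q.taut z - Q.locSection (Q.proj z) Q.taut z * _) = _ +
      ((_ - _) * Q.locSection (Q.proj z) Q.taut z - Q.locSection (Q.proj z) Q.taut z * (_ - _))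
    simp only [φ, sub_mul, mul_sub]
    abel
  have hn : ∀ x, S x * K 0 - K 0 * S x ∈ Submodule.span ℝ (Set.range K) := by
    intro x
    obtain ⟨W, hW⟩ := exists_dproj_eq z (ofLocVec (𝓡 (4 * n)) (Q.proj z) (Q.proj z) x)
    have h := hdiff W
    rw [hW, locVec_ofLocVec hz] at h
    rw [hKs, ← sub_eq_iff_eq_add'.2 h]
    exact sub_mem (locEnd_mem_locFiber (vert_mem_Theta hD W).1)
      (locEnd_mem_locFiber (vert_mem_Theta hD₀ W).1)
  have hd : 3 < Module.finrank ℝ (EuclideanSpace ℝ (Fin (4 * n))) := by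
    have := Q.two_le
    rw [finrank_model]; omega
  have hsymm : ∀ x y, S x y = S y x := fun x y ↦ by
    rw [hS, hS, sub_apply, sub_apply, christoffel_symm D hD.torsion_free hz,
      christoffel_symm D₀ hD₀.torsion_free hz]
  have hc := hK.commutator_complex_linear hd S hsymm hn (φ (Q.dproj z U))
  refine locEnd_injective hz ?_
  rw [hdiff, h1, h2, locEnd_mul hz, locEnd_mul hz, hdiff, ← locEnd_locVec hz, ← hK0, hc, mul_add]

/-- The connection `∇` in local coordinates. -/
theorem locEnd_thetaCov (hz : Q.proj z ∈ trivDom (𝓡 (4 * n)) p)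
    (hs : ContMDiff ((𝓡 (4 * n)).prod (𝓡 2)) ((𝓡 (4 * n)).prod 𝓘(ℝ, EndF n)) ∞
      (fun z ↦ TotalSpace.mk' (EndF n) (E := EndT (𝓡 (4 * n))) (Q.proj z) (s z)))
    (U : TangentSpace ((𝓡 (4 * n)).prod (𝓡 2)) z) :
    locEnd (𝓡 (4 * n)) p (Q.proj z) (Q.thetaCov D s z U) =
      projCov ((𝓡 (4 * n)).prod (𝓡 2)) (fun w ↦ christoffel D p (Q.proj w))
        (fun w ↦ extChartAt (𝓡 (4 * n)) p (Q.proj w)) (Q.locSection p Q.taut) (Q.locSection p s)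
        z U := by
  have h : Q.thetaCov D s z U =
      (1 / 2 : ℝ) • (Q.piCov D s z U + Q.taut z * Q.piCov D s z U * Q.taut z) := rfl
  rw [h, map_smul, map_add, locEnd_mul hz, locEnd_mul hz, locEnd_piCov hz hs.contMDiffAt]
  rfl

theorem thetaCov_mem (hD : Q.IsQuaternionicConnection D) (hs : Q.IsSmoothSection s)
    (U : TangentSpace ((𝓡 (4 * n)).prod (𝓡 2)) z) : Q.thetaCov D s z U ∈ Q.Theta z := by
  have hz : Q.proj z ∈ trivDom (𝓡 (4 * n)) (Q.proj z) := mem_trivDom _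
  obtain ⟨K, hK, hK0, hKs⟩ := exists_adapted hz (taut_mem z) (taut_sq z)
  have hp : locEnd (𝓡 (4 * n)) (Q.proj z) (Q.proj z) (Q.piCov D s z U) ∈
      Submodule.span ℝ (Set.range K) := by
    rw [hKs]
    exact locEnd_mem_locFiber (piCov_mem hD hs.smooth (fun w ↦ (hs.mem w).1) U)
  have e : locEnd (𝓡 (4 * n)) (Q.proj z) (Q.proj z) (Q.thetaCov D s z U) =
      antiProj (K 0) (locEnd (𝓡 (4 * n)) (Q.proj z) (Q.proj z) (Q.piCov D s z U)) := by
    rw [locEnd_thetaCov hz hs.smooth, hK0, locEnd_piCov hz hs.smooth.contMDiffAt]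
    rfl
  refine ⟨mem_fiber_of_locEnd hz ?_, locEnd_injective hz ?_⟩
  · rw [e, ← hKs]
    exact hK.antiProj_mem hp
  · rw [map_neg, locEnd_mul hz, locEnd_mul hz, e, ← hK0]
    exact antiProj_anticomm (hK.sq 0) _

theorem contMDiffAt_christoffel_proj (hD : Q.IsQuaternionicConnection D)
    (hz : Q.proj z ∈ trivDom (𝓡 (4 * n)) p) :
    ContMDiffAt ((𝓡 (4 * n)).prod (𝓡 2)) 𝓘(ℝ, EuclideanSpace ℝ (Fin (4 * n)) →L[ℝ] EndF n) ∞
      (fun w : Q.Twistor ↦ christoffel D p (Q.proj w)) z :=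
  (contMDiffAt_christoffel D hD.smooth hz).comp z Q.contMDiff_proj.contMDiffAt

theorem contMDiffAt_chart_proj (hz : Q.proj z ∈ trivDom (𝓡 (4 * n)) p) :
    ContMDiffAt ((𝓡 (4 * n)).prod (𝓡 2)) 𝓘(ℝ, EuclideanSpace ℝ (Fin (4 * n))) ∞
      (fun w : Q.Twistor ↦ extChartAt (𝓡 (4 * n)) p (Q.proj w)) z :=
  (contMDiffAt_chart hz).comp z Q.contMDiff_proj.contMDiffAt

theorem isSmoothSection_thetaCov (hD : Q.IsQuaternionicConnection D) (hs : Q.IsSmoothSection s)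
    {X : Π z : Q.Twistor, TangentSpace ((𝓡 (4 * n)).prod (𝓡 2)) z} (hX : Q.IsSmoothField X) :
    Q.IsSmoothSection fun z ↦ Q.thetaCov D s z (X z) where
  mem z := thetaCov_mem hD hs (X z)
  smooth z := by
    have hz : Q.proj z ∈ trivDom (𝓡 (4 * n)) (Q.proj z) := mem_trivDom _
    rw [contMDiffAt_locSection_iff hz]
    have hj := contMDiffAt_locSection hz Q.contMDiff_taut
    have hb := contMDiffAt_locCov (ρ := adAction _) (contMDiffAt_christoffel_proj hD hz)
      (contMDiffAt_chart_proj hz) (contMDiffAt_locSection hz hs.smooth) hX.contMDiffAt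
    have hc : ContMDiffAt ((𝓡 (4 * n)).prod (𝓡 2)) 𝓘(ℝ, ℝ) ∞ (fun _ : Q.Twistor ↦ (1 / 2 : ℝ)) z :=
      contMDiffAt_const
    have h : ContMDiffAt ((𝓡 (4 * n)).prod (𝓡 2)) 𝓘(ℝ, EndF n) ∞ _ z :=
      hc.smul (hb.add (contMDiffAt_mul (contMDiffAt_mul hj hb) hj))
    refine h.congr_of_eventuallyEq ?_
    filter_upwards [eventually_proj_mem (isOpen_trivDom _) hz] with w hw
    exact locEnd_thetaCov hw hs.smooth (X w)

theorem isSmoothSection_taut_mul (hs : Q.IsSmoothSection s) :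
    Q.IsSmoothSection fun w ↦ Q.taut w * s w where
  mem z := taut_mul_mem_Theta (hs.mem z)
  smooth z := by
    have hz : Q.proj z ∈ trivDom (𝓡 (4 * n)) (Q.proj z) := mem_trivDom _
    rw [contMDiffAt_locSection_iff hz]
    refine (contMDiffAt_mul (contMDiffAt_locSection hz Q.contMDiff_taut)
      (contMDiffAt_locSection hz hs.smooth)).congr_of_eventuallyEq ?_
    filter_upwards [eventually_proj_mem (isOpen_trivDom _) hz] with w hw
    exact locEnd_mul hw _ _

theorem thetaCov_taut_mul (hs : Q.IsSmoothSection s) (U : TangentSpace ((𝓡 (4 * n)).prod (𝓡 2)) z) :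
    Q.thetaCov D (fun w ↦ Q.taut w * s w) z U = Q.taut z * Q.thetaCov D s z U := by
  have hz : Q.proj z ∈ trivDom (𝓡 (4 * n)) (Q.proj z) := mem_trivDom _
  have h := projCov_mul (γ := fun w ↦ christoffel D (Q.proj z) (Q.proj w))
    (h := fun w ↦ extChartAt (𝓡 (4 * n)) (Q.proj z) (Q.proj w))
    (a := Q.locSection (Q.proj z) s) (eventually_locSection_taut_sq hz)
    (by
      change locEnd _ _ _ _ * locEnd _ _ _ _ = -(locEnd _ _ _ _ * locEnd _ _ _ _)
      rw [← locEnd_mul hz, (hs.mem z).2, map_neg, locEnd_mul hz])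
    (mdifferentiableAt_locSection hz Q.contMDiff_taut) (mdifferentiableAt_locSection hz hs.smooth) U
  refine locEnd_injective hz ?_
  rw [locEnd_thetaCov hz (isSmoothSection_taut_mul hs).smooth, locEnd_mul hz,
    locEnd_thetaCov hz hs.smooth]
  refine Eq.trans ?_ h
  refine congrArg (antiProj _) (locCov_congr ?_ U)
  filter_upwards [eventually_proj_mem (isOpen_trivDom _) hz] with w hw
  exact locEnd_mul hw _ _

end AlmostQuaternionicStructure

end Quaternionic

namespace Quaternionic

/-- The derivative of the trace form along a connection. -/
theorem mvfderiv_traceForm {E' : Type*} [NormedAddCommGroup E'] [NormedSpace ℝ E']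
    {H' : Type*} [TopologicalSpace H'] {I' : ModelWithCorners ℝ E' H'}
    {N : Type*} [TopologicalSpace N] [ChartedSpace H' N]
    {E : Type*} [NormedAddCommGroup E] [NormedSpace ℝ E] [FiniteDimensional ℝ E]
    {γ : N → E →L[ℝ] E →L[ℝ] E} {h : N → E} {a b : N → E →L[ℝ] E} {z : N}
    (ha : MDifferentiableAt I' 𝓘(ℝ, E →L[ℝ] E) a z)
    (hb : MDifferentiableAt I' 𝓘(ℝ, E →L[ℝ] E) b z) (U : TangentSpace I' z) :
    mvfderiv I' (fun w ↦ traceForm (a w) (b w)) z U =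
      traceForm (locCov I' (adAction E) γ h a z U) (b z) +
        traceForm (a z) (locCov I' (adAction E) γ h b z U) := by
  let τ : (E →L[ℝ] E) →L[ℝ] ℝ :=
    LinearMap.toContinuousLinearMap
      ((LinearMap.trace ℝ E) ∘ₗ (ContinuousLinearMap.coeLM ℝ : (E →L[ℝ] E) →ₗ[ℝ] (E →ₗ[ℝ] E)))
  have e1 : mvfderiv I' (fun w ↦ traceForm (a w) (b w)) z U =
      traceForm (mvfderiv I' a z U) (b z) + traceForm (a z) (mvfderiv I' b z U) := by
    refine (mvfderiv_clm_comp τ (mdifferentiableAt_mul ha hb) U).trans ?_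
    have e := mvfderiv_bilin (ContinuousLinearMap.mul ℝ (E →L[ℝ] E)) ha hb U
    exact (congrArg τ e).trans (map_add τ _ _)
  have e2 := traceForm_commutator (γ z (mvfderiv I' h z U)) (a z) (b z)
  have e3 := traceForm_commutator (γ z (mvfderiv I' h z U)) (b z) (a z)
  rw [traceForm_comm _ (a z), traceForm_sub_right _ (b z * a z)] at e3
  rw [traceForm_sub_right _ (a z * b z)] at e2
  rw [e1, locCov, locCov, adAction_apply, adAction_apply, traceForm_add_left, traceForm_add_right,
    e2, e3]
  ring

theorem traceForm_antiProj {V : Type*} [AddCommGroup V] [Module ℝ V] [TopologicalSpace V]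
    [IsTopologicalAddGroup V] [ContinuousSMul ℝ V] {j t : V →L[ℝ] V} (hj : j * j = -1)
    (ht : t * j = -(j * t)) (b : V →L[ℝ] V) : traceForm (antiProj j b) t = traceForm b t := by
  have h : traceForm (j * b * j) t = traceForm b t := by
    rw [mul_assoc, traceForm_mul_cycle, traceForm_mul_assoc]
    congr 1
    rw [ht, mul_neg, ← mul_assoc, hj]
    simp
  rw [antiProj, traceForm_smul_left, traceForm_add_left, h]
  ring

namespace AlmostQuaternionicStructure

variable {n : ℕ} {M : Type*} [TopologicalSpace M] [T2Space M]
  [ChartedSpace (EuclideanSpace ℝ (Fin (4 * n))) M] [IsManifold (𝓡 (4 * n)) ∞ M]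
  {Q : AlmostQuaternionicStructure n M}
  {D D₀ : CovariantDerivative (𝓡 (4 * n)) (EuclideanSpace ℝ (Fin (4 * n)))
    (TangentSpace (𝓡 (4 * n)) : M → Type _)}
  {p : M} {z : Q.Twistor} {s t : Π z : Q.Twistor, EndT (𝓡 (4 * n)) (Q.proj z)}

theorem qInner_thetaCov (ht : t z ∈ Q.Theta z) (U : TangentSpace ((𝓡 (4 * n)).prod (𝓡 2)) z) :
    traceForm (Q.thetaCov D s z U) (t z) = traceForm (Q.piCov D s z U) (t z) :=
  traceForm_antiProj (taut_sq z) ht.2 _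

theorem mvfderiv_traceForm_section (hs : Q.IsSmoothSection s) (ht : Q.IsSmoothSection t)
    (U : TangentSpace ((𝓡 (4 * n)).prod (𝓡 2)) z) :
    mvfderiv ((𝓡 (4 * n)).prod (𝓡 2)) (fun w ↦ traceForm (s w) (t w)) z U =
      traceForm (Q.thetaCov D s z U) (t z) + traceForm (s z) (Q.thetaCov D t z U) := by
  have hz : Q.proj z ∈ trivDom (𝓡 (4 * n)) (Q.proj z) := mem_trivDom _
  have h := mvfderiv_traceForm (γ := fun w ↦ christoffel D (Q.proj z) (Q.proj w))
    (h := fun w ↦ extChartAt (𝓡 (4 * n)) (Q.proj z) (Q.proj w))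
    (mdifferentiableAt_locSection hz hs.smooth) (mdifferentiableAt_locSection hz ht.smooth) U
  rw [qInner_thetaCov (ht.mem z), traceForm_comm (s z), qInner_thetaCov (hs.mem z),
    ← traceForm_locEnd hz, ← traceForm_locEnd hz (Q.piCov D t z U),
    locEnd_piCov hz hs.smooth.contMDiffAt, locEnd_piCov hz ht.smooth.contMDiffAt,
    traceForm_comm _ (locEnd _ _ _ (s z))]
  refine Eq.trans ?_ h
  rw [mvfderiv_congr_of_eventuallyEq]
  filter_upwards [eventually_proj_mem (isOpen_trivDom _) hz] with w hw
  exact (traceForm_locEnd hw _ _).symm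

theorem mdifferentiableAt_qInner (hs : Q.IsSmoothSection s) (ht : Q.IsSmoothSection t) :
    MDifferentiableAt ((𝓡 (4 * n)).prod (𝓡 2)) 𝓘(ℝ, ℝ) (fun w ↦ qInner (s w) (t w)) z := by
  have h : ContMDiffAt ((𝓡 (4 * n)).prod (𝓡 2)) 𝓘(ℝ, ℝ) ∞ (fun w ↦ qInner (s w) (t w)) z := by
    rw [← contMDiffWithinAt_univ]
    exact contMDiffWithinAt_qInner (f := Q.proj) hs.smooth.contMDiffAt ht.smooth.contMDiffAt
  exact h.mdifferentiableAt (by simp)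

theorem mdifferentiableAt_traceForm (hs : Q.IsSmoothSection s) (ht : Q.IsSmoothSection t) :
    MDifferentiableAt ((𝓡 (4 * n)).prod (𝓡 2)) 𝓘(ℝ, ℝ) (fun w ↦ traceForm (s w) (t w)) z := by
  have h : ContMDiffAt ((𝓡 (4 * n)).prod (𝓡 2)) 𝓘(ℝ, ℝ) ∞ (fun w ↦ traceForm (s w) (t w)) z := by
    rw [← contMDiffWithinAt_univ]
    exact contMDiffWithinAt_traceForm (f := Q.proj) hs.smooth.contMDiffAt ht.smooth.contMDiffAt
  exact h.mdifferentiableAt (by simp)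

theorem mvfderiv_qInner (hs : Q.IsSmoothSection s) (ht : Q.IsSmoothSection t)
    (U : TangentSpace ((𝓡 (4 * n)).prod (𝓡 2)) z) :
    mvfderiv ((𝓡 (4 * n)).prod (𝓡 2)) (fun w ↦ qInner (s w) (t w)) z U =
      qInner (Q.thetaCov D s z U) (t z) + qInner (s z) (Q.thetaCov D t z U) := by
  have h := mvfderiv_clm_comp (-(1 / (4 * n : ℝ)) • ContinuousLinearMap.id ℝ ℝ)
    (mdifferentiableAt_traceForm hs ht) U
  rw [mvfderiv_traceForm_section (D := D) hs ht] at h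
  exact h.trans (mul_add _ _ _)

theorem mvfderiv_herm (hs : Q.IsSmoothSection s) (ht : Q.IsSmoothSection t)
    (U : TangentSpace ((𝓡 (4 * n)).prod (𝓡 2)) z) :
    mvfderiv ((𝓡 (4 * n)).prod (𝓡 2)) (fun w ↦ Q.herm w (s w) (t w)) z U =
      Q.herm z (Q.thetaCov D s z U) (t z) + Q.herm z (s z) (Q.thetaCov D t z U) := by
  have hjs := isSmoothSection_taut_mul hs
  let L₁ : ℝ →L[ℝ] ℂ := (1 / 2 : ℂ) • Complex.ofRealCLM
  let L₂ : ℝ →L[ℝ] ℂ := (-(1 / 2) * Complex.I : ℂ) • Complex.ofRealCLM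
  have e : (fun w ↦ Q.herm w (s w) (t w)) =
      fun w ↦ L₁ (qInner (s w) (t w)) + L₂ (qInner (Q.taut w * s w) (t w)) := by
    funext w
    simp only [herm, L₁, L₂, smul_apply, Complex.ofRealCLM_apply, smul_eq_mul]
    ring
  rw [e, mvfderiv_fun_add (mdifferentiableAt_clm_comp L₁ (mdifferentiableAt_qInner hs ht))
    (mdifferentiableAt_clm_comp L₂ (mdifferentiableAt_qInner hjs ht)), add_apply,
    mvfderiv_clm_comp L₁ (mdifferentiableAt_qInner hs ht),
    mvfderiv_clm_comp L₂ (mdifferentiableAt_qInner hjs ht), mvfderiv_qInner (D := D) hs ht,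
    mvfderiv_qInner (D := D) hjs ht, thetaCov_taut_mul hs]
  simp only [herm, L₁, L₂, smul_apply, Complex.ofRealCLM_apply, smul_eq_mul, Complex.ofReal_add]
  ring

theorem isHermitianConnection_thetaCov (hD : Q.IsQuaternionicConnection D) :
    Q.IsHermitianConnection (Q.thetaCov D) where
  smooth _ _ hs hX := isSmoothSection_thetaCov hD hs hX
  add s t hs ht z U := by
    have hz : Q.proj z ∈ trivDom (𝓡 (4 * n)) (Q.proj z) := mem_trivDom _
    have hst : ContMDiff ((𝓡 (4 * n)).prod (𝓡 2)) ((𝓡 (4 * n)).prod 𝓘(ℝ, EndF n)) ∞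
        (fun z ↦ TotalSpace.mk' (EndF n) (E := EndT (𝓡 (4 * n))) (Q.proj z) ((s + t) z)) := by
      intro w
      have hw : Q.proj w ∈ trivDom (𝓡 (4 * n)) (Q.proj w) := mem_trivDom _
      rw [contMDiffAt_locSection_iff hw]
      refine ((contMDiffAt_locSection hw hs.smooth).add
        (contMDiffAt_locSection hw ht.smooth)).congr_of_eventuallyEq ?_
      exact Filter.Eventually.of_forall fun w ↦ map_add _ _ _
    refine locEnd_injective hz ?_
    rw [map_add, locEnd_thetaCov hz hst, locEnd_thetaCov hz hs.smooth, locEnd_thetaCov hz ht.smooth,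
      projCov, projCov, projCov, ← antiProj_add, ← locCov_add (mdifferentiableAt_locSection hz hs.smooth)
      (mdifferentiableAt_locSection hz ht.smooth)]
    refine congrArg (antiProj _) (locCov_congr ?_ U)
    exact Filter.Eventually.of_forall fun w ↦ map_add _ _ _
  leibniz f s hf hs z U := by
    have hz : Q.proj z ∈ trivDom (𝓡 (4 * n)) (Q.proj z) := mem_trivDom _
    have hfs : ContMDiff ((𝓡 (4 * n)).prod (𝓡 2)) ((𝓡 (4 * n)).prod 𝓘(ℝ, EndF n)) ∞
        (fun z ↦ TotalSpace.mk' (EndF n) (E := EndT (𝓡 (4 * n))) (Q.proj z) (f z • s z)) := by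
      intro w
      have hw : Q.proj w ∈ trivDom (𝓡 (4 * n)) (Q.proj w) := mem_trivDom _
      refine (contMDiffAt_locSection_iff (s := fun z ↦ f z • s z) hw).2 ?_
      refine (hf.contMDiffAt.smul
        (contMDiffAt_locSection hw hs.smooth)).congr_of_eventuallyEq ?_
      exact Filter.Eventually.of_forall fun w ↦ map_smul _ _ _
    have hsz : antiProj (Q.locSection (Q.proj z) Q.taut z) (Q.locSection (Q.proj z) s z) =
        Q.locSection (Q.proj z) s z := by
      refine antiProj_of_anticomm (locSection_taut_sq hz) ?_
      change locEnd _ _ _ _ * locEnd _ _ _ _ = -(locEnd _ _ _ _ * locEnd _ _ _ _)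
      rw [← locEnd_mul hz, (hs.mem z).2, map_neg, locEnd_mul hz]
    refine locEnd_injective hz ?_
    rw [map_add, map_smul, map_smul, locEnd_thetaCov hz hfs, locEnd_thetaCov hz hs.smooth]
    have h := locCov_smul (ρ := adAction _) (γ := fun w ↦ christoffel D (Q.proj z) (Q.proj w))
      (h := fun w ↦ extChartAt (𝓡 (4 * n)) (Q.proj z) (Q.proj w))
      (hf.contMDiffAt.mdifferentiableAt (by simp))
      (mdifferentiableAt_locSection hz hs.smooth) U
    have h' := congrArg (antiProj (Q.locSection (Q.proj z) Q.taut z)) h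
    rw [antiProj_add, antiProj_smul, antiProj_smul, hsz] at h'
    refine Eq.trans ?_ h'
    refine congrArg (antiProj _) (locCov_congr ?_ U)
    exact Filter.Eventually.of_forall fun w ↦ map_smul _ _ _
  complex_linear _ hs _ U := thetaCov_taut_mul hs U
  metric _ _ hs ht _ U := mvfderiv_herm hs ht U

set_option maxHeartbeats 1000000 in
/-- The curvature of `∇`. -/
theorem locEnd_curvature (hD : Q.IsQuaternionicConnection D) (hs : Q.IsSmoothSection s)
    {X Y : Π z : Q.Twistor, TangentSpace ((𝓡 (4 * n)).prod (𝓡 2)) z} (hX : Q.IsSmoothField X)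
    (hY : Q.IsSmoothField Y) {K : Fin 3 → EndF n} (hK : IsQuaternionTriple K)
    (hK0 : K 0 = locEnd (𝓡 (4 * n)) (Q.proj z) (Q.proj z) (Q.taut z))
    (hKs : Submodule.span ℝ (Set.range K) = Q.locFiber (Q.proj z) (Q.proj z)) :
    locEnd (𝓡 (4 * n)) (Q.proj z) (Q.proj z) (Q.curvature (Q.thetaCov D) X Y s z) =
      (2 * tripleCoeff K (curvForm D (Q.proj z)
        (locVec (𝓡 (4 * n)) (Q.proj z) (Q.proj z) (Q.dproj z (X z)))
        (locVec (𝓡 (4 * n)) (Q.proj z) (Q.proj z) (Q.dproj z (Y z)))) 0) •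
        (K 0 * locEnd (𝓡 (4 * n)) (Q.proj z) (Q.proj z) (s z)) -
      (1 / 4 : ℝ) • vertTerm (locEnd (𝓡 (4 * n)) (Q.proj z) (Q.proj z) (s z))
        (locEnd (𝓡 (4 * n)) (Q.proj z) (Q.proj z) (Q.vert D z (X z)))
        (locEnd (𝓡 (4 * n)) (Q.proj z) (Q.proj z) (Q.vert D z (Y z))) := by
  have := Q.nontrivial_model
  have hz : Q.proj z ∈ trivDom (𝓡 (4 * n)) (Q.proj z) := mem_trivDom _
  have hev : ∀ᶠ w in 𝓝 z, Q.locSection (Q.proj z) s w * Q.locSection (Q.proj z) Q.taut w =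
      -(Q.locSection (Q.proj z) Q.taut w * Q.locSection (Q.proj z) s w) := by
    filter_upwards [eventually_proj_mem (isOpen_trivDom _) hz] with w hw
    change locEnd _ _ _ _ * locEnd _ _ _ _ = -(locEnd _ _ _ _ * locEnd _ _ _ _)
    rw [← locEnd_mul hw, (hs.mem w).2, map_neg, locEnd_mul hw]
  have h := projCov_commutator (contMDiffAt_christoffel_proj hD hz) (contMDiffAt_chart_proj hz)
    (contMDiffAt_locSection hz Q.contMDiff_taut) (contMDiffAt_locSection hz hs.smooth)
    (eventually_locSection_taut_sq hz) hev hX.contMDiffAt hY.contMDiffAt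
  have hΓ := (contMDiffAt_christoffel D hD.smooth hz).mdifferentiableAt
    (by simp : (∞ : WithTop ℕ∞) ≠ 0)
  have hcurv : locCurv ((𝓡 (4 * n)).prod (𝓡 2)) (fun w ↦ christoffel D (Q.proj z) (Q.proj w))
      (fun w ↦ extChartAt (𝓡 (4 * n)) (Q.proj z) (Q.proj w)) z (X z) (Y z) =
      curvForm D (Q.proj z) (locVec (𝓡 (4 * n)) (Q.proj z) (Q.proj z) (Q.dproj z (X z)))
        (locVec (𝓡 (4 * n)) (Q.proj z) (Q.proj z) (Q.dproj z (Y z))) := by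
    rw [curvForm_locVec, locCurv, locCurv, mvfderiv_chart_proj hz, mvfderiv_chart_proj hz,
      mvfderiv_comp_proj hΓ, mvfderiv_comp_proj hΓ, mvfderiv_chart hz, mvfderiv_chart hz]
  have hkey : ∀ {A B : Π z : Q.Twistor, TangentSpace ((𝓡 (4 * n)).prod (𝓡 2)) z},
      Q.IsSmoothField B → locEnd (𝓡 (4 * n)) (Q.proj z) (Q.proj z)
        (Q.thetaCov D (fun w ↦ Q.thetaCov D s w (B w)) z (A z)) =
      projCov ((𝓡 (4 * n)).prod (𝓡 2)) (fun w ↦ christoffel D (Q.proj z) (Q.proj w))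
        (fun w ↦ extChartAt (𝓡 (4 * n)) (Q.proj z) (Q.proj w)) (Q.locSection (Q.proj z) Q.taut)
        (fun w ↦ projCov ((𝓡 (4 * n)).prod (𝓡 2)) (fun w ↦ christoffel D (Q.proj z) (Q.proj w))
          (fun w ↦ extChartAt (𝓡 (4 * n)) (Q.proj z) (Q.proj w)) (Q.locSection (Q.proj z) Q.taut)
          (Q.locSection (Q.proj z) s) w (B w)) z (A z) := by
    intro A B hB
    rw [locEnd_thetaCov hz (isSmoothSection_thetaCov hD hs hB).smooth]
    refine congrArg (antiProj _) (locCov_congr ?_ _)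
    filter_upwards [eventually_proj_mem (isOpen_trivDom _) hz] with w hw
    exact locEnd_thetaCov hw hs.smooth (B w)
  rw [curvature, map_sub, map_sub, hkey hY, hkey hX, locEnd_thetaCov hz hs.smooth, h, hcurv]
  have hR := isQuaternionicCurvature_curvForm hD (Q.proj z) hKs
  have hsK : locEnd (𝓡 (4 * n)) (Q.proj z) (Q.proj z) (s z) ∈ Submodule.span ℝ (Set.range K) := by
    rw [hKs]; exact locEnd_mem_locFiber (hs.mem z).1
  have hanti : locEnd (𝓡 (4 * n)) (Q.proj z) (Q.proj z) (s z) * K 0 =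
      -(K 0 * locEnd (𝓡 (4 * n)) (Q.proj z) (Q.proj z) (s z)) := by
    rw [hK0]; exact hev.self_of_nhds
  rw [← hK.antiProj_commutator (hR.normalizes _ _) hsK hanti, hK0, locEnd_vert hz, locEnd_vert hz]
  rfl

end AlmostQuaternionicStructure

end Quaternionic

namespace Quaternionic

theorem exists_smooth_field {E : Type*} [NormedAddCommGroup E] [NormedSpace ℝ E]
    [FiniteDimensional ℝ E] {H : Type*} [TopologicalSpace H] (I : ModelWithCorners ℝ E H)
    {M : Type*} [TopologicalSpace M] [T2Space M] [ChartedSpace H M] [IsManifold I ∞ M]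
    (p : M) (x : TangentSpace I p) : ∃ X : Π q : M, TangentSpace I q,
      ContMDiff I I.tangent ∞ (fun q ↦ (⟨q, X q⟩ : TangentBundle I M)) ∧ X p = x := by
  obtain ⟨f, hf, -, hs⟩ := exists_global_section I E (isOpen_trivDom p) (mem_trivDom p)
    (s := fun w ↦ ofLocVec I p w (locVec I p p x))
    (fun w hw ↦ (contMDiffAt_ofLocVec hw _).contMDiffWithinAt)
  refine ⟨_, hs, ?_⟩
  simp [hf.self_of_nhds, mem_trivDom]

namespace AlmostQuaternionicStructure

variable {n : ℕ} {M : Type*} [TopologicalSpace M] [T2Space M]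
  [ChartedSpace (EuclideanSpace ℝ (Fin (4 * n))) M] [IsManifold (𝓡 (4 * n)) ∞ M]
  {Q : AlmostQuaternionicStructure n M}
  {D₀ D : CovariantDerivative (𝓡 (4 * n)) (EuclideanSpace ℝ (Fin (4 * n)))
    (TangentSpace (𝓡 (4 * n)) : M → Type _)}
  {z : Q.Twistor} {s : Π z : Q.Twistor, EndT (𝓡 (4 * n)) (Q.proj z)}

theorem locEnd_projTheta {p : M} (hz : Q.proj z ∈ trivDom (𝓡 (4 * n)) p)
    (A : EndT (𝓡 (4 * n)) (Q.proj z)) :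
    locEnd (𝓡 (4 * n)) p (Q.proj z) (Q.projTheta z A) =
      antiProj (locEnd (𝓡 (4 * n)) p (Q.proj z) (Q.taut z))
        (locEnd (𝓡 (4 * n)) p (Q.proj z) A) := by
  rw [antiProj, ← locEnd_mul hz, ← locEnd_mul hz, ← map_add, ← map_smul]
  rfl

theorem projTheta_mem {A : EndT (𝓡 (4 * n)) (Q.proj z)} (hA : A ∈ Q.fiber (Q.proj z)) :
    Q.projTheta z A ∈ Q.Theta z := by
  have hz : Q.proj z ∈ trivDom (𝓡 (4 * n)) (Q.proj z) := mem_trivDom _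
  obtain ⟨K, hK, hK0, hKs⟩ := exists_adapted hz (taut_mem z) (taut_sq z)
  refine ⟨mem_fiber_of_locEnd hz ?_, locEnd_injective hz ?_⟩
  · rw [locEnd_projTheta hz, ← hK0, ← hKs]
    exact hK.antiProj_mem (by rw [hKs]; exact locEnd_mem_locFiber hA)
  · rw [map_neg, locEnd_mul hz, locEnd_mul hz, locEnd_projTheta hz, ← hK0]
    exact antiProj_anticomm (hK.sq 0) _

/-- Every element of `Θ_z` is the value of a smooth section of `Θ`. -/
theorem exists_smooth_section {A : EndT (𝓡 (4 * n)) (Q.proj z)} (hA : A ∈ Q.Theta z) :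
    ∃ s, Q.IsSmoothSection s ∧ s z = A := by
  obtain ⟨f, hf, hf0, hs⟩ := exists_global_section (𝓡 (4 * n)) (EndF n) (Q.isOpen_dom (Q.proj z))
    (Q.mem_dom (Q.proj z))
    (s := fun q ↦ ∑ i, Q.coord (Q.proj z) A i • Q.frame (Q.proj z) i q)
    (Q.contMDiffOn_sum_frame (Q.proj z) (f := id) (a := fun _ ↦ Q.coord (Q.proj z) A)
      contMDiffOn_id (fun q hq ↦ hq) (fun i ↦ contMDiffOn_const))
  set B : Π q : M, EndT (𝓡 (4 * n)) q :=
    f • fun q ↦ ∑ i, Q.coord (Q.proj z) A i • Q.frame (Q.proj z) i q with hB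
  have hBQ : ∀ q, B q ∈ Q.fiber q := fun q ↦ by
    refine Submodule.smul_mem _ _ ?_
    rw [Q.fiber_eq (Q.proj z) q]
    exact Submodule.sum_mem _ fun i _ ↦ Submodule.smul_mem _ _ (Submodule.subset_span ⟨i, rfl⟩)
  have hBz : B (Q.proj z) = A := by
    have : f (Q.proj z) = 1 := hf.self_of_nhds
    change f (Q.proj z) • _ = A
    rw [this, one_smul]
    exact Q.sum_coord _ hA.1
  refine ⟨fun w ↦ Q.projTheta w (B (Q.proj w)), ⟨fun w ↦ projTheta_mem (hBQ _), fun w ↦ ?_⟩, ?_⟩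
  · have hw : Q.proj w ∈ trivDom (𝓡 (4 * n)) (Q.proj w) := mem_trivDom _
    rw [contMDiffAt_locSection_iff hw]
    have hj := contMDiffAt_locSection hw Q.contMDiff_taut
    have hb := ((contMDiffAt_end_iff (f := id) hw).1 hs.contMDiffAt).2.comp w
      Q.contMDiff_proj.contMDiffAt
    have hc : ContMDiffAt ((𝓡 (4 * n)).prod (𝓡 2)) 𝓘(ℝ, ℝ) ∞ (fun _ : Q.Twistor ↦ (1 / 2 : ℝ)) w :=
      contMDiffAt_const
    have h : ContMDiffAt ((𝓡 (4 * n)).prod (𝓡 2)) 𝓘(ℝ, EndF n) ∞ _ w :=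
      hc.smul (hb.add (contMDiffAt_mul (contMDiffAt_mul hj hb) hj))
    refine h.congr_of_eventuallyEq ?_
    filter_upwards [eventually_proj_mem (isOpen_trivDom _) hw] with y hy
    exact locEnd_projTheta hy _
  · have hz : Q.proj z ∈ trivDom (𝓡 (4 * n)) (Q.proj z) := mem_trivDom _
    refine locEnd_injective hz ?_
    change locEnd _ _ _ (Q.projTheta z (B (Q.proj z))) = _
    rw [hBz, locEnd_projTheta hz, antiProj_of_anticomm]
    · rw [← locEnd_mul hz, taut_sq, map_neg, locEnd_one hz]
    · rw [← locEnd_mul hz, hA.2, map_neg, locEnd_mul hz]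

/-- The failure of the curvature of `∇` to be of type `(1,1)`. -/
theorem locEnd_curvature_sub (hD₀ : Q.IsQuaternionicConnection D₀)
    (hD : Q.IsQuaternionicConnection D) (hs : Q.IsSmoothSection s)
    {X Y X' Y' : Π z : Q.Twistor, TangentSpace ((𝓡 (4 * n)).prod (𝓡 2)) z} (hX : Q.IsSmoothField X)
    (hY : Q.IsSmoothField Y) (hX' : Q.IsSmoothField X') (hY' : Q.IsSmoothField Y')
    (hXX : X' z = Q.twistorJ D₀ z (X z)) (hYY : Y' z = Q.twistorJ D₀ z (Y z))
    {K : Fin 3 → EndF n} (hK : IsQuaternionTriple K)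
    (hK0 : K 0 = locEnd (𝓡 (4 * n)) (Q.proj z) (Q.proj z) (Q.taut z))
    (hKs : Submodule.span ℝ (Set.range K) = Q.locFiber (Q.proj z) (Q.proj z)) :
    locEnd (𝓡 (4 * n)) (Q.proj z) (Q.proj z) (Q.curvature (Q.thetaCov D) X' Y' s z -
        Q.curvature (Q.thetaCov D) X Y s z) =
      (2 * (tripleCoeff K (curvForm D (Q.proj z)
        (K 0 (locVec (𝓡 (4 * n)) (Q.proj z) (Q.proj z) (Q.dproj z (X z))))
        (K 0 (locVec (𝓡 (4 * n)) (Q.proj z) (Q.proj z) (Q.dproj z (Y z))))) 0 -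
      tripleCoeff K (curvForm D (Q.proj z)
        (locVec (𝓡 (4 * n)) (Q.proj z) (Q.proj z) (Q.dproj z (X z)))
        (locVec (𝓡 (4 * n)) (Q.proj z) (Q.proj z) (Q.dproj z (Y z)))) 0)) •
        (K 0 * locEnd (𝓡 (4 * n)) (Q.proj z) (Q.proj z) (s z)) := by
  have := Q.nontrivial_model
  have hz : Q.proj z ∈ trivDom (𝓡 (4 * n)) (Q.proj z) := mem_trivDom _
  have hmem : ∀ {A}, A ∈ Q.Theta z → locEnd (𝓡 (4 * n)) (Q.proj z) (Q.proj z) A ∈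
      Submodule.span ℝ (Set.range K) := fun hA ↦ by
    rw [hKs]; exact locEnd_mem_locFiber hA.1
  have hanti : ∀ {A}, A ∈ Q.Theta z → locEnd (𝓡 (4 * n)) (Q.proj z) (Q.proj z) A * K 0 =
      -(K 0 * locEnd (𝓡 (4 * n)) (Q.proj z) (Q.proj z) A) := fun hA ↦ by
    rw [hK0, ← locEnd_mul hz, hA.2, map_neg, locEnd_mul hz]
  have hvX := vert_mem_Theta hD (X z)
  have hvY := vert_mem_Theta hD (Y z)
  rw [map_sub, locEnd_curvature hD hs hX' hY' hK hK0 hKs, locEnd_curvature hD hs hX hY hK hK0 hKs,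
    hXX, hYY, vert_twistorJ hD₀ hD, vert_twistorJ hD₀ hD, (twistorJ_spec hD₀ (X z)).1,
    (twistorJ_spec hD₀ (Y z)).1, ← locEnd_locVec hz, ← locEnd_locVec hz, locEnd_mul hz,
    locEnd_mul hz, ← hK0, hK.vertTerm_complex (hmem (hs.mem z)) (hanti (hs.mem z)) (hmem hvX)
    (hanti hvX) (hmem hvY) (hanti hvY)]
  module

/-- `∇` is a Chern connection if and only if the trace of the curvature of `D` is `Q`-hermitian. -/
theorem isChernConnection_thetaCov_iff (hD₀ : Q.IsQuaternionicConnection D₀)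
    (hD : Q.IsQuaternionicConnection D) :
    Q.IsChernConnection (Q.thetaCov D) (Q.twistorJ D₀) ↔
      ∀ (p : M) (j : EndT (𝓡 (4 * n)) p), j ∈ Q.fiber p → j * j = -1 →
      ∀ x y : EuclideanSpace ℝ (Fin (4 * n)),
        LinearMap.trace ℝ (EuclideanSpace ℝ (Fin (4 * n)))
          (curvForm D p (locEnd (𝓡 (4 * n)) p p j x) (locEnd (𝓡 (4 * n)) p p j y)).toLinearMap =
        LinearMap.trace ℝ (EuclideanSpace ℝ (Fin (4 * n))) (curvForm D p x y).toLinearMap := by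
  have := Q.nontrivial_model
  have hd : 4 < Module.finrank ℝ (EuclideanSpace ℝ (Fin (4 * n))) := by
    have := Q.two_le
    rw [finrank_model]; omega
  constructor
  · rintro ⟨-, h⟩ p j hj hj2
    obtain ⟨z, rfl, hjz⟩ : ∃ z : Q.Twistor, ∃ e : Q.proj z = p, HEq (Q.taut z) j :=
      ⟨⟨⟨p, j⟩, hj, hj2⟩, rfl, HEq.rfl⟩
    obtain rfl := eq_of_heq hjz
    have hz : Q.proj z ∈ trivDom (𝓡 (4 * n)) (Q.proj z) := mem_trivDom _
    obtain ⟨K, hK, hK0, hKs⟩ := exists_adapted hz (taut_mem z) (taut_sq z)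
    have hR := isQuaternionicCurvature_curvForm hD (Q.proj z) hKs
    rw [← hK0]
    refine (hR.tripleCoeff_invariant_iff hd hK).1 fun x y ↦ ?_
    obtain ⟨A, hA⟩ := locEnd_surjective hz (K 1)
    have hAΘ : A ∈ Q.Theta z := by
      refine ⟨mem_fiber_of_locEnd hz ?_, locEnd_injective hz ?_⟩
      · rw [hA, ← hKs]; exact Submodule.subset_span ⟨1, rfl⟩
      · rw [map_neg, locEnd_mul hz, locEnd_mul hz, hA, ← hK0, hK.anti01]
    obtain ⟨s, hs, hsz⟩ := exists_smooth_section hAΘ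
    obtain ⟨u, hu⟩ := exists_dproj_eq z (ofLocVec (𝓡 (4 * n)) (Q.proj z) (Q.proj z) x)
    obtain ⟨v, hv⟩ := exists_dproj_eq z (ofLocVec (𝓡 (4 * n)) (Q.proj z) (Q.proj z) y)
    obtain ⟨X, hX, rfl⟩ := exists_smooth_field ((𝓡 (4 * n)).prod (𝓡 2)) z u
    obtain ⟨Y, hY, rfl⟩ := exists_smooth_field ((𝓡 (4 * n)).prod (𝓡 2)) z v
    obtain ⟨X', hX', hXX⟩ := exists_smooth_field ((𝓡 (4 * n)).prod (𝓡 2)) z (Q.twistorJ D₀ z (X z))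
    obtain ⟨Y', hY', hYY⟩ := exists_smooth_field ((𝓡 (4 * n)).prod (𝓡 2)) z (Q.twistorJ D₀ z (Y z))
    have h1 := locEnd_curvature_sub hD₀ hD hs hX hY hX' hY' hXX hYY hK hK0 hKs
    rw [h X Y X' Y' hX hY hX' hY' s hs z hXX hYY, sub_self, map_zero, hu, hv, locVec_ofLocVec hz,
      locVec_ofLocVec hz, hsz, hA, hK.mul] at h1
    have h2 : K 2 ≠ 0 := fun h0 ↦ by
      have := hK.sq 2
      rw [h0, zero_mul] at this
      exact one_ne_zero (neg_eq_zero.1 this.symm)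
    have h3 := (smul_eq_zero.1 h1.symm).resolve_right h2
    linarith
  · intro h
    refine ⟨isHermitianConnection_thetaCov hD, ?_⟩
    intro X Y X' Y' hX hY hX' hY' s hs z hXX hYY
    have hz : Q.proj z ∈ trivDom (𝓡 (4 * n)) (Q.proj z) := mem_trivDom _
    obtain ⟨K, hK, hK0, hKs⟩ := exists_adapted hz (taut_mem z) (taut_sq z)
    have hR := isQuaternionicCurvature_curvForm hD (Q.proj z) hKs
    have h0 := h (Q.proj z) (Q.taut z) (taut_mem z) (taut_sq z)
    rw [← hK0] at h0
    have h1 := (hR.tripleCoeff_invariant_iff hd hK).2 h0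
    refine sub_eq_zero.1 (locEnd_injective hz ?_)
    rw [locEnd_curvature_sub hD₀ hD hs hX hY hX' hY' hXX hYY hK hK0 hKs, h1]
    simp

end AlmostQuaternionicStructure

end Quaternionic

namespace Quaternionic

theorem mvfderiv_fun_sum {E' : Type*} [NormedAddCommGroup E'] [NormedSpace ℝ E']
    {H' : Type*} [TopologicalSpace H'] {I' : ModelWithCorners ℝ E' H'}
    {N : Type*} [TopologicalSpace N] [ChartedSpace H' N] {F : Type*} [NormedAddCommGroup F]
    [NormedSpace ℝ F] {ι : Type} [Fintype ι] {f : ι → N → F} {z : N}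
    (hf : ∀ i, MDifferentiableAt I' 𝓘(ℝ, F) (f i) z) (U : TangentSpace I' z) :
    mvfderiv I' (fun w ↦ ∑ i, f i w) z U = ∑ i, mvfderiv I' (f i) z U := by
  have h : HasMFDerivAt I' 𝓘(ℝ, F) (∑ i, f i) z
      (∑ i, (show E' →L[ℝ] F from mvfderiv I' (f i) z)) :=
    HasMFDerivAt.sum (t := Finset.univ) fun i _ ↦ (hf i).hasMFDerivAt
  rw [show (fun w ↦ ∑ i, f i w) = ∑ i, f i by ext w; simp]
  have h' := congrArg (fun L : E' →L[ℝ] F ↦ L U) h.mfderiv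
  refine h'.trans ?_
  exact map_sum (ContinuousLinearMap.apply ℝ F (show E' from U)) _ _

namespace AlmostQuaternionicStructure

variable {n : ℕ} {M : Type*} [TopologicalSpace M] [T2Space M]
  [ChartedSpace (EuclideanSpace ℝ (Fin (4 * n))) M] [IsManifold (𝓡 (4 * n)) ∞ M]
  {D : CovariantDerivative (𝓡 (4 * n)) (EuclideanSpace ℝ (Fin (4 * n)))
    (TangentSpace (𝓡 (4 * n)) : M → Type _)}

theorem isSmoothFieldBase_covariantDerivative (hD : D.ContMDiffCovariantDerivative ∞)
    {V X : Π p : M, TangentSpace (𝓡 (4 * n)) p} (hV : IsSmoothFieldBase V)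
    (hX : IsSmoothFieldBase X) : IsSmoothFieldBase fun q ↦ D V q (X q) := by
  intro q
  have h := hD.contMDiff.contMDiff (hV.contMDiffOn (s := Set.univ))
  exact (h.contMDiffAt Filter.univ_mem).clm_bundle_apply hX.contMDiffAt

theorem formOnFields_update {k : ℕ} (η : Π p : M, TangentSpace (𝓡 (4 * n)) p [⋀^Fin k]→ₗ[ℝ] ℝ)
    (V : Fin k → Π p : M, TangentSpace (𝓡 (4 * n)) p) (i : Fin k)
    (W : Π p : M, TangentSpace (𝓡 (4 * n)) p) (p : M) :
    formOnFields η (Function.update V i W) p = η p (Function.update (fun j ↦ V j p) i (W p)) := by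
  refine congrArg (η p) (funext fun j ↦ ?_)
  by_cases h : j = i
  · subst h; simp
  · simp [h]

theorem isSmoothFieldBase_update {k : ℕ} {V : Fin k → Π p : M, TangentSpace (𝓡 (4 * n)) p}
    (hV : ∀ i, IsSmoothFieldBase (V i)) (i : Fin k) {W : Π p : M, TangentSpace (𝓡 (4 * n)) p}
    (hW : IsSmoothFieldBase W) (j : Fin k) : IsSmoothFieldBase (Function.update V i W j) := by
  by_cases h : j = i
  · subst h; simpa using hW
  · simpa [h] using hV j

/-- The second covariant derivative of a differential form. -/
theorem formCov_formCov {k : ℕ} (hD : D.ContMDiffCovariantDerivative ∞)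
    {η : Π p : M, TangentSpace (𝓡 (4 * n)) p [⋀^Fin k]→ₗ[ℝ] ℝ} (hη : IsSmoothForm η)
    {X Y : Π p : M, TangentSpace (𝓡 (4 * n)) p} (hX : IsSmoothFieldBase X)
    (hY : IsSmoothFieldBase Y) {V : Fin k → Π p : M, TangentSpace (𝓡 (4 * n)) p}
    (hV : ∀ i, IsSmoothFieldBase (V i)) (p : M) :
    formCov D X (formCov D Y (formOnFields η)) V p =
      mvfderiv (𝓡 (4 * n)) (fun q ↦ mvfderiv (𝓡 (4 * n)) (formOnFields η V) q (Y q)) p (X p) -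
      ∑ i, mvfderiv (𝓡 (4 * n))
        (formOnFields η (Function.update V i fun q ↦ D (V i) q (Y q))) p (X p) -
      ∑ i, mvfderiv (𝓡 (4 * n))
        (formOnFields η (Function.update V i fun q ↦ D (V i) q (X q))) p (Y p) +
      ∑ i, η p (Function.update (fun j ↦ V j p) i (D (fun q ↦ D (V i) q (X q)) p (Y p))) +
      ∑ i, ∑ j, if j = i then 0 else η p (Function.update (Function.update (fun j ↦ V j p) i
        (D (V i) p (X p))) j (D (V j) p (Y p))) := by
  have hVX : ∀ i, IsSmoothFieldBase fun q ↦ D (V i) q (X q) := fun i ↦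
    isSmoothFieldBase_covariantDerivative hD (hV i) hX
  have hVY : ∀ i, IsSmoothFieldBase fun q ↦ D (V i) q (Y q) := fun i ↦
    isSmoothFieldBase_covariantDerivative hD (hV i) hY
  have hY1 : ∀ i, MDifferentiableAt (𝓡 (4 * n)) 𝓘(ℝ, ℝ)
      (formOnFields η (Function.update V i fun q ↦ D (V i) q (Y q))) p := fun i ↦
    (hη _ (isSmoothFieldBase_update hV i (hVY i))).mdifferentiable (by simp) p
  have h0 : MDifferentiableAt (𝓡 (4 * n)) 𝓘(ℝ, ℝ)
      (fun q ↦ mvfderiv (𝓡 (4 * n)) (formOnFields η V) q (Y q)) p :=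
    (contMDiffAt_mvfderiv_apply (hη V hV).contMDiffAt hY.contMDiffAt).mdifferentiableAt (by simp)
  have h1 : MDifferentiableAt (𝓡 (4 * n)) 𝓘(ℝ, ℝ)
      (fun q ↦ ∑ i, formOnFields η (Function.update V i fun q ↦ D (V i) q (Y q)) q) p :=
    (ContMDiffAt.sum fun i _ ↦ (hη _ (isSmoothFieldBase_update hV i (hVY i))).contMDiffAt
      ).mdifferentiableAt (by simp : (∞ : WithTop ℕ∞) ≠ 0)
  have e1 : mvfderiv (𝓡 (4 * n)) (formCov D Y (formOnFields η) V) p (X p) =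
      mvfderiv (𝓡 (4 * n)) (fun q ↦ mvfderiv (𝓡 (4 * n)) (formOnFields η V) q (Y q)) p (X p) -
      ∑ i, mvfderiv (𝓡 (4 * n))
        (formOnFields η (Function.update V i fun q ↦ D (V i) q (Y q))) p (X p) := by
    have := mvfderiv_fun_sub h0 h1
    rw [← mvfderiv_fun_sum hY1 (X p)]
    exact congrArg (fun L ↦ L (X p)) this
  have e2 : ∀ i, formCov D Y (formOnFields η) (Function.update V i fun q ↦ D (V i) q (X q)) p =
      mvfderiv (𝓡 (4 * n))
        (formOnFields η (Function.update V i fun q ↦ D (V i) q (X q))) p (Y p) -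
      (η p (Function.update (fun j ↦ V j p) i (D (fun q ↦ D (V i) q (X q)) p (Y p))) +
      ∑ j, if j = i then 0 else η p (Function.update (Function.update (fun j ↦ V j p) i
        (D (V i) p (X p))) j (D (V j) p (Y p)))) := by
    intro i
    rw [formCov]
    congr 1
    rw [← Finset.add_sum_erase _ _ (Finset.mem_univ i)]
    congr 1
    · rw [Function.update_self, Function.update_idem, formOnFields_update]
    · rw [← Finset.add_sum_erase _ (fun j ↦ if j = i then (0 : ℝ) else _) (Finset.mem_univ i),
        if_pos rfl, zero_add]
      refine Finset.sum_congr rfl fun j hj ↦ ?_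
      have hji : j ≠ i := Finset.ne_of_mem_erase hj
      rw [if_neg hji, formOnFields_update, Function.update_of_ne hji]
      refine congrArg (fun v ↦ η p (Function.update v j _)) (funext fun l ↦ ?_)
      by_cases h : l = i
      · subst h; simp
      · simp [h]
  rw [formCov, e1]
  simp only [e2, Finset.sum_sub_distrib, Finset.sum_add_distrib]
  ring

/-- The curvature of `D` on vector fields. -/
theorem covariantDerivative_commutator [Nontrivial (EuclideanSpace ℝ (Fin (4 * n)))]
    (hD : D.ContMDiffCovariantDerivative ∞)
    {X Y V : Π p : M, TangentSpace (𝓡 (4 * n)) p} (hX : IsSmoothFieldBase X)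
    (hY : IsSmoothFieldBase Y) (hV : IsSmoothFieldBase V) (p : M) :
    locVec (𝓡 (4 * n)) p p (D (fun q ↦ D V q (Y q)) p (X p) - D (fun q ↦ D V q (X q)) p (Y p) -
      D V p (VectorField.mlieBracket (𝓡 (4 * n)) X Y p)) =
    curvForm D p (locVec (𝓡 (4 * n)) p p (X p)) (locVec (𝓡 (4 * n)) p p (Y p))
      (locVec (𝓡 (4 * n)) p p (V p)) := by
  have hp : p ∈ trivDom (𝓡 (4 * n)) p := mem_trivDom p
  have hd : ∀ {W : Π p : M, TangentSpace (𝓡 (4 * n)) p}, IsSmoothFieldBase W → ∀ q,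
      MDifferentiableAt (𝓡 (4 * n)) ((𝓡 (4 * n)).prod 𝓘(ℝ, EuclideanSpace ℝ (Fin (4 * n))))
        (fun q ↦ TotalSpace.mk' (EuclideanSpace ℝ (Fin (4 * n)))
          (E := (TangentSpace (𝓡 (4 * n)) : M → Type _)) q (W q)) q := fun hW q ↦
    hW.contMDiffAt.mdifferentiableAt (by simp)
  have key : ∀ {A B : Π p : M, TangentSpace (𝓡 (4 * n)) p}, IsSmoothFieldBase B →
      locVec (𝓡 (4 * n)) p p (D (fun q ↦ D V q (B q)) p (A p)) =
      locCov (𝓡 (4 * n)) (ContinuousLinearMap.id ℝ (EndF n)) (christoffel D p)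
        (extChartAt (𝓡 (4 * n)) p) (fun w ↦ locCov (𝓡 (4 * n)) (ContinuousLinearMap.id ℝ (EndF n))
          (christoffel D p) (extChartAt (𝓡 (4 * n)) p)
          (fun w ↦ locVec (𝓡 (4 * n)) p w (V w)) w (B w)) p (A p) := by
    intro A B hB
    rw [locVec_covariantDerivative_eq_locCov D hp
      (hd (isSmoothFieldBase_covariantDerivative hD hV hB) p)]
    refine locCov_congr ?_ _
    filter_upwards [eventually_trivDom hp] with w hw
    exact locVec_covariantDerivative_eq_locCov D hw (hd hV w) _
  have h := locCov_commutator isLieAction_id (contMDiffAt_christoffel D hD hp)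
    (contMDiffAt_chart hp) ((contMDiffAt_vec_iff hp).1 hV.contMDiffAt) hX.contMDiffAt
    hY.contMDiffAt
  rw [map_sub, map_sub, key hY, key hX, locVec_covariantDerivative_eq_locCov D hp (hd hV p), h,
    curvForm_locVec]
  rfl

/-- The curvature of the connection induced on top-degree forms is minus the trace of the
curvature. -/
theorem formCurvature_eq [Nontrivial (EuclideanSpace ℝ (Fin (4 * n)))]
    (hD : D.ContMDiffCovariantDerivative ∞)
    {η : Π p : M, TangentSpace (𝓡 (4 * n)) p [⋀^Fin (4 * n)]→ₗ[ℝ] ℝ} (hη : IsSmoothForm η)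
    {X Y : Π p : M, TangentSpace (𝓡 (4 * n)) p} (hX : IsSmoothFieldBase X)
    (hY : IsSmoothFieldBase Y) {V : Fin (4 * n) → Π p : M, TangentSpace (𝓡 (4 * n)) p}
    (hV : ∀ i, IsSmoothFieldBase (V i)) (p : M) :
    formCurvature D X Y (formOnFields η) V p =
      -(LinearMap.trace ℝ (EuclideanSpace ℝ (Fin (4 * n)))
        (curvForm D p (locVec (𝓡 (4 * n)) p p (X p)) (locVec (𝓡 (4 * n)) p p (Y p))).toLinearMap *
        η p fun i ↦ V i p) := by
  have hp : p ∈ trivDom (𝓡 (4 * n)) p := mem_trivDom p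
  obtain ⟨T, hT⟩ := locEnd_surjective hp
    (curvForm D p (locVec (𝓡 (4 * n)) p p (X p)) (locVec (𝓡 (4 * n)) p p (Y p)))
  have hTV : ∀ i, T (V i p) = D (fun q ↦ D (V i) q (Y q)) p (X p) -
      D (fun q ↦ D (V i) q (X q)) p (Y p) -
      D (V i) p (VectorField.mlieBracket (𝓡 (4 * n)) X Y p) := by
    intro i
    have h := covariantDerivative_commutator hD hX hY (hV i) p
    rw [← hT, locEnd_locVec hp] at h
    have h' := congrArg (ofLocVec (𝓡 (4 * n)) p p) h
    rw [ofLocVec_locVec hp, ofLocVec_locVec hp] at h'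
    exact h'.symm
  have hfin : Module.Finite ℝ (TangentSpace (𝓡 (4 * n)) p) :=
    inferInstanceAs (Module.Finite ℝ (EuclideanSpace ℝ (Fin (4 * n))))
  have hk : Module.finrank ℝ (TangentSpace (𝓡 (4 * n)) p) = 4 * n := finrank_model
  have htr := AlternatingMap.sum_update_eq_trace (W := TangentSpace (𝓡 (4 * n)) p) hk (η p)
    T.toLinearMap (fun i ↦ V i p)
  have hsub : ∀ i, η p (Function.update (fun j ↦ V j p) i (T (V i p))) =
      η p (Function.update (fun j ↦ V j p) i (D (fun q ↦ D (V i) q (Y q)) p (X p))) -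
      η p (Function.update (fun j ↦ V j p) i (D (fun q ↦ D (V i) q (X q)) p (Y p))) -
      η p (Function.update (fun j ↦ V j p) i
        (D (V i) p (VectorField.mlieBracket (𝓡 (4 * n)) X Y p))) := by
    intro i
    rw [hTV, AlternatingMap.map_update_sub, AlternatingMap.map_update_sub]
  have htr' : ∑ i, η p (Function.update (fun j ↦ V j p) i (T (V i p))) = _ := htr
  simp only [hsub, Finset.sum_sub_distrib] at htr'
  have hlie := mvfderiv_mlieBracket_real (hη V hV).contMDiffAt (hX.contMDiffAt (x := p))
    hY.contMDiffAt
  have hsymm : (∑ i, ∑ j, if j = i then 0 else η p (Function.update (Function.update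
        (fun j ↦ V j p) i (D (V i) p (X p))) j (D (V j) p (Y p)))) =
      ∑ i, ∑ j, if j = i then 0 else η p (Function.update (Function.update
        (fun j ↦ V j p) i (D (V i) p (Y p))) j (D (V j) p (X p))) := by
    rw [Finset.sum_comm]
    refine Finset.sum_congr rfl fun i _ ↦ Finset.sum_congr rfl fun j _ ↦ ?_
    by_cases h : i = j
    · rw [if_pos h, if_pos h.symm]
    · rw [if_neg h, if_neg (Ne.symm h), Function.update_comm h]
  have hbr : formCov D (VectorField.mlieBracket (𝓡 (4 * n)) X Y) (formOnFields η) V p =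
      mvfderiv (𝓡 (4 * n)) (formOnFields η V) p (VectorField.mlieBracket (𝓡 (4 * n)) X Y p) -
      ∑ i, η p (Function.update (fun j ↦ V j p) i
        (D (V i) p (VectorField.mlieBracket (𝓡 (4 * n)) X Y p))) := by
    rw [formCov]
    simp only [formOnFields_update]
  rw [formCurvature, formCov_formCov hD hη hX hY hV, formCov_formCov hD hη hY hX hV, hbr, hlie,
    hsymm, ← hT, trace_locEnd hp]
  linear_combination -htr'

end AlmostQuaternionicStructure

end Quaternionic

namespace Quaternionic

namespace AlmostQuaternionicStructure

variable {n : ℕ} {M : Type*} [TopologicalSpace M] [T2Space M]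
  [ChartedSpace (EuclideanSpace ℝ (Fin (4 * n))) M] [IsManifold (𝓡 (4 * n)) ∞ M]
  {Q : AlmostQuaternionicStructure n M}
  {D : CovariantDerivative (𝓡 (4 * n)) (EuclideanSpace ℝ (Fin (4 * n)))
    (TangentSpace (𝓡 (4 * n)) : M → Type _)}

/-- There is a smooth top-degree form which does not vanish at a given point. -/
theorem exists_smooth_form (p : M) :
    ∃ η : Π p : M, TangentSpace (𝓡 (4 * n)) p [⋀^Fin (4 * n)]→ₗ[ℝ] ℝ, IsSmoothForm η ∧
      ∃ V : Fin (4 * n) → Π p : M, TangentSpace (𝓡 (4 * n)) p,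
        (∀ i, IsSmoothFieldBase (V i)) ∧ (η p fun i ↦ V i p) = 1 := by
  set b := (EuclideanSpace.basisFun (Fin (4 * n)) ℝ).toBasis with hb
  obtain ⟨f, hf, hsupp, h1⟩ := exists_cutOff (𝓡 (4 * n))
    ((isOpen_trivDom (I := 𝓡 (4 * n)) p).mem_nhds (mem_trivDom p))
  refine ⟨fun q ↦ f q • b.det.compLinearMap (locVec (𝓡 (4 * n)) p q).toLinearMap, ?_, ?_⟩
  · intro Y hY q
    by_cases hq : q ∈ trivDom (𝓡 (4 * n)) p
    · have hYl : ∀ i, ContMDiffAt (𝓡 (4 * n)) 𝓘(ℝ, EuclideanSpace ℝ (Fin (4 * n))) ∞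
          (fun w ↦ locVec (𝓡 (4 * n)) p w (Y i w)) q := fun i ↦
        (contMDiffAt_vec_iff hq).1 (hY i).contMDiffAt
      have hYc : ∀ i j, ContMDiffAt (𝓡 (4 * n)) 𝓘(ℝ, ℝ) ∞
          (fun w ↦ (locVec (𝓡 (4 * n)) p w (Y i w)) j) q := fun i j ↦
        (EuclideanSpace.proj (𝕜 := ℝ) j).contMDiff.contMDiffAt.comp q (hYl i)
      have hdet : ContMDiffAt (𝓡 (4 * n)) 𝓘(ℝ, ℝ) ∞ (fun w ↦ ∑ σ : Equiv.Perm (Fin (4 * n)),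
          ((Equiv.Perm.sign σ : ℤ) : ℝ) * ∏ i, (locVec (𝓡 (4 * n)) p w (Y i w)) (σ i)) q := by
        refine ContMDiffAt.sum fun σ _ ↦ ?_
        exact contMDiffAt_const.mul (ContMDiffAt.prod fun i _ ↦ hYc i (σ i))
      refine (hf.contMDiffAt.mul hdet).congr_of_eventuallyEq ?_
      filter_upwards with w
      change f w • b.det (fun i ↦ locVec (𝓡 (4 * n)) p w (Y i w)) = f w * _
      rw [Module.Basis.det_apply, Matrix.det_apply', smul_eq_mul]
      rfl
    · have h0 : f =ᶠ[𝓝 q] 0 := by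
        have : q ∉ tsupport f := fun h ↦ hq (hsupp h)
        exact notMem_tsupport_iff_eventuallyEq.1 this
      refine (contMDiffAt_const (c := (0 : ℝ))).congr_of_eventuallyEq ?_
      filter_upwards [h0] with w hw
      change f w • b.det (fun i ↦ locVec (𝓡 (4 * n)) p w (Y i w)) = 0
      rw [hw]; simp
  · choose V hV hVp using fun i ↦ exists_smooth_field (𝓡 (4 * n)) p (ofLocVec (𝓡 (4 * n)) p p (b i))
    refine ⟨V, hV, ?_⟩
    change f p • b.det (fun i ↦ locVec (𝓡 (4 * n)) p p (V i p)) = 1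
    simp only [hVp, locVec_ofLocVec (mem_trivDom p)]
    rw [h1.self_of_nhds, b.det_self]
    simp

/-- `D` is self-dual if and only if the trace of its curvature is `Q`-hermitian. -/
theorem isSelfDual_iff (hD : Q.IsQuaternionicConnection D) :
    Q.IsSelfDual D ↔ ∀ (p : M) (j : EndT (𝓡 (4 * n)) p), j ∈ Q.fiber p → j * j = -1 →
      ∀ x y : EuclideanSpace ℝ (Fin (4 * n)),
        LinearMap.trace ℝ (EuclideanSpace ℝ (Fin (4 * n)))
          (curvForm D p (locEnd (𝓡 (4 * n)) p p j x) (locEnd (𝓡 (4 * n)) p p j y)).toLinearMap =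
        LinearMap.trace ℝ (EuclideanSpace ℝ (Fin (4 * n))) (curvForm D p x y).toLinearMap := by
  have := Q.nontrivial_model
  constructor
  · intro h p j hj hj2 x y
    have hp : p ∈ trivDom (𝓡 (4 * n)) p := mem_trivDom p
    obtain ⟨η, hη, V, hV, hηV⟩ := exists_smooth_form (n := n) p
    obtain ⟨X, hX, hXp⟩ := exists_smooth_field (𝓡 (4 * n)) p (ofLocVec (𝓡 (4 * n)) p p x)
    obtain ⟨Y, hY, hYp⟩ := exists_smooth_field (𝓡 (4 * n)) p (ofLocVec (𝓡 (4 * n)) p p y)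
    obtain ⟨X', hX', hXX⟩ := exists_smooth_field (𝓡 (4 * n)) p (j (X p))
    obtain ⟨Y', hY', hYY⟩ := exists_smooth_field (𝓡 (4 * n)) p (j (Y p))
    have h1 := h X Y X' Y' hX hY hX' hY' η hη V hV p j hj hj2 hXX hYY
    rw [formCurvature_eq hD.smooth hη hX' hY' hV, formCurvature_eq hD.smooth hη hX hY hV, hXX, hYY,
      ← locEnd_locVec hp, ← locEnd_locVec hp, hXp, hYp, locVec_ofLocVec hp, locVec_ofLocVec hp,
      hηV, mul_one, mul_one, neg_inj] at h1
    exact h1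
  · intro h X Y X' Y' hX hY hX' hY' η hη V hV p j hj hj2 hXX hYY
    have hp : p ∈ trivDom (𝓡 (4 * n)) p := mem_trivDom p
    rw [formCurvature_eq hD.smooth hη hX' hY' hV, formCurvature_eq hD.smooth hη hX hY hV, hXX, hYY,
      ← locEnd_locVec hp, ← locEnd_locVec hp, h p j hj hj2]

end AlmostQuaternionicStructure

end Quaternionic

end

theorem proposition3p1 {n : ℕ} {M : Type*} [TopologicalSpace M] [T2Space M]
    [SecondCountableTopology M] [ChartedSpace (EuclideanSpace ℝ (Fin (4 * n))) M]
    [IsManifold (𝓡 (4 * n)) ∞ M] (Q : Quaternionic.AlmostQuaternionicStructure n M)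
    (D₀ : CovariantDerivative (𝓡 (4 * n)) (EuclideanSpace ℝ (Fin (4 * n)))
      (TangentSpace (𝓡 (4 * n)) : M → Type _)) (hD₀ : Q.IsQuaternionicConnection D₀)
    (D : CovariantDerivative (𝓡 (4 * n)) (EuclideanSpace ℝ (Fin (4 * n)))
      (TangentSpace (𝓡 (4 * n)) : M → Type _)) (hD : Q.IsQuaternionicConnection D) :
    Q.IsHermitianConnection (Q.thetaCov D) ∧
      (Q.IsChernConnection (Q.thetaCov D) (Q.twistorJ D₀) ↔ Q.IsSelfDual D) := by
  exact ⟨Quaternionic.AlmostQuaternionicStructure.isHermitianConnection_thetaCov hD,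
    (Quaternionic.AlmostQuaternionicStructure.isChernConnection_thetaCov_iff hD₀ hD).trans
      (Quaternionic.AlmostQuaternionicStructure.isSelfDual_iff hD).symm⟩
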